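/- Consider the stationary incompressible Navier–Stokes equations in $\mathbb R^3$, $$-\Delta u+u\cdot\nabla u+\nabla p=0,\qquad \operatorname{div}u=0. \tag{1}$$ Use polar coordinates $(r,\theta,\phi)$, with $\theta$ the angle to the positive $x_3$-axis, $\phi$ the meridian angle and orthonormal frame $e_r,e_\theta,e_\phi$, and write $u=u_re_r+u_\theta e_\theta+u_\phi e_\phi$. Let $S=(0,0,-1)$ be the south pole of $\mathbb S^2$. By an axisymmetric solution of (1) in $C^\infty(\mathbb S^2\setminus\{S\})$ we mean a pair $(u,p)$ of $C^\infty$ functions on $\mathbb R^3\setminus\{(0,0,x_3): x_3\le 0\}$ satisfying (1) there, where $u$ is $(-1)$-homogeneous, $p$ is $(-2)$-homogeneous, and $u_r,u_\theta,u_\phi$ do not depend on $\phi$. For such a solution put, on the unit sphere and with $x=\cos\theta$, $U_\theta(x)=u_\theta\sin\theta$ and $U_\phi(x)=u_\phi\sin\theta$ for $-1<x\le 1$, and $U_\theta(-1):=\lim_{x\to-1^+}U_\theta(x)$; the solution has zero swirl if $U_\phi\equiv0$, and nonzero swirl otherwise. (a) For every real $\tau<3$ there exists an axisymmetric solution of (1)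 in $C^\infty(\mathbb S^2\setminus\{S\})$ with nonzero swirl and $U_\theta(-1)=\tau$. (b) For every axisymmetric solution of (1) in $C^\infty(\mathbb S^2\setminus\{S\})$ the limit $U_\theta(-1)$ exists and is finite, and if $U_\theta(-1)\ge3$, then the solution has zero swirl, i.e. $U_\phi\equiv0$. -/

import Mathlib

open Set Filter Topology
open scoped ContDiff

noncomputable section

namespace AxisymNS

/-- Euclidean three-space. -/
abbrev R3 : Type := EuclideanSpace ℝ (Fin 3)

/-- The cone over the unit sphere minus its south pole: `ℝ³ ∖ {(0, 0, x₃) | x₃ ≤ 0}`. -/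
def slitSpace : Set R3 := {y | ¬ (y 0 = 0 ∧ y 1 = 0 ∧ y 2 ≤ 0)}

/-- The radial unit vector of the polar frame. -/
def eR (θ φ : ℝ) : R3 :=
  !₂[Real.sin θ * Real.cos φ, Real.sin θ * Real.sin φ, Real.cos θ]

/-- The polar unit vector of the polar frame. -/
def eTheta (θ φ : ℝ) : R3 :=
  !₂[Real.cos θ * Real.cos φ, Real.cos θ * Real.sin φ, -Real.sin θ]

/-- The azimuthal unit vector of the polar frame. -/
def ePhi (φ : ℝ) : R3 := !₂[-Real.sin φ, Real.cos φ, 0]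

/-- The component `u_r` at the point with polar coordinates `(r, θ, φ)`. -/
def compR (u : R3 → R3) (r θ φ : ℝ) : ℝ := inner ℝ (u (r • eR θ φ)) (eR θ φ)

/-- The component `u_θ` at the point with polar coordinates `(r, θ, φ)`. -/
def compTheta (u : R3 → R3) (r θ φ : ℝ) : ℝ := inner ℝ (u (r • eR θ φ)) (eTheta θ φ)

/-- The component `u_φ` at the point with polar coordinates `(r, θ, φ)`. -/
def compPhi (u : R3 → R3) (r θ φ : ℝ) : ℝ := inner ℝ (u (r • eR θ φ)) (ePhi φ)

/-- The polar components of `u` depend only on `r` and `θ`. -/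
def IsAxisymmetric (u : R3 → R3) : Prop :=
  ∀ r : ℝ, 0 < r → ∀ θ ∈ Ioo 0 Real.pi, ∀ φ φ' : ℝ,
    compR u r θ φ = compR u r θ φ' ∧
    compTheta u r θ φ = compTheta u r θ φ' ∧
    compPhi u r θ φ = compPhi u r θ φ'

/-- The divergence `∑ᵢ ∂ᵢ uᵢ`. -/
def divergence (u : R3 → R3) (y : R3) : ℝ :=
  ∑ i : Fin 3, fderiv ℝ u y (EuclideanSpace.single i 1) i

/-- The stationary incompressible Navier–Stokes equations at every point of `D`:
`-Δu + (u · ∇)u + ∇p = 0` and `div u = 0`. -/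
def SolvesNavierStokes (u : R3 → R3) (p : R3 → ℝ) (D : Set R3) : Prop :=
  ∀ y ∈ D, -Laplacian.laplacian u y + fderiv ℝ u y (u y) + gradient p y = 0 ∧
    divergence u y = 0

/-- `(u, p)` is an axisymmetric solution in `C^∞(𝕊² ∖ {S})`: the velocity is `(-1)`-homogeneous and
axisymmetric, the pressure is `(-2)`-homogeneous, both are smooth away from the closed negative
`x₃`-axis, and they satisfy the stationary Navier–Stokes equations there. -/
structure IsAxisymmetricSolution (u : R3 → R3) (p : R3 → ℝ) : Prop where
  smooth_velocity : ContDiffOn ℝ ∞ u slitSpace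
  smooth_pressure : ContDiffOn ℝ ∞ p slitSpace
  homogeneous_velocity : ∀ y ∈ slitSpace, ∀ c : ℝ, 0 < c → u (c • y) = c⁻¹ • u y
  homogeneous_pressure : ∀ y ∈ slitSpace, ∀ c : ℝ, 0 < c → p (c • y) = (c ^ 2)⁻¹ * p y
  axisymmetric : IsAxisymmetric u
  equations : SolvesNavierStokes u p slitSpace

/-- `U_θ = u_θ sin θ` on the unit sphere, as a function of `x = cos θ`. For axisymmetric `u` the
value does not depend on the meridian, which is taken to be `φ = 0`. -/
def UTheta (u : R3 → R3) (x : ℝ) : ℝ :=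
  compTheta u 1 (Real.arccos x) 0 * Real.sin (Real.arccos x)

/-- `U_φ = u_φ sin θ` on the unit sphere, as a function of `x = cos θ`. -/
def UPhi (u : R3 → R3) (x : ℝ) : ℝ :=
  compPhi u 1 (Real.arccos x) 0 * Real.sin (Real.arccos x)

/-- `U_θ(-1) = a`, that is, `U_θ(x) → a` as `x → -1⁺`. -/
def UThetaAtSouth (u : R3 → R3) (a : ℝ) : Prop :=
  Tendsto (UTheta u) (𝓝[>] (-1)) (𝓝 a)

end AxisymNS

end

/-! Write x = cos θ, f = U_θ, g = U_φ. For homogeneous axisymmetric fields the system reduces to two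
ordinary differential equations on (-1, 1): (1 - x²) g'' + f g' = 0 and H''' = -2 g g' / (1 - x²),
where H = (1 - x²) f' + 2 x f + f² / 2. The passage from a solution to these equations is
`IsAxisymmetricSolution.profileEquations`; the way back, for profiles smooth across the north pole,
is `IsProfile.isAxisymmetricSolution`. Throughout, y = 1 + x, so that the south pole is y = 0 and
the north pole y = 2.

Why 3 is the threshold: if f tends to a > 2 at the south pole, a nonzero g' behaves like y^(-a/2),
hence g like y^(1 - a/2) and H''' like y^(-a). This is compatible with a bounded H only for a < 3;
at a = 3 the divergence is logarithmic.

Part (b). The swirl equation is linear of first order in g', so g' has one sign; smoothness at the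
north pole makes g tend to 0 there. After replacing g by -g if necessary, g' ≥ 0 ≥ g and H''' ≥ 0.
Then H is monotone near the south pole up to a quadratic polynomial, hence bounded above. Reading
the definition of H as a Riccati equation for f, this bounds f from both sides (`Riccati.bddBelow`,
`Riccati.bddAbove`); boundedness of f in turn bounds H from below, and both f and H converge
(`Riccati.tendsto_inhomogeneity`, `Riccati.tendsto_solution`). If the limit of f is at least 3, then
f ≥ 3 - c y, and a nonzero swirl would force H to -∞ like log y (`Riccati.not_pos_swirl`).

Part (a). Put f = (1 - x)(m + w(y)) with m = τ / 2 < 3/2. The factor (1 - x)² divides out of the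
equation for H and leaves y w' = (1 - m) w + e κ[w] - w² / 2, where e > 0 measures the square of the
swirl and κ[w] is a nonlocal functional. For m < 3/2 it is O(y^α) with some α > 0, with Lipschitz
dependence on w (`Exponents.lipBd_swirlKernel`), so for small e the equation is solved by
contraction among functions O(y^α) (`exists_reduced_solution`). All integrals from y to 2 are
written as averages over that segment, which keeps every function smooth on 0 < y < 3, hence across
the north pole (`exists_swirling_profile`). -/

namespace AxisymNS

/-! ### Barriers, monotonicity and logarithmic growth on (0, b]. -/

/-- A level `c` which `φ` can only cross upwards is not exceeded to the left of a point where
`φ ≤ c`. -/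
lemma le_of_upward_crossing {φ φ' : ℝ → ℝ} {b c : ℝ}
    (hd : ∀ y ∈ Ioc 0 b, HasDerivAt φ (φ' y) y) (h0 : φ b ≤ c)
    (hb : ∀ y ∈ Ioc 0 b, φ y = c → 0 < φ' y) : ∀ y ∈ Ioc 0 b, φ y ≤ c := by
  intro y hy
  have hmem : ∀ t ∈ Icc (-b) (-y), -t ∈ Ioc 0 b := fun t ht =>
    ⟨by linarith [ht.2, hy.1], by linarith [ht.1]⟩
  have hder : ∀ t ∈ Icc (-b) (-y), HasDerivAt (fun t => φ (-t)) (-φ' (-t)) t := by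
    intro t ht
    exact ((hd _ (hmem t ht)).scomp t (hasDerivAt_neg t)).congr_deriv (by simp)
  have := image_le_of_deriv_right_lt_deriv_boundary' (f := fun t => φ (-t))
    (f' := fun t => -φ' (-t)) (a := -b) (b := -y) (B := fun _ => c) (B' := fun _ => 0)
    (fun t ht => (hder t ht).continuousAt.continuousWithinAt)
    (fun t ht => (hder t (Ico_subset_Icc_self ht)).hasDerivWithinAt)
    (by simpa using h0) continuousOn_const (fun t _ => hasDerivWithinAt_const _ _ _)
    (fun t ht he => by
      have := hb _ (hmem t (Ico_subset_Icc_self ht)) he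
      linarith)
  have h := this (x := -y) ⟨by linarith [hy.2], le_rfl⟩
  simpa using h

lemma monotoneOn_Ioc_of_deriv {φ φ' : ℝ → ℝ} {b : ℝ}
    (hd : ∀ y ∈ Ioc 0 b, HasDerivAt φ (φ' y) y) (hn : ∀ y ∈ Ioc 0 b, 0 ≤ φ' y) :
    MonotoneOn φ (Ioc 0 b) := by
  refine monotoneOn_of_deriv_nonneg (convex_Ioc _ _)
    (fun y hy => (hd y hy).continuousAt.continuousWithinAt) ?_ ?_
  · intro y hy
    exact (hd y (interior_subset hy)).differentiableAt.differentiableWithinAt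
  · intro y hy
    rw [(hd y (interior_subset hy)).deriv]
    exact hn y (interior_subset hy)

lemma antitoneOn_Ioc_of_deriv {φ φ' : ℝ → ℝ} {b : ℝ}
    (hd : ∀ y ∈ Ioc 0 b, HasDerivAt φ (φ' y) y) (hn : ∀ y ∈ Ioc 0 b, φ' y ≤ 0) :
    AntitoneOn φ (Ioc 0 b) := by
  have := monotoneOn_Ioc_of_deriv (φ := fun y => -φ y) (φ' := fun y => -φ' y)
    (fun y hy => (hd y hy).neg) (fun y hy => by linarith [hn y hy])
  intro x hx y hy hxy
  have := this hx hy hxy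
  simp only at this
  linarith

/-- A function whose third derivative is nonnegative on `(0, b]` becomes monotone after subtracting
a quadratic polynomial without constant term. -/
lemma exists_monotone_sub_quadratic {h h₁ h₂ h₃ : ℝ → ℝ} {b : ℝ} (hb : 0 < b)
    (d1 : ∀ y ∈ Ioc 0 b, HasDerivAt h (h₁ y) y) (d2 : ∀ y ∈ Ioc 0 b, HasDerivAt h₁ (h₂ y) y)
    (d3 : ∀ y ∈ Ioc 0 b, HasDerivAt h₂ (h₃ y) y) (hn : ∀ y ∈ Ioc 0 b, 0 ≤ h₃ y) :
    ∃ k l : ℝ, MonotoneOn (fun y => h y - (k * y ^ 2 + l * y)) (Ioc 0 b) := by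
  have hbb : b ∈ Ioc 0 b := ⟨hb, le_rfl⟩
  have m2 := monotoneOn_Ioc_of_deriv d3 hn
  have m1 : AntitoneOn (fun y => h₁ y - h₂ b * y) (Ioc 0 b) := by
    refine antitoneOn_Ioc_of_deriv (φ' := fun y => h₂ y - h₂ b) (fun y hy => ?_) (fun y hy => ?_)
    · exact ((d2 y hy).fun_sub ((hasDerivAt_id' y).const_mul (h₂ b))).congr_deriv (by ring)
    · have := m2 hy hbb hy.2
      linarith
  refine ⟨h₂ b / 2, h₁ b - h₂ b * b, ?_⟩
  refine monotoneOn_Ioc_of_deriv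
    (φ' := fun y => h₁ y - (h₂ b / 2 * (2 * y) + (h₁ b - h₂ b * b))) (fun y hy => ?_)
    (fun y hy => ?_)
  · have := ((hasDerivAt_pow 2 y).const_mul (h₂ b / 2)).fun_add
      ((hasDerivAt_id' y).const_mul (h₁ b - h₂ b * b))
    exact ((d1 y hy).fun_sub this).congr_deriv (by simp)
  · have := m1 hy hbb hy.2
    simp only at this
    linarith

/-- Up to a quadratic polynomial the function increases away from 0, so its value at b controls it
from above. This is how the sign of the swirl source enters. -/
lemma bddAbove_of_third_deriv_nonneg {h h₁ h₂ h₃ : ℝ → ℝ} {b : ℝ} (hb : 0 < b)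
    (d1 : ∀ y ∈ Ioc 0 b, HasDerivAt h (h₁ y) y) (d2 : ∀ y ∈ Ioc 0 b, HasDerivAt h₁ (h₂ y) y)
    (d3 : ∀ y ∈ Ioc 0 b, HasDerivAt h₂ (h₃ y) y) (hn : ∀ y ∈ Ioc 0 b, 0 ≤ h₃ y) :
    ∃ C, ∀ y ∈ Ioc 0 b, h y ≤ C := by
  obtain ⟨k, l, hm⟩ := exists_monotone_sub_quadratic hb d1 d2 d3 hn
  refine ⟨h b - (k * b ^ 2 + l * b) + (|k| * b ^ 2 + |l| * b), fun y hy => ?_⟩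
  have := hm hy ⟨hb, le_rfl⟩ hy.2
  simp only at this
  have h1 : k * y ^ 2 ≤ |k| * b ^ 2 :=
    mul_le_mul (le_abs_self k) (pow_le_pow_left₀ hy.1.le hy.2 2) (by positivity) (abs_nonneg k)
  have h2 : l * y ≤ |l| * b := mul_le_mul (le_abs_self l) hy.2 hy.1.le (abs_nonneg l)
  linarith

/-- If `y φ'(y) ≤ -η < 0` near `0`, then `φ` is unbounded near `0`. -/
lemma not_bddAbove_of_mul_deriv_le {φ φ' : ℝ → ℝ} {b η : ℝ} (hb : 0 < b) (hη : 0 < η)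
    (hd : ∀ y ∈ Ioc 0 b, HasDerivAt φ (φ' y) y) (hn : ∀ y ∈ Ioc 0 b, y * φ' y ≤ -η) (C : ℝ) :
    ∃ y ∈ Ioc 0 b, C < φ y := by
  have ha : AntitoneOn (fun y => φ y + η * Real.log y) (Ioc 0 b) := by
    refine antitoneOn_Ioc_of_deriv (φ' := fun y => φ' y + η * y⁻¹) (fun y hy => ?_) (fun y hy => ?_)
    · exact (hd y hy).add ((Real.hasDerivAt_log hy.1.ne').const_mul η)
    · have := hn y hy
      have hy0 := hy.1
      have : y * (φ' y + η * y⁻¹) ≤ 0 := by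
        rw [mul_add, mul_comm η, ← mul_assoc, mul_inv_cancel₀ hy0.ne']
        linarith
      exact nonpos_of_mul_nonpos_right this hy0
  have ht : Tendsto (fun y => φ b + η * Real.log b - η * Real.log y) (𝓝[>] 0) atTop := by
    have h1 : Tendsto (fun y => η * Real.log y) (𝓝[>] 0) atBot :=
      Real.tendsto_log_nhdsGT_zero.const_mul_atBot hη
    have h2 := tendsto_neg_atBot_atTop.comp h1
    simpa [sub_eq_add_neg, Function.comp_def] using
      tendsto_atTop_add_const_left _ (φ b + η * Real.log b) h2
  obtain ⟨y, hy, hyb⟩ := ((ht.eventually_gt_atTop C).and (Ioc_mem_nhdsGT hb)).exists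
  refine ⟨y, hyb, ?_⟩
  have := ha hyb ⟨hb, le_rfl⟩ hyb.2
  simp only at this
  linarith

/-! ### The Riccati equation near the south pole. -/

/-- The Riccati equation `y (2 - y) F' = 2 (1 - y) F - F² / 2 + h` on `(0, 1]`. -/
def Riccati (F F' h : ℝ → ℝ) : Prop :=
  ∀ y ∈ Ioc (0 : ℝ) 1, HasDerivAt F (F' y) y ∧
    y * (2 - y) * F' y = 2 * (1 - y) * F y - F y ^ 2 / 2 + h y

/-- At a level -B with B² > 2 C the term -F²/2 beats the inhomogeneity and F' < 0, so F cannot drop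
below -B when y moves left from 1. -/
lemma Riccati.bddBelow {F F' h : ℝ → ℝ} (H : Riccati F F' h) {C : ℝ}
    (hC : ∀ y ∈ Ioc (0 : ℝ) 1, h y ≤ C) : ∃ B, ∀ y ∈ Ioc (0 : ℝ) 1, B ≤ F y := by
  obtain ⟨B, hB0, hB1, hB2⟩ : ∃ B : ℝ, 0 ≤ B ∧ -F 1 ≤ B ∧ 2 * C < B ^ 2 := by
    refine ⟨|F 1| + |C| + 1, by positivity, ?_, ?_⟩
    · linarith [neg_abs_le (F 1), abs_nonneg C]
    · nlinarith [abs_nonneg (F 1), abs_nonneg C, le_abs_self C, sq_abs C]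
  refine ⟨-B, ?_⟩
  have := le_of_upward_crossing (φ := fun y => -F y) (φ' := fun y => -F' y) (b := 1) (c := B)
    (fun y hy => (H y hy).1.neg) hB1 (fun y hy he => ?_)
  · intro y hy
    linarith [this y hy]
  · have h1 := (H y hy).2
    have h2 : F y = -B := by linarith
    rw [h2] at h1
    have h3 := hC y hy
    have h4 : 0 < y * (2 - y) := mul_pos hy.1 (by linarith [hy.2])
    have h5 : 0 ≤ (1 - y) * B := mul_nonneg (by linarith [hy.2]) hB0
    have h6 : y * (2 - y) * F' y < 0 := by nlinarith
    have := neg_of_mul_neg_right h6 h4.le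
    linarith

/-- Above a large level the quadratic term dominates and y F' ≤ -F²/8. A solution that exceeds this
level at b stays above it to the left, where y (-1/F)' ≤ -1/8 would push -1/F above 0 through
logarithmic growth. -/
lemma Riccati.bddAbove {F F' h : ℝ → ℝ} (H : Riccati F F' h) {C : ℝ}
    (hC : ∀ y ∈ Ioc (0 : ℝ) 1, h y ≤ C) : ∃ B, ∀ y ∈ Ioc (0 : ℝ) 1, F y ≤ B := by
  set B := 16 + 8 * |C| with hB
  have hBC : ∀ v : ℝ, B ≤ v → 2 * v + C ≤ v ^ 2 / 4 := by
    intro v hv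
    nlinarith [abs_nonneg C, le_abs_self C]
  have hB16 : 16 ≤ B := by linarith [abs_nonneg C]
  refine ⟨B, ?_⟩
  by_contra! hcon
  obtain ⟨b, hb, hFb⟩ := hcon
  have hsub : ∀ y ∈ Ioc 0 b, y ∈ Ioc (0 : ℝ) 1 := fun y hy => ⟨hy.1, hy.2.trans hb.2⟩
  have key : ∀ y ∈ Ioc 0 b, B ≤ F y → y * F' y ≤ -(F y ^ 2 / 8) := by
    intro y hy hBy
    have hy' := hsub y hy
    have h1 := (H y hy').2
    have h3 := hC y hy'
    have h2 := hBC _ hBy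
    have h4 : 0 ≤ y * F y := mul_nonneg hy.1.le (by linarith)
    have h5 : (2 - y) * (y * F' y) ≤ -(F y ^ 2 / 4) := by nlinarith
    by_contra! hlt
    nlinarith [hy'.1, hy'.2, sq_nonneg (F y)]
  have hge : ∀ y ∈ Ioc 0 b, B ≤ F y := by
    have := le_of_upward_crossing (φ := fun y => -F y) (φ' := fun y => -F' y) (b := b) (c := -B)
      (fun y hy => (H y (hsub y hy)).1.neg) (by simpa using hFb.le) (fun y hy he => ?_)
    · intro y hy
      linarith [this y hy]
    · have h1 := key y hy (by linarith)
      have h2 : F y = B := by linarith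
      rw [h2] at h1
      have : y * F' y < 0 := by nlinarith
      have := neg_of_mul_neg_right this hy.1.le
      linarith
  obtain ⟨y, hy, hlt⟩ := not_bddAbove_of_mul_deriv_le (φ := fun y => -(F y)⁻¹)
    (φ' := fun y => F' y / F y ^ 2) (b := b) (η := 1 / 8) hb.1 (by norm_num)
    (fun y hy => by
      have hF : F y ≠ 0 := by linarith [hge y hy]
      exact ((H y (hsub y hy)).1.fun_inv hF).fun_neg.congr_deriv (by ring))
    (fun y hy => by
      have hF : 0 < F y := by linarith [hge y hy]
      rw [← mul_div_assoc, div_le_iff₀ (by positivity)]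
      linarith [key y hy (hge y hy)]) 0
  have hF : 0 < F y := by linarith [hge y hy]
  have : 0 < (F y)⁻¹ := inv_pos.2 hF
  linarith

lemma exists_Ioc_of_eventually {p : ℝ → Prop} (h : ∀ᶠ y in 𝓝[>] (0 : ℝ), p y) :
    ∃ b ∈ Ioc (0 : ℝ) 1, ∀ y ∈ Ioc 0 b, p y := by
  obtain ⟨c, hc, hcp⟩ := mem_nhdsGT_iff_exists_Ioc_subset.1 h
  exact ⟨min c 1, ⟨lt_min hc one_pos, min_le_right _ _⟩,
    fun y hy => hcp ⟨hy.1, hy.2.trans (min_le_left _ _)⟩⟩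

/-- If the inhomogeneity of the Riccati equation has nonnegative third derivative, then it
converges at `0`, at least linearly from below. -/
lemma Riccati.tendsto_inhomogeneity {F F' h h₁ h₂ h₃ : ℝ → ℝ} (H : Riccati F F' h)
    (d1 : ∀ y ∈ Ioc (0 : ℝ) 1, HasDerivAt h (h₁ y) y)
    (d2 : ∀ y ∈ Ioc (0 : ℝ) 1, HasDerivAt h₁ (h₂ y) y)
    (d3 : ∀ y ∈ Ioc (0 : ℝ) 1, HasDerivAt h₂ (h₃ y) y)
    (hn : ∀ y ∈ Ioc (0 : ℝ) 1, 0 ≤ h₃ y) :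
    ∃ L C : ℝ, 0 ≤ C ∧ Tendsto h (𝓝[>] 0) (𝓝 L) ∧ ∀ y ∈ Ioc (0 : ℝ) 1, L - C * y ≤ h y := by
  obtain ⟨C, hC⟩ := bddAbove_of_third_deriv_nonneg one_pos d1 d2 d3 hn
  obtain ⟨B, hB⟩ := H.bddAbove hC
  obtain ⟨k, l, hm⟩ := exists_monotone_sub_quadratic one_pos d1 d2 d3 hn
  have hkl : ∀ y ∈ Ioc (0 : ℝ) 1, |k * y ^ 2 + l * y| ≤ (|k| + |l|) * y := by
    intro y hy
    have h1 : y ^ 2 ≤ y := by nlinarith [hy.1, hy.2]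
    calc |k * y ^ 2 + l * y| ≤ |k * y ^ 2| + |l * y| := abs_add_le _ _
      _ = |k| * y ^ 2 + |l| * y := by
        rw [abs_mul, abs_mul, abs_of_pos hy.1, abs_of_nonneg (sq_nonneg y)]
      _ ≤ |k| * y + |l| * y := by gcongr
      _ = _ := by ring
  -- If the monotone function fell below this level at b, then h ≤ -4 to the left of b. Completing
  -- the square in F gives a right-hand side at most -2, hence y F' ≤ -1, and F would be unbounded
  -- above.
  have hbdd : BddBelow ((fun y => h y - (k * y ^ 2 + l * y)) '' Ioo 0 1) := by
    refine ⟨-(|k| + |l|) - 4, ?_⟩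
    rintro _ ⟨b, hb, rfl⟩
    by_contra! hlt
    have hsub : ∀ y ∈ Ioc 0 b, y ∈ Ioc (0 : ℝ) 1 := fun y hy => ⟨hy.1, hy.2.trans hb.2.le⟩
    have key : ∀ y ∈ Ioc 0 b, y * F' y ≤ -1 := by
      intro y hy
      have hy' := hsub y hy
      have h1 := hm hy' ⟨hb.1, hb.2.le⟩ hy.2
      have h2 := (abs_le.1 (hkl y hy')).2
      have h3 : (|k| + |l|) * y ≤ |k| + |l| := mul_le_of_le_one_right (by positivity) hy'.2
      simp only at h1 hlt
      have h4 : h y ≤ -4 := by linarith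
      have h5 := (H y hy').2
      have h6 : 2 * (1 - y) * F y ≤ F y ^ 2 / 2 + 2 := by
        nlinarith [sq_nonneg (F y - 2 * (1 - y)), hy'.1, hy'.2]
      have h7 : (2 - y) * (y * F' y) ≤ -2 := by linarith
      by_contra! hlt'
      nlinarith [hy'.1, hy'.2]
    obtain ⟨y, hy, hBy⟩ := not_bddAbove_of_mul_deriv_le hb.1 one_pos
      (fun y hy => (H y (hsub y hy)).1) key B
    linarith [hB y (hsub y hy)]
  have hlim := MonotoneOn.tendsto_nhdsWithin_Ioo_right (by simp : (Ioo (0 : ℝ) 1).Nonempty)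
    (hm.mono Ioo_subset_Ioc_self) hbdd
  set L := sInf ((fun y => h y - (k * y ^ 2 + l * y)) '' Ioo 0 1)
  refine ⟨L, |k| + |l|, by positivity, ?_, fun y hy => ?_⟩
  · have h0 : Tendsto (fun y : ℝ => k * y ^ 2 + l * y) (𝓝[>] 0) (𝓝 0) := by
      have : Continuous fun y : ℝ => k * y ^ 2 + l * y := by fun_prop
      simpa using (this.tendsto 0).mono_left nhdsWithin_le_nhds
    simpa using hlim.add h0
  -- The infimum runs over the open interval, which misses y = 1; evaluating at y / 2 and using
  -- monotonicity covers that point too.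
  · have hhalf : y / 2 ∈ Ioo (0 : ℝ) 1 := ⟨by linarith [hy.1], by linarith [hy.2]⟩
    have h1 : L ≤ _ := csInf_le hbdd ⟨y / 2, hhalf, rfl⟩
    have h2 := hm (Ioo_subset_Ioc_self hhalf) hy (by linarith [hy.1])
    have h3 := (abs_le.1 (hkl y hy)).1
    simp only at h1 h2
    linarith

/-- Bounded solutions of the Riccati equation with convergent inhomogeneity converge. -/
lemma Riccati.tendsto_solution {F F' h : ℝ → ℝ} {L A B : ℝ} (H : Riccati F F' h)
    (hL : Tendsto h (𝓝[>] 0) (𝓝 L)) (hA : ∀ y ∈ Ioc (0 : ℝ) 1, A ≤ F y)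
    (hB : ∀ y ∈ Ioc (0 : ℝ) 1, F y ≤ B) :
    ∃ a, Tendsto F (𝓝[>] 0) (𝓝 a) ∧ L = a ^ 2 / 2 - 2 * a := by
  have hmem : ∀ᶠ y in 𝓝[>] (0 : ℝ), y ∈ Ioc (0 : ℝ) 1 := Ioc_mem_nhdsGT one_pos
  have hid : Tendsto (fun y : ℝ => y) (𝓝[>] 0) (𝓝 0) := tendsto_id.mono_left nhdsWithin_le_nhds
  have hrhs : ∀ c, Tendsto (fun y => 2 * (1 - y) * c - c ^ 2 / 2 + h y) (𝓝[>] 0)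
      (𝓝 (2 * (1 - 0) * c - c ^ 2 / 2 + L)) := fun c =>
    ((((hid.const_sub 1).const_mul 2).mul_const c).sub_const _).add hL
  have hconv : ∃ a, Tendsto F (𝓝[>] 0) (𝓝 a) := by
    refine tendsto_of_no_upcrossings dense_univ ?_ ?_ ?_
    · rintro a - b - hab ⟨ha, hb⟩
      -- The limiting right-hand side is quadratic in c with leading coefficient -1/2, so it cannot
      -- vanish at three levels. At a level where it is nonzero, F' has a fixed sign at all
      -- crossings near 0, and F cannot oscillate around it.
      obtain ⟨c, hc, hc0⟩ : ∃ c ∈ Ioo a b, 2 * (1 - 0) * c - c ^ 2 / 2 + L ≠ 0 := by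
        by_contra! hcon
        have h1 := hcon ((a + b) / 2) ⟨by linarith, by linarith⟩
        have h2 := hcon ((3 * a + b) / 4) ⟨by linarith, by linarith⟩
        have h3 := hcon ((a + 3 * b) / 4) ⟨by linarith, by linarith⟩
        nlinarith [mul_pos (sub_pos.2 hab) (sub_pos.2 hab)]
      rcases lt_or_gt_of_ne hc0 with hneg | hpos
      · obtain ⟨b₁, hb₁, hev⟩ := exists_Ioc_of_eventually ((hrhs c).eventually_lt_const hneg)
        obtain ⟨b₂, hFb, hb₂⟩ := (hb.and_eventually (Ioc_mem_nhdsGT hb₁.1)).exists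
        have hsub : ∀ y ∈ Ioc 0 b₂, y ∈ Ioc 0 b₁ := fun y hy => ⟨hy.1, hy.2.trans hb₂.2⟩
        have hsub' : ∀ y ∈ Ioc 0 b₂, y ∈ Ioc (0 : ℝ) 1 := fun y hy =>
          ⟨hy.1, (hsub y hy).2.trans hb₁.2⟩
        have := le_of_upward_crossing (φ := fun y => -F y) (φ' := fun y => -F' y) (b := b₂)
          (c := -c) (fun y hy => (H y (hsub' y hy)).1.neg) (by linarith [hc.2]) (fun y hy he => ?_)
        · obtain ⟨y, hya, hy⟩ := (ha.and_eventually (Ioc_mem_nhdsGT hb₂.1)).exists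
          linarith [this y hy, hc.1]
        · have h1 := (H y (hsub' y hy)).2
          have h2 : F y = c := by linarith
          rw [h2] at h1
          have h3 := hev y (hsub y hy)
          rw [← h1] at h3
          have h4 : 0 < y * (2 - y) := mul_pos hy.1 (by linarith [(hsub' y hy).2])
          linarith [neg_of_mul_neg_right h3 h4.le]
      · obtain ⟨b₁, hb₁, hev⟩ := exists_Ioc_of_eventually ((hrhs c).eventually_const_lt hpos)
        obtain ⟨b₂, hFb, hb₂⟩ := (ha.and_eventually (Ioc_mem_nhdsGT hb₁.1)).exists
        have hsub : ∀ y ∈ Ioc 0 b₂, y ∈ Ioc 0 b₁ := fun y hy => ⟨hy.1, hy.2.trans hb₂.2⟩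
        have hsub' : ∀ y ∈ Ioc 0 b₂, y ∈ Ioc (0 : ℝ) 1 := fun y hy =>
          ⟨hy.1, (hsub y hy).2.trans hb₁.2⟩
        have := le_of_upward_crossing (φ := F) (φ' := F') (b := b₂)
          (c := c) (fun y hy => (H y (hsub' y hy)).1) (by linarith [hc.1]) (fun y hy he => ?_)
        · obtain ⟨y, hya, hy⟩ := (hb.and_eventually (Ioc_mem_nhdsGT hb₂.1)).exists
          linarith [this y hy, hc.2]
        · have h1 := (H y (hsub' y hy)).2
          rw [he] at h1
          have h3 := hev y (hsub y hy)
          rw [← h1] at h3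
          have h4 : 0 < y * (2 - y) := mul_pos hy.1 (by linarith [(hsub' y hy).2])
          exact pos_of_mul_pos_right h3 h4.le
    · exact ⟨B, eventually_map.2 (hmem.mono fun y hy => hB y hy)⟩
    · exact ⟨A, eventually_map.2 (hmem.mono fun y hy => hA y hy)⟩
  obtain ⟨a, ha⟩ := hconv
  refine ⟨a, ha, ?_⟩
  have hyF : Tendsto (fun y => y * F' y) (𝓝[>] 0)
      (𝓝 ((2 * (1 - 0) * a - a ^ 2 / 2 + L) / (2 - 0))) := by
    have h1 : Tendsto (fun y => (2 * (1 - y) * F y - F y ^ 2 / 2 + h y) / (2 - y)) (𝓝[>] 0)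
        (𝓝 ((2 * (1 - 0) * a - a ^ 2 / 2 + L) / (2 - 0))) :=
      (((((hid.const_sub 1).const_mul 2).mul ha).sub ((ha.pow 2).div_const 2)).add hL).div
        (hid.const_sub 2) (by norm_num)
    refine h1.congr' (hmem.mono fun y hy => ?_)
    rw [← (H y hy).2]
    have : (2 : ℝ) - y ≠ 0 := by linarith [hy.2]
    field_simp
  -- A nonzero limit of y F' would make F grow like log y, against its bounds.
  by_contra hne
  set μ := (2 * (1 - 0) * a - a ^ 2 / 2 + L) / (2 - 0) with hμ
  have hμ0 : μ ≠ 0 := by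
    intro h0
    apply hne
    rw [hμ] at h0
    linarith
  rcases lt_or_gt_of_ne hμ0 with hneg | hpos
  · obtain ⟨b, hb, hev⟩ := exists_Ioc_of_eventually
      (hyF.eventually_lt_const (show μ < μ / 2 by linarith))
    have hsub : ∀ y ∈ Ioc 0 b, y ∈ Ioc (0 : ℝ) 1 := fun y hy => ⟨hy.1, hy.2.trans hb.2⟩
    obtain ⟨y, hy, hlt⟩ := not_bddAbove_of_mul_deriv_le (φ := F) (φ' := F') (η := -μ / 2) hb.1
      (by linarith) (fun y hy => (H y (hsub y hy)).1) (fun y hy => by linarith [hev y hy]) B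
    linarith [hB y (hsub y hy)]
  · obtain ⟨b, hb, hev⟩ := exists_Ioc_of_eventually
      (hyF.eventually_const_lt (show μ / 2 < μ by linarith))
    have hsub : ∀ y ∈ Ioc 0 b, y ∈ Ioc (0 : ℝ) 1 := fun y hy => ⟨hy.1, hy.2.trans hb.2⟩
    obtain ⟨y, hy, hlt⟩ := not_bddAbove_of_mul_deriv_le (φ := fun y => -F y)
      (φ' := fun y => -F' y) (η := μ / 2) hb.1
      (by linarith) (fun y hy => (H y (hsub y hy)).1.neg)
      (fun y hy => by linarith [hev y hy]) (-A)
    linarith [hA y (hsub y hy)]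

/-- A solution with limit at least `3` stays above `3 - C y`. -/
lemma Riccati.three_sub_le {F F' h : ℝ → ℝ} {L C a : ℝ} (H : Riccati F F' h) (hC0 : 0 ≤ C)
    (hC : ∀ y ∈ Ioc (0 : ℝ) 1, L - C * y ≤ h y) (ha : Tendsto F (𝓝[>] 0) (𝓝 a))
    (hLa : L = a ^ 2 / 2 - 2 * a) (h3 : 3 ≤ a) :
    ∃ c, 0 ≤ c ∧ ∃ b ∈ Ioc (0 : ℝ) 1, ∀ y ∈ Ioc 0 b, 3 - c * y ≤ F y ∧ 0 ≤ F y := by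
  rcases h3.lt_or_eq with hlt | rfl
  · obtain ⟨b, hb, hev⟩ := exists_Ioc_of_eventually (ha.eventually_const_lt hlt)
    exact ⟨0, le_rfl, b, hb, fun y hy => ⟨by linarith [hev y hy], by linarith [hev y hy]⟩⟩
  · obtain ⟨b, hb, hev⟩ := exists_Ioc_of_eventually
      (ha.eventually_const_lt (show (2 : ℝ) < 3 by norm_num))
    -- Here L = -3/2, so at a level v = F y₀ in (2, 3) the right-hand side is at least (v - 1)(3 -
    -- v)/2 - 2 v y - C y. For 3 - v > 2 (6 + C) y₀ this is positive for all y ≤ y₀; the level is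
    -- then crossed only upwards, so F ≤ v < 3 on the left, contradicting the limit 3.
    refine ⟨2 * (6 + C), by linarith, b, hb, fun y₀ hy₀ => ⟨?_, by linarith [hev y₀ hy₀]⟩⟩
    by_contra! hlt
    have hsub : ∀ y ∈ Ioc 0 y₀, y ∈ Ioc 0 b := fun y hy => ⟨hy.1, hy.2.trans hy₀.2⟩
    have hsub' : ∀ y ∈ Ioc 0 y₀, y ∈ Ioc (0 : ℝ) 1 := fun y hy => ⟨hy.1, (hsub y hy).2.trans hb.2⟩
    have := le_of_upward_crossing (φ := F) (φ' := F') (b := y₀) (c := F y₀)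
      (fun y hy => (H y (hsub' y hy)).1) le_rfl (fun y hy he => ?_)
    · have hle : (3 : ℝ) ≤ F y₀ := le_of_tendsto ha
        (by filter_upwards [Ioc_mem_nhdsGT hy₀.1] with y hy using this y hy)
      have : 0 ≤ 2 * (6 + C) * y₀ := by have := hy₀.1; positivity
      linarith
    · have h1 := (H y (hsub' y hy)).2
      rw [he] at h1
      have h2 := hC y (hsub' y hy)
      have h4 : 0 < y * (2 - y) := mul_pos hy.1 (by linarith [(hsub' y hy).2])
      have h5 := hev y₀ hy₀
      have h6 : 2 * (6 + C) * y ≤ 2 * (6 + C) * y₀ := by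
        have := hy.2
        gcongr
      have h7 : F y₀ < 3 := by
        have : 0 ≤ 2 * (6 + C) * y₀ := by have := hy₀.1; positivity
        linarith
      have h8 : 3 - F y₀ ≤ (F y₀ - 1) * (3 - F y₀) := by nlinarith
      have h9 : y * F y₀ ≤ 3 * y := by nlinarith [hy.1]
      have : 0 < y * (2 - y) * F' y := by rw [h1]; nlinarith
      exact pos_of_mul_pos_right this h4.le

/-- With limit at least `3` at the south pole, a nonvanishing swirl would force the inhomogeneity of
the Riccati equation to diverge. -/
lemma Riccati.not_pos_swirl {F F' h h₁ h₂ h₃ g q : ℝ → ℝ} {L C a : ℝ} (H : Riccati F F' h)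
    (d1 : ∀ y ∈ Ioc (0 : ℝ) 1, HasDerivAt h (h₁ y) y)
    (d2 : ∀ y ∈ Ioc (0 : ℝ) 1, HasDerivAt h₁ (h₂ y) y)
    (d3 : ∀ y ∈ Ioc (0 : ℝ) 1, HasDerivAt h₂ (h₃ y) y)
    (dg : ∀ y ∈ Ioc (0 : ℝ) 1, HasDerivAt g (q y) y)
    (dq : ∀ y ∈ Ioc (0 : ℝ) 1, HasDerivAt q (-(F y * q y / (y * (2 - y)))) y)
    (hg : ∀ y ∈ Ioc (0 : ℝ) 1, g y ≤ 0) (hq : ∀ y ∈ Ioc (0 : ℝ) 1, 0 < q y)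
    (h3 : ∀ y ∈ Ioc (0 : ℝ) 1, h₃ y = -(2 * g y * q y / (y * (2 - y))))
    (hC0 : 0 ≤ C) (hC : ∀ y ∈ Ioc (0 : ℝ) 1, L - C * y ≤ h y)
    (ha : Tendsto F (𝓝[>] 0) (𝓝 a)) (hLa : L = a ^ 2 / 2 - 2 * a) (h3a : 3 ≤ a) : False := by
  obtain ⟨c, hc, b, hb, hF⟩ := H.three_sub_le hC0 hC ha hLa h3a
  have hsub : ∀ y ∈ Ioc 0 b, y ∈ Ioc (0 : ℝ) 1 := fun y hy => ⟨hy.1, hy.2.trans hb.2⟩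
  have hbb : b ∈ Ioc 0 b := ⟨hb.1, le_rfl⟩
  -- lower bound for the derivative of the swirl
  have hqa : AntitoneOn (fun y => q y * (y * √y) * Real.exp (-(c / 2) * y)) (Ioc 0 b) := by
    refine antitoneOn_Ioc_of_deriv (φ' := fun y => q y * √y * Real.exp (-(c / 2) * y) *
      (3 / 2 - c / 2 * y - F y / (2 - y))) (fun y hy => ?_) (fun y hy => ?_)
    · have hs : 0 < √y := Real.sqrt_pos.2 hy.1
      have hyy : y = √y * √y := (Real.mul_self_sqrt hy.1.le).symm
      have h2y : (2 : ℝ) - y ≠ 0 := by linarith [(hsub y hy).2]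
      have e1 : HasDerivAt (fun y => y * √y) (3 / 2 * √y) y := by
        refine ((hasDerivAt_id' y).fun_mul (Real.hasDerivAt_sqrt hy.1.ne')).congr_deriv ?_
        field_simp
        rw [Real.sq_sqrt hy.1.le]
        ring
      have e2 : HasDerivAt (fun y => Real.exp (-(c / 2) * y))
          (Real.exp (-(c / 2) * y) * (-(c / 2) * 1)) y :=
        ((hasDerivAt_id' y).const_mul (-(c / 2))).exp
      refine (((dq y (hsub y hy)).fun_mul e1).fun_mul e2).congr_deriv ?_
      have := hy.1.ne'
      field_simp
      ring
    -- F / (2 - y) ≥ F / 2 ≥ 3/2 - (c/2) y: the power 3/2 and the exponential correction are chosen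
    -- to match this bound.
    · have h1 := hF y hy
      have h2y : (0 : ℝ) < 2 - y := by linarith [(hsub y hy).2]
      have h4 : F y / 2 ≤ F y / (2 - y) :=
        div_le_div_of_nonneg_left h1.2 h2y (by linarith [hy.1])
      have h5 := (hq y (hsub y hy)).le
      refine mul_nonpos_of_nonneg_of_nonpos (by positivity) ?_
      linarith
  set κ := q b * (b * √b) * Real.exp (-(c / 2) * b) with hκ
  have hκ0 : 0 < κ := by
    have := hq b (hsub b hbb)
    have := hb.1
    have := Real.sqrt_pos.2 hb.1
    positivity
  have hqb : ∀ y ∈ Ioc 0 b, κ ≤ q y * (y * √y) := by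
    intro y hy
    refine (hqa hy hbb hy.2).trans ?_
    have h1 : Real.exp (-(c / 2) * y) ≤ 1 := Real.exp_le_one_iff.2 (by nlinarith [hy.1])
    have h2 := (hq y (hsub y hy)).le
    have h3 := hy.1.le
    exact mul_le_of_le_one_right (by positivity) h1
  -- Integrates the lower bound κ y^(-3/2) for the derivative of g.
  have hgm : MonotoneOn (fun y => g y + 2 * κ * (√y)⁻¹) (Ioc 0 b) := by
    refine monotoneOn_Ioc_of_deriv (φ' := fun y => q y + 2 * κ * (-(1 / (2 * √y)) / √y ^ 2))
      (fun y hy => ?_) (fun y hy => ?_)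
    · have hs : 0 < √y := Real.sqrt_pos.2 hy.1
      exact (dg y (hsub y hy)).fun_add
        (((Real.hasDerivAt_sqrt hy.1.ne').fun_inv hs.ne').const_mul (2 * κ))
    · have hs : 0 < √y := Real.sqrt_pos.2 hy.1
      have h1 := hqb y hy
      have hy0 := hy.1
      have h2 : κ / (y * √y) ≤ q y := by
        rw [div_le_iff₀ (by positivity)]
        exact h1
      have h4 : 2 * κ * (-(1 / (2 * √y)) / √y ^ 2) = -(κ / (y * √y)) := by
        rw [Real.sq_sqrt hy.1.le]
        field_simp
      rw [h4]
      linarith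
  -- On (0, b/4] one has √b ≥ 2 √y, so half of 2 κ / √y absorbs the boundary term at b.
  have hgb : ∀ y ∈ Ioc 0 (b / 4), g y ≤ -(κ / √y) := by
    intro y hy
    have hy' : y ∈ Ioc 0 b := ⟨hy.1, by linarith [hy.2, hb.1]⟩
    have h1 := hgm hy' hbb hy'.2
    have h2 := hg b (hsub b hbb)
    have hs : 0 < √y := Real.sqrt_pos.2 hy.1
    have hsb : 2 * √y ≤ √b := by
      have : √(4 * y) ≤ √b := Real.sqrt_le_sqrt (by linarith [hy.2])
      rwa [Real.sqrt_mul (by norm_num), show (4 : ℝ) = 2 ^ 2 by norm_num,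
        Real.sqrt_sq (by norm_num)] at this
    have h4 : (√b)⁻¹ ≤ (2 * √y)⁻¹ := inv_anti₀ (by positivity) hsb
    have h5 : 2 * κ * (√b)⁻¹ ≤ 2 * κ * (2 * √y)⁻¹ := by gcongr
    have h6 : 2 * κ * (2 * √y)⁻¹ = κ / √y := by field_simp
    have h7 : 2 * κ * (√y)⁻¹ = 2 * (κ / √y) := by field_simp
    simp only at h1
    linarith
  have hb4 : 0 < b / 4 := by linarith [hb.1]
  have hsub4 : ∀ y ∈ Ioc 0 (b / 4), y ∈ Ioc 0 b := fun y hy => ⟨hy.1, by linarith [hy.2, hb.1]⟩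
  have hh3 : ∀ y ∈ Ioc 0 (b / 4), κ ^ 2 / y ^ 3 ≤ h₃ y := by
    intro y hy
    have hy' := hsub y (hsub4 y hy)
    have hs : 0 < √y := Real.sqrt_pos.2 hy.1
    have hy0 := hy.1
    have h2y : (0 : ℝ) < 2 - y := by linarith [hy'.2]
    have h1 : κ / (y * √y) ≤ q y := by
      rw [div_le_iff₀ (by positivity)]
      exact hqb y (hsub4 y hy)
    have h2 : κ / √y ≤ -g y := by linarith [hgb y hy]
    have h4 : κ / √y * (κ / (y * √y)) ≤ -g y * q y :=
      mul_le_mul h2 h1 (by positivity) (le_trans (by positivity) h2)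
    have h5 : κ / √y * (κ / (y * √y)) = κ ^ 2 / y ^ 2 := by
      have : √y * √y = y := Real.mul_self_sqrt hy.1.le
      field_simp
      rw [Real.sq_sqrt hy.1.le]
    rw [h5] at h4
    rw [h3 y hy']
    have h6 : κ ^ 2 / y ^ 3 = κ ^ 2 / y ^ 2 / y := by field_simp
    have h7 : -(2 * g y * q y / (y * (2 - y))) = -g y * q y / y * (2 / (2 - y)) := by
      field_simp
    have h8 : 1 ≤ 2 / (2 - y) := by
      rw [le_div_iff₀ h2y]
      linarith
    rw [h6, h7]
    calc κ ^ 2 / y ^ 2 / y ≤ -g y * q y / y := by gcongr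
      _ ≤ -g y * q y / y * (2 / (2 - y)) :=
        le_mul_of_one_le_right (div_nonneg (le_trans (by positivity) h4) hy0.le) h8
  -- The third derivative of (κ²/2) log y is κ² / y³, so the difference has nonnegative third
  -- derivative and is bounded above. Thus h tends to -∞, against its lower bound.
  obtain ⟨C', hC'⟩ := bddAbove_of_third_deriv_nonneg
    (h := fun y => h y - κ ^ 2 / 2 * Real.log y) (h₁ := fun y => h₁ y - κ ^ 2 / 2 * y⁻¹)
    (h₂ := fun y => h₂ y - κ ^ 2 / 2 * (-(y ^ 2)⁻¹))
    (h₃ := fun y => h₃ y - κ ^ 2 / 2 * (-(-(2 * y) / (y ^ 2) ^ 2))) hb4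
    (fun y hy => (d1 y (hsub y (hsub4 y hy))).fun_sub
      ((Real.hasDerivAt_log hy.1.ne').const_mul _))
    (fun y hy => (d2 y (hsub y (hsub4 y hy))).fun_sub ((hasDerivAt_inv hy.1.ne').const_mul _))
    (fun y hy => by
      have e : HasDerivAt (fun y : ℝ => y ^ 2) (2 * y) y := by simpa using hasDerivAt_pow 2 y
      have := hy.1
      exact (d3 y (hsub y (hsub4 y hy))).fun_sub
        ((e.fun_inv (by positivity)).fun_neg.const_mul (κ ^ 2 / 2)))
    (fun y hy => by
      have h1 := hh3 y hy
      have hy0 := hy.1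
      have h2 : κ ^ 2 / 2 * (-(-(2 * y) / (y ^ 2) ^ 2)) = κ ^ 2 / y ^ 3 := by field_simp
      linarith)
  have hlog : Tendsto (fun y => κ ^ 2 / 2 * Real.log y) (𝓝[>] 0) atBot :=
    Real.tendsto_log_nhdsGT_zero.const_mul_atBot (by positivity)
  obtain ⟨y, hy1, hy2⟩ := ((hlog.eventually_lt_atBot (L - C - C')).and
    (Ioc_mem_nhdsGT hb4)).exists
  have h1 := hC' y hy2
  have h2 := hC y (hsub y (hsub4 y hy2))
  have h4 : C * y ≤ C := mul_le_of_le_one_right hC0 (hsub y (hsub4 y hy2)).2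
  linarith

/-! ### The profile equations and the limit at the south pole. -/

lemma exists_primitive_Ioo {φ : ℝ → ℝ} {a b c : ℝ} (hc : c ∈ Ioo a b)
    (hφ : ContinuousOn φ (Ioo a b)) : ∃ Φ : ℝ → ℝ, ∀ x ∈ Ioo a b, HasDerivAt Φ (φ x) x := by
  refine ⟨fun x => ∫ t in c..x, φ t, fun x hx => ?_⟩
  have hsub : uIcc c x ⊆ Ioo a b := ordConnected_Ioo.uIcc_subset hc hx
  refine intervalIntegral.integral_hasDerivAt_right
    (hφ.mono hsub).intervalIntegrable ?_ (hφ.continuousAt (isOpen_Ioo.mem_nhds hx))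
  exact hφ.stronglyMeasurableAtFilter isOpen_Ioo x hx

lemma _root_.ContDiffOn.deriv_infty {φ : ℝ → ℝ} {s : Set ℝ} (h : ContDiffOn ℝ ∞ φ s)
    (hs : IsOpen s) : ContDiffOn ℝ ∞ (deriv φ) s :=
  ((contDiffOn_infty_iff_deriv_of_isOpen hs).1 h).2

lemma _root_.ContDiffOn.hasDerivAt_of_isOpen {φ : ℝ → ℝ} {s : Set ℝ} (h : ContDiffOn ℝ ∞ φ s)
    (hs : IsOpen s) {x : ℝ} (hx : x ∈ s) : HasDerivAt φ (deriv φ x) x :=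
  (((h.differentiableOn (by simp)) x hx).differentiableAt (hs.mem_nhds hx)).hasDerivAt

/-- The left-hand side of the first integral of the equation for `U_θ`. -/
noncomputable def riccatiForm (f : ℝ → ℝ) (x : ℝ) : ℝ :=
  (1 - x ^ 2) * deriv f x + 2 * x * f x + f x ^ 2 / 2

/-- The profile equations for `f = U_θ` and `g = U_φ`. -/
structure ProfileEquations (f g : ℝ → ℝ) : Prop where
  smooth_f : ContDiffOn ℝ ∞ f (Ioo (-1) 1)
  smooth_g : ContDiffOn ℝ ∞ g (Ioo (-1) 1)
  swirl : ∀ x ∈ Ioo (-1 : ℝ) 1, (1 - x ^ 2) * deriv (deriv g) x + f x * deriv g x = 0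
  meridian : ∀ x ∈ Ioo (-1 : ℝ) 1,
    deriv (deriv (deriv (riccatiForm f))) x + 2 * g x * deriv g x / (1 - x ^ 2) = 0

lemma ProfileEquations.smooth_riccatiForm {f g : ℝ → ℝ} (h : ProfileEquations f g) :
    ContDiffOn ℝ ∞ (riccatiForm f) (Ioo (-1) 1) := by
  have h0 := h.smooth_f
  have h1 := h0.deriv_infty isOpen_Ioo
  unfold riccatiForm
  fun_prop

/-- The swirl equation is linear in g and the other one is even in g; the sign of g' may thus be
chosen freely. -/
lemma ProfileEquations.neg {f g : ℝ → ℝ} (h : ProfileEquations f g) :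
    ProfileEquations f (fun x => -g x) where
  smooth_f := h.smooth_f
  smooth_g := h.smooth_g.neg
  swirl x hx := by
    have := h.swirl x hx
    simp only [deriv.fun_neg', deriv.fun_neg]
    linarith
  meridian x hx := by
    have := h.meridian x hx
    simp only [deriv.fun_neg']
    rw [← this]
    ring

/-- Integrating factor for the first-order linear equation satisfied by g'. It follows that g'
vanishes identically or nowhere, with constant sign. -/
lemma ProfileEquations.deriv_swirl_sign {f g : ℝ → ℝ} (h : ProfileEquations f g) :
    ∃ Φ : ℝ → ℝ, ∀ x ∈ Ioo (-1 : ℝ) 1, deriv g x = deriv g 0 * Real.exp (Φ x) := by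
  have hw : ∀ x ∈ Ioo (-1 : ℝ) 1, 0 < 1 - x ^ 2 := fun x hx => by nlinarith [hx.1, hx.2]
  obtain ⟨Φ, hΦ⟩ := exists_primitive_Ioo (φ := fun x => f x / (1 - x ^ 2)) (c := 0) (by simp)
    (h.smooth_f.continuousOn.div (by fun_prop) fun x hx => (hw x hx).ne')
  refine ⟨fun x => Φ 0 - Φ x, fun x hx => ?_⟩
  have hg1 := h.smooth_g.deriv_infty isOpen_Ioo
  have hd : ∀ x ∈ Ioo (-1 : ℝ) 1, HasDerivAt (fun x => deriv g x * Real.exp (Φ x)) 0 x := by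
    intro x hx
    refine ((hg1.hasDerivAt_of_isOpen isOpen_Ioo hx).fun_mul (hΦ x hx).exp).congr_deriv ?_
    have h1 := h.swirl x hx
    have h2 := (hw x hx).ne'
    have : deriv (deriv g) x = -(f x * deriv g x) / (1 - x ^ 2) := by
      field_simp
      linarith
    rw [this]
    ring
  have := isOpen_Ioo.is_const_of_deriv_eq_zero isPreconnected_Ioo
    (fun x hx => (hd x hx).differentiableAt.differentiableWithinAt)
    (fun x hx => (hd x hx).deriv) hx (show (0 : ℝ) ∈ Ioo (-1) 1 by simp)
  rw [Real.exp_sub, ← mul_div_assoc, ← this, mul_div_cancel_right₀ _ (Real.exp_ne_zero _)]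

/-- With g' ≥ 0 and g → 0 at the north pole, g ≤ 0, so the third derivative of the Riccati form is
nonnegative and the Riccati estimates apply after the shift y = 1 + x. -/
lemma ProfileEquations.south_pole_aux {f g : ℝ → ℝ} (h : ProfileEquations f g)
    (hg : Tendsto g (𝓝[<] 1) (𝓝 0)) (h0 : 0 ≤ deriv g 0) :
    ∃ a, Tendsto f (𝓝[>] (-1)) (𝓝 a) ∧ (3 ≤ a → deriv g 0 = 0) := by
  obtain ⟨Φ, hΦ⟩ := h.deriv_swirl_sign
  have hsh : ∀ y ∈ Ioc (0 : ℝ) 1, y - 1 ∈ Ioo (-1 : ℝ) 1 := fun y hy =>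
    ⟨by linarith [hy.1], by linarith [hy.2]⟩
  have dsh : ∀ {φ : ℝ → ℝ}, ContDiffOn ℝ ∞ φ (Ioo (-1) 1) → ∀ y ∈ Ioc (0 : ℝ) 1,
      HasDerivAt (fun y => φ (y - 1)) (deriv φ (y - 1)) y := fun hφ y hy =>
    (hφ.hasDerivAt_of_isOpen isOpen_Ioo (hsh y hy)).comp_sub_const y 1
  have hq0 : ∀ x ∈ Ioo (-1 : ℝ) 1, 0 ≤ deriv g x := fun x hx => by
    rw [hΦ x hx]
    positivity
  have hmono : MonotoneOn g (Ioo (-1) 1) :=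
    monotoneOn_of_deriv_nonneg (convex_Ioo _ _) h.smooth_g.continuousOn
      (by rw [interior_Ioo]; exact h.smooth_g.differentiableOn (by simp))
      (by rw [interior_Ioo]; exact hq0)
  have hgn : ∀ x ∈ Ioo (-1 : ℝ) 1, g x ≤ 0 := fun x hx =>
    ge_of_tendsto hg (by
      filter_upwards [Ioo_mem_nhdsLT hx.2] with z hz using
        hmono hx ⟨hx.1.trans hz.1, hz.2⟩ hz.1.le)
  have sH := h.smooth_riccatiForm
  have sH1 := sH.deriv_infty isOpen_Ioo
  have sH2 := sH1.deriv_infty isOpen_Ioo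
  have hR : Riccati (fun y => f (y - 1)) (fun y => deriv f (y - 1))
      (fun y => riccatiForm f (y - 1)) := fun y hy =>
    ⟨dsh h.smooth_f y hy, by unfold riccatiForm; ring⟩
  have hw : ∀ y : ℝ, 1 - (y - 1) ^ 2 = y * (2 - y) := fun y => by ring
  have hw0 : ∀ y ∈ Ioc (0 : ℝ) 1, 0 < y * (2 - y) := fun y hy =>
    mul_pos hy.1 (by linarith [hy.2])
  have h3 : ∀ y ∈ Ioc (0 : ℝ) 1, deriv (deriv (deriv (riccatiForm f))) (y - 1) =
      -(2 * g (y - 1) * deriv g (y - 1) / (y * (2 - y))) := fun y hy => by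
    have := h.meridian _ (hsh y hy)
    rw [hw] at this
    linarith
  have h3n : ∀ y ∈ Ioc (0 : ℝ) 1, 0 ≤ deriv (deriv (deriv (riccatiForm f))) (y - 1) := by
    intro y hy
    rw [h3 y hy, neg_nonneg]
    refine div_nonpos_of_nonpos_of_nonneg ?_ (hw0 y hy).le
    have := hq0 _ (hsh y hy)
    have := hgn _ (hsh y hy)
    nlinarith
  obtain ⟨L, C, hC0, hL, hC⟩ := hR.tendsto_inhomogeneity (dsh sH) (dsh sH1) (dsh sH2) h3n
  obtain ⟨C', hC'⟩ := bddAbove_of_third_deriv_nonneg one_pos (dsh sH) (dsh sH1) (dsh sH2) h3n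
  obtain ⟨A, hA⟩ := hR.bddBelow hC'
  obtain ⟨B, hB⟩ := hR.bddAbove hC'
  obtain ⟨a, ha, hLa⟩ := hR.tendsto_solution hL hA hB
  refine ⟨a, ?_, fun h3a => ?_⟩
  · have ht : Tendsto (fun x : ℝ => x + 1) (𝓝[>] (-1)) (𝓝[>] 0) := by
      refine tendsto_nhdsWithin_iff.2 ⟨?_, ?_⟩
      · have : Continuous fun x : ℝ => x + 1 := by fun_prop
        simpa using (this.tendsto (-1)).mono_left nhdsWithin_le_nhds
      · filter_upwards [self_mem_nhdsWithin] with x hx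
        have : -1 < x := hx
        show (0 : ℝ) < x + 1
        linarith
    simpa [Function.comp_def] using ha.comp ht
  · by_contra hne
    have hpos : 0 < deriv g 0 := lt_of_le_of_ne h0 (Ne.symm hne)
    have sg := h.smooth_g
    refine hR.not_pos_swirl (dsh sH) (dsh sH1) (dsh sH2) (dsh sg)
      (fun y hy => (dsh (sg.deriv_infty isOpen_Ioo) y hy).congr_deriv ?_)
      (fun y hy => hgn _ (hsh y hy)) (fun y hy => ?_) h3 hC0 hC ha hLa h3a
    · have h1 := h.swirl _ (hsh y hy)
      rw [hw] at h1
      have h2 := (hw0 y hy).ne'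
      rw [eq_neg_iff_add_eq_zero, ← mul_right_inj' h2, mul_add, mul_div_cancel₀ _ h2]
      simpa using h1
    · rw [hΦ _ (hsh y hy)]
      positivity

/-- `U_θ` has a limit at the south pole; if the limit is at least `3`, the swirl vanishes. -/
theorem ProfileEquations.south_pole {f g : ℝ → ℝ} (h : ProfileEquations f g)
    (hg : Tendsto g (𝓝[<] 1) (𝓝 0)) :
    ∃ a, Tendsto f (𝓝[>] (-1)) (𝓝 a) ∧ (3 ≤ a → ∀ x ∈ Ioo (-1 : ℝ) 1, g x = 0) := by
  obtain ⟨a, ha, h3⟩ : ∃ a, Tendsto f (𝓝[>] (-1)) (𝓝 a) ∧ (3 ≤ a → deriv g 0 = 0) := by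
    rcases le_total 0 (deriv g 0) with h0 | h0
    · exact h.south_pole_aux hg h0
    · obtain ⟨a, ha, h3⟩ := h.neg.south_pole_aux (by simpa using hg.neg) (by simpa using h0)
      exact ⟨a, ha, fun h => by simpa using h3 h⟩
  refine ⟨a, ha, fun h3a x hx => ?_⟩
  obtain ⟨Φ, hΦ⟩ := h.deriv_swirl_sign
  have hz : ∀ x ∈ Ioo (-1 : ℝ) 1, deriv g x = 0 := fun x hx => by rw [hΦ x hx, h3 h3a, zero_mul]
  have hconst : ∀ z ∈ Ioo (-1 : ℝ) 1, g z = g x := fun z hz' =>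
    isOpen_Ioo.is_const_of_deriv_eq_zero isPreconnected_Ioo
      (h.smooth_g.differentiableOn (by simp)) hz hz' hx
  refine tendsto_nhds_unique (tendsto_const_nhds.congr' ?_) hg
  filter_upwards [Ioo_mem_nhdsLT (show (-1 : ℝ) < 1 by norm_num)] with z hz' using (hconst z hz').symm

/-! ### The Navier–Stokes equations in scalar components. -/

/-- The partial derivative `∂ᵢ h` of a scalar function. -/
noncomputable def pd (i : Fin 3) (h : R3 → ℝ) (y : R3) : ℝ :=
  fderiv ℝ h y (EuclideanSpace.single i 1)

/-- The sum of the pure second partial derivatives of a scalar function. -/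
noncomputable def lap (h : R3 → ℝ) (y : R3) : ℝ := ∑ i : Fin 3, pd i (pd i h) y

lemma pd_congr {i : Fin 3} {h₁ h₂ : R3 → ℝ} {s : Set R3} (hs : IsOpen s) (h : EqOn h₁ h₂ s)
    {y : R3} (hy : y ∈ s) : pd i h₁ y = pd i h₂ y := by
  unfold pd
  rw [(h.eventuallyEq_of_mem (hs.mem_nhds hy)).fderiv_eq]

lemma lap_congr {h₁ h₂ : R3 → ℝ} {s : Set R3} (hs : IsOpen s) (h : EqOn h₁ h₂ s)
    {y : R3} (hy : y ∈ s) : lap h₁ y = lap h₂ y :=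
  Finset.sum_congr rfl fun _ _ => pd_congr hs (fun _ hz => pd_congr hs h hz) hy

lemma contDiffOn_pd {i : Fin 3} {h : R3 → ℝ} {s : Set R3} (hs : IsOpen s)
    (hh : ContDiffOn ℝ ∞ h s) : ContDiffOn ℝ ∞ (pd i h) s :=
  (hh.fderiv_of_isOpen hs (m := ∞) (by simp)).clm_apply contDiffOn_const

lemma _root_.ContDiffOn.differentiableAt_of_isOpen {E F : Type*} [NormedAddCommGroup E]
    [NormedSpace ℝ E] [NormedAddCommGroup F] [NormedSpace ℝ F] {h : E → F} {s : Set E} {y : E}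
    (hh : ContDiffOn ℝ ∞ h s) (hs : IsOpen s) (hy : y ∈ s) : DifferentiableAt ℝ h y :=
  ((hh.differentiableOn (by simp)) y hy).differentiableAt (hs.mem_nhds hy)

lemma pd_add {i : Fin 3} {h₁ h₂ : R3 → ℝ} {y : R3} (d₁ : DifferentiableAt ℝ h₁ y)
    (d₂ : DifferentiableAt ℝ h₂ y) : pd i (fun y => h₁ y + h₂ y) y = pd i h₁ y + pd i h₂ y := by
  unfold pd
  rw [fderiv_fun_add d₁ d₂]
  rfl

lemma pd_sub {i : Fin 3} {h₁ h₂ : R3 → ℝ} {y : R3} (d₁ : DifferentiableAt ℝ h₁ y)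
    (d₂ : DifferentiableAt ℝ h₂ y) : pd i (fun y => h₁ y - h₂ y) y = pd i h₁ y - pd i h₂ y := by
  unfold pd
  rw [fderiv_fun_sub d₁ d₂]
  rfl

/-- The coordinate functionals. -/
noncomputable def coord (j : Fin 3) : R3 →L[ℝ] ℝ := EuclideanSpace.proj j

@[simp] lemma coord_apply (j : Fin 3) (y : R3) : coord j y = y j := rfl

lemma hasFDerivAt_coord (j : Fin 3) (y : R3) :
    HasFDerivAt (fun y : R3 => y j) (coord j) y :=
  (coord j).hasFDerivAt

lemma contDiff_coord (j : Fin 3) : ContDiff ℝ ∞ (fun y : R3 => y j) :=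
  (coord j).contDiff

lemma pd_coord_mul {i j : Fin 3} {h : R3 → ℝ} {y : R3} (d : DifferentiableAt ℝ h y) :
    pd i (fun y => y j * h y) y = (if j = i then 1 else 0) * h y + y j * pd i h y := by
  unfold pd
  rw [((hasFDerivAt_coord j y).fun_mul d.hasFDerivAt).fderiv]
  simp
  ring

lemma lap_add {h₁ h₂ : R3 → ℝ} {s : Set R3} (hs : IsOpen s) (c₁ : ContDiffOn ℝ ∞ h₁ s)
    (c₂ : ContDiffOn ℝ ∞ h₂ s) {y : R3} (hy : y ∈ s) :
    lap (fun y => h₁ y + h₂ y) y = lap h₁ y + lap h₂ y := by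
  unfold lap
  rw [← Finset.sum_add_distrib]
  refine Finset.sum_congr rfl fun i _ => ?_
  rw [pd_congr hs (fun z hz => pd_add (c₁.differentiableAt_of_isOpen hs hz)
    (c₂.differentiableAt_of_isOpen hs hz)) hy]
  exact pd_add ((contDiffOn_pd hs c₁).differentiableAt_of_isOpen hs hy)
    ((contDiffOn_pd hs c₂).differentiableAt_of_isOpen hs hy)

lemma lap_sub {h₁ h₂ : R3 → ℝ} {s : Set R3} (hs : IsOpen s) (c₁ : ContDiffOn ℝ ∞ h₁ s)
    (c₂ : ContDiffOn ℝ ∞ h₂ s) {y : R3} (hy : y ∈ s) :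
    lap (fun y => h₁ y - h₂ y) y = lap h₁ y - lap h₂ y := by
  unfold lap
  rw [← Finset.sum_sub_distrib]
  refine Finset.sum_congr rfl fun i _ => ?_
  rw [pd_congr hs (fun z hz => pd_sub (c₁.differentiableAt_of_isOpen hs hz)
    (c₂.differentiableAt_of_isOpen hs hz)) hy]
  exact pd_sub ((contDiffOn_pd hs c₁).differentiableAt_of_isOpen hs hy)
    ((contDiffOn_pd hs c₂).differentiableAt_of_isOpen hs hy)

lemma lap_coord_mul {j : Fin 3} {h : R3 → ℝ} {s : Set R3} (hs : IsOpen s)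
    (c : ContDiffOn ℝ ∞ h s) {y : R3} (hy : y ∈ s) :
    lap (fun y => y j * h y) y = y j * lap h y + 2 * pd j h y := by
  have key : ∀ i, pd i (pd i fun y => y j * h y) y =
      2 * ((if j = i then 1 else 0) * pd i h y) + y j * pd i (pd i h) y := by
    intro i
    have cp := contDiffOn_pd (i := i) hs c
    rw [pd_congr hs (fun z hz => pd_coord_mul (i := i) (c.differentiableAt_of_isOpen hs hz)) hy,
      pd_add ((c.differentiableAt_of_isOpen hs hy).const_mul _)
        ((contDiff_coord j).contDiffOn.mul cp |>.differentiableAt_of_isOpen hs hy),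
      pd_coord_mul (cp.differentiableAt_of_isOpen hs hy)]
    have : pd i (fun y => (if j = i then 1 else 0) * h y) y = (if j = i then 1 else 0) * pd i h y := by
      unfold pd
      rw [fderiv_const_mul (c.differentiableAt_of_isOpen hs hy)]
      rfl
    rw [this]
    ring
  unfold lap
  simp only [key, Finset.sum_add_distrib, ← Finset.mul_sum]
  simp [Finset.sum_ite_eq]
  ring

lemma laplacian_apply {u : R3 → R3} {s : Set R3} (hs : IsOpen s) (c : ContDiffOn ℝ ∞ u s)
    {y : R3} (hy : y ∈ s) (j : Fin 3) :
    (Laplacian.laplacian u y) j = lap (fun z => u z j) y := by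
  have cj : ContDiffOn ℝ ∞ (fun z => u z j) s := (contDiff_coord j).comp_contDiffOn c
  have h1 := ContDiffAt.laplacian_CLM_comp_left
    (l := coord j)
    (((c y hy).contDiffAt (hs.mem_nhds hy)).of_le (WithTop.coe_le_coe.2 le_top))
  have h2 : (Laplacian.laplacian u y) j = Laplacian.laplacian (fun z => u z j) y := h1.symm
  rw [h2, congrFun (InnerProductSpace.laplacian_eq_iteratedFDeriv_orthonormalBasis _
    (EuclideanSpace.basisFun (Fin 3) ℝ)) y]
  unfold lap
  refine Finset.sum_congr rfl fun i _ => ?_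
  rw [iteratedFDeriv_two_apply]
  have hd : DifferentiableAt ℝ (fderiv ℝ fun z => u z j) y :=
    (cj.fderiv_of_isOpen hs (m := ∞) (by simp)).differentiableAt_of_isOpen hs hy
  unfold pd
  rw [fderiv_clm_apply hd (differentiableAt_const _)]
  simp

lemma gradient_apply {p : R3 → ℝ} {y : R3} (j : Fin 3) :
    (gradient p y) j = pd j p y := by
  have h := InnerProductSpace.toDual_symm_apply (𝕜 := ℝ) (x := EuclideanSpace.single j (1 : ℝ))
    (y := fderiv ℝ p y)
  rw [EuclideanSpace.inner_single_right] at h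
  simpa [gradient, pd] using h

lemma pd_component {u : R3 → R3} {y : R3} (d : DifferentiableAt ℝ u y) (i j : Fin 3) :
    pd i (fun z => u z j) y = fderiv ℝ u y (EuclideanSpace.single i 1) j := by
  unfold pd
  have := ((coord j).hasFDerivAt.comp y
    d.hasFDerivAt).fderiv
  have h2 : ((coord j) ∘ u) = fun z => u z j := rfl
  rw [h2] at this
  rw [this]
  rfl

lemma fderiv_apply_component {u : R3 → R3} {y : R3} (d : DifferentiableAt ℝ u y) (v : R3)
    (j : Fin 3) : fderiv ℝ u y v j = ∑ i, v i * pd i (fun z => u z j) y := by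
  have hv : v = ∑ i, v i • EuclideanSpace.single i (1 : ℝ) := by
    ext k
    simp [Fin.sum_univ_three]
    fin_cases k <;> simp
  conv_lhs => rw [hv, map_sum]
  simp [pd_component d]

/-- The momentum balance of the Navier–Stokes equations without pressure, for one component `v` of
the velocity `u`. -/
noncomputable def momentum (u : R3 → R3) (v : R3 → ℝ) (y : R3) : ℝ :=
  -lap v y + ∑ i, u y i * pd i v y

/-- The Navier–Stokes equations in terms of scalar partial derivatives. -/
lemma navierStokes_iff {u : R3 → R3} {p : R3 → ℝ} {s : Set R3} (hs : IsOpen s)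
    (c : ContDiffOn ℝ ∞ u s) {y : R3} (hy : y ∈ s) :
    (-Laplacian.laplacian u y + fderiv ℝ u y (u y) + gradient p y = 0 ∧ divergence u y = 0) ↔
      (∀ j, momentum u (fun z => u z j) y + pd j p y = 0) ∧ ∑ i, pd i (fun z => u z i) y = 0 := by
  have d := c.differentiableAt_of_isOpen hs hy
  refine and_congr ?_ ?_
  · rw [PiLp.ext_iff]
    refine forall_congr' fun j => ?_
    unfold momentum
    rw [← laplacian_apply hs c hy, ← fderiv_apply_component d, ← gradient_apply]
    simp
  · simp only [divergence, pd_component d]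

/-! ### Homogeneous axisymmetric fields off the axis and their residuals. -/

/-- The complement of the `x₃`-axis. -/
def offAxis : Set R3 := {y | 0 < y 0 ^ 2 + y 1 ^ 2}

lemma isOpen_offAxis : IsOpen offAxis :=
  isOpen_lt continuous_const (by fun_prop)

lemma norm_sq_eq (y : R3) : ‖y‖ ^ 2 = y 0 ^ 2 + y 1 ^ 2 + y 2 ^ 2 := by
  simp [EuclideanSpace.real_norm_sq_eq, Fin.sum_univ_three]

lemma offAxis_subset_slitSpace : offAxis ⊆ slitSpace := by
  rintro y hy ⟨h0, h1, -⟩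
  simp [offAxis, h0, h1] at hy

lemma ne_zero_of_mem_slitSpace {y : R3} (hy : y ∈ slitSpace) : y ≠ 0 := by
  rintro rfl
  simp [slitSpace] at hy

lemma norm_pos_of_mem_offAxis {y : R3} (hy : y ∈ offAxis) : 0 < ‖y‖ :=
  norm_pos_iff.2 (ne_zero_of_mem_slitSpace (offAxis_subset_slitSpace hy))

/-- The cosine of the polar angle. -/
noncomputable def cosPolar (y : R3) : ℝ := y 2 / ‖y‖

lemma cosPolar_mem_Ioo {y : R3} (hy : y ∈ offAxis) : cosPolar y ∈ Ioo (-1 : ℝ) 1 := by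
  have h0 := norm_pos_of_mem_offAxis hy
  have h1 := norm_sq_eq y
  have h2 : 0 < y 0 ^ 2 + y 1 ^ 2 := hy
  have h3 : |y 2| < ‖y‖ := by
    rw [← abs_of_pos h0]
    exact sq_lt_sq.1 (by linarith)
  obtain ⟨h4, h5⟩ := abs_lt.1 h3
  exact ⟨by unfold cosPolar; rw [lt_div_iff₀ h0]; linarith,
    by unfold cosPolar; rw [div_lt_iff₀ h0]; linarith⟩

/-- The function `r⁻ᵏ η(cos θ)`. -/
noncomputable def hom (k : ℕ) (η : ℝ → ℝ) (y : R3) : ℝ := (‖y‖ ^ k)⁻¹ * η (cosPolar y)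

lemma contDiffOn_cosPolar {s : Set R3} (hs : ∀ y ∈ s, y ≠ 0) : ContDiffOn ℝ ∞ cosPolar s :=
  (contDiff_coord 2).contDiffOn.div (fun y hy => (contDiffAt_norm ℝ (hs y hy)).contDiffWithinAt)
    fun y hy => norm_ne_zero_iff.2 (hs y hy)

lemma contDiffOn_hom {k : ℕ} {η : ℝ → ℝ} {s : Set R3} {J : Set ℝ} (hs : ∀ y ∈ s, y ≠ 0)
    (hJ : MapsTo cosPolar s J) (hη : ContDiffOn ℝ ∞ η J) : ContDiffOn ℝ ∞ (hom k η) s := by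
  have hn : ContDiffOn ℝ ∞ (fun y : R3 => ‖y‖) s := fun y hy =>
    (contDiffAt_norm ℝ (hs y hy)).contDiffWithinAt
  exact ((hn.pow k).inv fun y hy => pow_ne_zero _ (norm_ne_zero_iff.2 (hs y hy))).mul
    (hη.comp (contDiffOn_cosPolar hs) hJ)

lemma hasFDerivAt_norm' {y : R3} (hy : y ≠ 0) :
    HasFDerivAt (fun y : R3 => ‖y‖) (‖y‖⁻¹ • innerSL ℝ y) y := by
  have h0 : ‖y‖ ≠ 0 := norm_ne_zero_iff.2 hy
  have h := (hasStrictFDerivAt_norm_sq y).hasFDerivAt.sqrt (pow_ne_zero 2 h0)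
  simp only [Real.sqrt_sq (norm_nonneg _)] at h
  refine h.congr_fderiv ?_
  ext v
  simp
  field_simp

lemma hasFDerivAt_hom {k : ℕ} {η : ℝ → ℝ} {η' : ℝ} {y : R3} (hy : y ≠ 0)
    (hη : HasDerivAt η η' (cosPolar y)) :
    HasFDerivAt (hom k η)
      ((-((‖y‖ ^ (k + 2))⁻¹ * (k * η (cosPolar y) + cosPolar y * η'))) • innerSL ℝ y +
        ((‖y‖ ^ (k + 1))⁻¹ * η') • coord 2) y := by
  have h0 : ‖y‖ ≠ 0 := norm_ne_zero_iff.2 hy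
  have hn := hasFDerivAt_norm' hy
  have hi := (hasDerivAt_inv h0).comp_hasFDerivAt y hn
  have hx : HasFDerivAt cosPolar _ y := (hasFDerivAt_coord 2 y).fun_mul hi
  have hp := ((hasDerivAt_pow k ‖y‖).fun_inv (pow_ne_zero k h0)).comp_hasFDerivAt y hn
  refine (hp.fun_mul (hη.comp_hasFDerivAt y hx)).congr_fderiv ?_
  ext v
  simp only [add_apply, smul_apply, smul_eq_mul,
    Function.comp_apply, coord_apply]
  have hc : cosPolar y = y 2 / ‖y‖ := rfl
  rcases k with _ | k
  · simp only [hc, Nat.cast_zero]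
    field_simp
    ring
  · simp only [hc, Nat.add_sub_cancel]
    field_simp
    ring

/-- The action of `∂_{ρ²}` on profiles: `∂_{ρ²} (r⁻ᵏ η) = r⁻ᵏ⁻² S η`. -/
noncomputable def rhoOp (k : ℕ) (η : ℝ → ℝ) (x : ℝ) : ℝ := -(k * η x + x * deriv η x) / 2

/-- The action of `∂₃` on profiles: `∂₃ (r⁻ᵏ η) = r⁻ᵏ⁻¹ Z η`. -/
noncomputable def zOp (k : ℕ) (η : ℝ → ℝ) (x : ℝ) : ℝ :=
  -k * x * η x + (1 - x ^ 2) * deriv η x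

lemma contDiffOn_rhoOp {k : ℕ} {η : ℝ → ℝ} {J : Set ℝ} (hJ : IsOpen J) (h : ContDiffOn ℝ ∞ η J) :
    ContDiffOn ℝ ∞ (rhoOp k η) J := by
  have := h.deriv_infty hJ
  unfold rhoOp
  fun_prop

lemma contDiffOn_zOp {k : ℕ} {η : ℝ → ℝ} {J : Set ℝ} (hJ : IsOpen J) (h : ContDiffOn ℝ ∞ η J) :
    ContDiffOn ℝ ∞ (zOp k η) J := by
  have := h.deriv_infty hJ
  unfold zOp
  fun_prop

lemma contDiffOn_hom_offAxis {k : ℕ} {η : ℝ → ℝ} (h : ContDiffOn ℝ ∞ η (Ioo (-1) 1)) :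
    ContDiffOn ℝ ∞ (hom k η) offAxis :=
  contDiffOn_hom (fun _ hy => ne_zero_of_mem_slitSpace (offAxis_subset_slitSpace hy))
    (fun _ hy => cosPolar_mem_Ioo hy) h

/-- Off the axis r⁻ᵏ η depends only on ρ² = y₀² + y₁² and y₂, so each horizontal derivative is 2 yᵢ
times the derivative in ρ². -/
lemma pd_hom_horizontal {k : ℕ} {η : ℝ → ℝ} (h : ContDiffOn ℝ ∞ η (Ioo (-1) 1)) {y : R3}
    (hy : y ∈ offAxis) {i : Fin 3} (hi : i ≠ 2) :
    pd i (hom k η) y = y i * (2 * hom (k + 2) (rhoOp k η) y) := by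
  unfold pd
  rw [(hasFDerivAt_hom (ne_zero_of_mem_slitSpace (offAxis_subset_slitSpace hy))
    (h.hasDerivAt_of_isOpen isOpen_Ioo (cosPolar_mem_Ioo hy))).fderiv]
  simp [hom, rhoOp, EuclideanSpace.inner_single_right, hi.symm]
  ring

lemma pd_hom_two {k : ℕ} {η : ℝ → ℝ} (h : ContDiffOn ℝ ∞ η (Ioo (-1) 1)) {y : R3}
    (hy : y ∈ offAxis) :
    pd 2 (hom k η) y = hom (k + 1) (zOp k η) y := by
  have h0 := (norm_pos_of_mem_offAxis hy).ne'
  unfold pd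
  rw [(hasFDerivAt_hom (ne_zero_of_mem_slitSpace (offAxis_subset_slitSpace hy))
    (h.hasDerivAt_of_isOpen isOpen_Ioo (cosPolar_mem_Ioo hy))).fderiv]
  have hc : y 2 = ‖y‖ * cosPolar y := by
    unfold cosPolar
    field_simp
  simp [hom, zOp, EuclideanSpace.inner_single_right]
  rw [hc]
  field_simp
  ring

/-- In the variables s = ρ² and z the Laplacian is 4 ∂ₛ + 4 s ∂ₛ² + ∂_z². -/
lemma lap_hom {k : ℕ} {η : ℝ → ℝ} (h : ContDiffOn ℝ ∞ η (Ioo (-1) 1)) {y : R3}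
    (hy : y ∈ offAxis) :
    lap (hom k η) y = 4 * hom (k + 2) (rhoOp k η) y +
      4 * (y 0 ^ 2 + y 1 ^ 2) * hom (k + 4) (rhoOp (k + 2) (rhoOp k η)) y +
      hom (k + 2) (zOp (k + 1) (zOp k η)) y := by
  have hr := contDiffOn_rhoOp (k := k) isOpen_Ioo h
  have hz := contDiffOn_zOp (k := k) isOpen_Ioo h
  have key : ∀ i : Fin 3, i ≠ 2 → pd i (pd i (hom k η)) y =
      2 * hom (k + 2) (rhoOp k η) y + 4 * y i ^ 2 * hom (k + 4) (rhoOp (k + 2) (rhoOp k η)) y := by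
    intro i hi
    have hd := (contDiffOn_hom_offAxis (k := k + 2) hr).differentiableAt_of_isOpen isOpen_offAxis hy
    rw [pd_congr isOpen_offAxis (fun z hz => pd_hom_horizontal h hz hi) hy,
      pd_coord_mul (hd.const_mul 2)]
    have : pd i (fun y => 2 * hom (k + 2) (rhoOp k η) y) y =
        2 * pd i (hom (k + 2) (rhoOp k η)) y := by
      unfold pd
      rw [fderiv_const_mul hd]
      rfl
    rw [this, pd_hom_horizontal hr hy hi]
    simp
    ring
  unfold lap
  rw [Fin.sum_univ_three, key 0 (by decide), key 1 (by decide),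
    pd_congr isOpen_offAxis (fun z hz => pd_hom_two h hz) hy, pd_hom_two hz hy]
  ring

/-- The `(-1)`-homogeneous axisymmetric vector field with the given meridian profiles. -/
noncomputable def axiField (α β ζ : ℝ → ℝ) (y : R3) : R3 :=
  !₂[y 0 * hom 2 α y - y 1 * hom 2 β y, y 1 * hom 2 α y + y 0 * hom 2 β y, hom 1 ζ y]

/-- The profile of `∂_ρ`-type momentum. -/
noncomputable def radialRes (α β ζ : ℝ → ℝ) (x : ℝ) : ℝ :=
  -(4 * (1 - x ^ 2) * rhoOp 4 (rhoOp 2 α) x + 8 * rhoOp 2 α x + zOp 3 (zOp 2 α) x) +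
    α x ^ 2 - β x ^ 2 + 2 * (1 - x ^ 2) * α x * rhoOp 2 α x + ζ x * zOp 2 α x

/-- The profile of the azimuthal momentum. -/
noncomputable def swirlRes (α β ζ : ℝ → ℝ) (x : ℝ) : ℝ :=
  -(4 * (1 - x ^ 2) * rhoOp 4 (rhoOp 2 β) x + 8 * rhoOp 2 β x + zOp 3 (zOp 2 β) x) +
    2 * α x * β x + 2 * (1 - x ^ 2) * α x * rhoOp 2 β x + ζ x * zOp 2 β x

/-- The profile of the vertical momentum. -/
noncomputable def axialRes (α ζ : ℝ → ℝ) (x : ℝ) : ℝ :=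
  -(4 * (1 - x ^ 2) * rhoOp 3 (rhoOp 1 ζ) x + 4 * rhoOp 1 ζ x + zOp 2 (zOp 1 ζ) x) +
    2 * (1 - x ^ 2) * α x * rhoOp 1 ζ x + ζ x * zOp 1 ζ x

/-- The profile of the divergence. -/
noncomputable def divRes (α ζ : ℝ → ℝ) (x : ℝ) : ℝ :=
  2 * α x + 2 * (1 - x ^ 2) * rhoOp 2 α x + zOp 1 ζ x

lemma axiField_zero (α β ζ : ℝ → ℝ) (y : R3) :
    axiField α β ζ y 0 = y 0 * hom 2 α y - y 1 * hom 2 β y := rfl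

lemma axiField_one (α β ζ : ℝ → ℝ) (y : R3) :
    axiField α β ζ y 1 = y 1 * hom 2 α y + y 0 * hom 2 β y := rfl

lemma axiField_two (α β ζ : ℝ → ℝ) (y : R3) : axiField α β ζ y 2 = hom 1 ζ y := rfl

/-- This is ρ² = r² (1 - x²), the one relation needed to collapse the residuals to functions of x
times a power of r. -/
lemma sq_add_sq_mul_inv_pow {y : R3} (hy : y ∈ offAxis) (k : ℕ) :
    (y 0 ^ 2 + y 1 ^ 2) * (‖y‖ ^ (k + 2))⁻¹ = (1 - cosPolar y ^ 2) * (‖y‖ ^ k)⁻¹ := by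
  have h0 := (norm_pos_of_mem_offAxis hy).ne'
  have h1 := norm_sq_eq y
  have hc : cosPolar y ^ 2 = y 2 ^ 2 / ‖y‖ ^ 2 := by
    unfold cosPolar
    ring
  rw [hc, pow_add]
  field_simp
  linarith

section

variable {α β ζ : ℝ → ℝ} {y : R3}

lemma contDiffOn_coord_mul_hom {k : ℕ} {η : ℝ → ℝ} (h : ContDiffOn ℝ ∞ η (Ioo (-1) 1))
    (j : Fin 3) : ContDiffOn ℝ ∞ (fun y : R3 => y j * hom k η y) offAxis :=
  (contDiff_coord j).contDiffOn.mul (contDiffOn_hom_offAxis h)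

lemma momentum_axiField_zero (hα : ContDiffOn ℝ ∞ α (Ioo (-1) 1))
    (hβ : ContDiffOn ℝ ∞ β (Ioo (-1) 1)) (hy : y ∈ offAxis) :
    momentum (axiField α β ζ) (fun z => axiField α β ζ z 0) y =
      (‖y‖ ^ 4)⁻¹ * (y 0 * radialRes α β ζ (cosPolar y) - y 1 * swirlRes α β ζ (cosPolar y)) := by
  have ho := isOpen_offAxis
  have cA := contDiffOn_hom_offAxis (k := 2) hα
  have cB := contDiffOn_hom_offAxis (k := 2) hβ
  have dA := cA.differentiableAt_of_isOpen ho hy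
  have dB := cB.differentiableAt_of_isOpen ho hy
  have dA' := (contDiffOn_coord_mul_hom (k := 2) hα 0).differentiableAt_of_isOpen ho hy
  have dB' := (contDiffOn_coord_mul_hom (k := 2) hβ 1).differentiableAt_of_isOpen ho hy
  unfold momentum
  simp only [Fin.sum_univ_three, axiField_zero, axiField_one, axiField_two]
  rw [lap_sub ho (contDiffOn_coord_mul_hom hα 0) (contDiffOn_coord_mul_hom hβ 1) hy,
    lap_coord_mul ho cA hy, lap_coord_mul ho cB hy, lap_hom hα hy, lap_hom hβ hy,
    pd_sub dA' dB', pd_sub dA' dB', pd_sub dA' dB']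
  simp only [pd_coord_mul dA, pd_coord_mul dB]
  rw [pd_hom_horizontal hα hy (show (0 : Fin 3) ≠ 2 by decide),
    pd_hom_horizontal hα hy (show (1 : Fin 3) ≠ 2 by decide),
    pd_hom_horizontal hβ hy (show (0 : Fin 3) ≠ 2 by decide),
    pd_hom_horizontal hβ hy (show (1 : Fin 3) ≠ 2 by decide), pd_hom_two hα hy, pd_hom_two hβ hy]
  have hr := sq_add_sq_mul_inv_pow hy 4
  simp only [hom, radialRes, swirlRes, Nat.reduceAdd, Fin.reduceEq, if_true, if_false] at hr ⊢
  generalize cosPolar y = x at *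
  -- The terms carrying ρ² are the second derivatives in ρ² from the Laplacian and the convection by
  -- the horizontal radial part; `hr` rewrites exactly those.
  linear_combination (-4 * y 0 * rhoOp 4 (rhoOp 2 α) x + 4 * y 1 * rhoOp 4 (rhoOp 2 β) x +
    2 * α x * (y 0 * rhoOp 2 α x - y 1 * rhoOp 2 β x)) * hr

lemma momentum_axiField_one (hα : ContDiffOn ℝ ∞ α (Ioo (-1) 1))
    (hβ : ContDiffOn ℝ ∞ β (Ioo (-1) 1)) (hy : y ∈ offAxis) :
    momentum (axiField α β ζ) (fun z => axiField α β ζ z 1) y =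
      (‖y‖ ^ 4)⁻¹ * (y 1 * radialRes α β ζ (cosPolar y) + y 0 * swirlRes α β ζ (cosPolar y)) := by
  have ho := isOpen_offAxis
  have cA := contDiffOn_hom_offAxis (k := 2) hα
  have cB := contDiffOn_hom_offAxis (k := 2) hβ
  have dA := cA.differentiableAt_of_isOpen ho hy
  have dB := cB.differentiableAt_of_isOpen ho hy
  have dA' := (contDiffOn_coord_mul_hom (k := 2) hα 1).differentiableAt_of_isOpen ho hy
  have dB' := (contDiffOn_coord_mul_hom (k := 2) hβ 0).differentiableAt_of_isOpen ho hy
  unfold momentum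
  simp only [Fin.sum_univ_three, axiField_zero, axiField_one, axiField_two]
  rw [lap_add ho (contDiffOn_coord_mul_hom hα 1) (contDiffOn_coord_mul_hom hβ 0) hy,
    lap_coord_mul ho cA hy, lap_coord_mul ho cB hy, lap_hom hα hy, lap_hom hβ hy,
    pd_add dA' dB', pd_add dA' dB', pd_add dA' dB']
  simp only [pd_coord_mul dA, pd_coord_mul dB]
  rw [pd_hom_horizontal hα hy (show (0 : Fin 3) ≠ 2 by decide),
    pd_hom_horizontal hα hy (show (1 : Fin 3) ≠ 2 by decide),
    pd_hom_horizontal hβ hy (show (0 : Fin 3) ≠ 2 by decide),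
    pd_hom_horizontal hβ hy (show (1 : Fin 3) ≠ 2 by decide), pd_hom_two hα hy, pd_hom_two hβ hy]
  have hr := sq_add_sq_mul_inv_pow hy 4
  simp only [hom, radialRes, swirlRes, Nat.reduceAdd, Fin.reduceEq, if_true, if_false] at hr ⊢
  generalize cosPolar y = x at *
  linear_combination (-4 * y 1 * rhoOp 4 (rhoOp 2 α) x - 4 * y 0 * rhoOp 4 (rhoOp 2 β) x +
    2 * α x * (y 1 * rhoOp 2 α x + y 0 * rhoOp 2 β x)) * hr

lemma momentum_axiField_two (hζ : ContDiffOn ℝ ∞ ζ (Ioo (-1) 1)) (hy : y ∈ offAxis) :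
    momentum (axiField α β ζ) (fun z => axiField α β ζ z 2) y =
      (‖y‖ ^ 3)⁻¹ * axialRes α ζ (cosPolar y) := by
  unfold momentum
  simp only [Fin.sum_univ_three, axiField_zero, axiField_one, axiField_two]
  rw [lap_hom hζ hy, pd_hom_horizontal hζ hy (show (0 : Fin 3) ≠ 2 by decide),
    pd_hom_horizontal hζ hy (show (1 : Fin 3) ≠ 2 by decide), pd_hom_two hζ hy]
  have hr := sq_add_sq_mul_inv_pow hy 3
  simp only [hom, axialRes, Nat.reduceAdd] at hr ⊢
  generalize cosPolar y = x at *
  linear_combination (-4 * rhoOp 3 (rhoOp 1 ζ) x + 2 * α x * rhoOp 1 ζ x) * hr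

lemma div_axiField (hα : ContDiffOn ℝ ∞ α (Ioo (-1) 1)) (hβ : ContDiffOn ℝ ∞ β (Ioo (-1) 1))
    (hζ : ContDiffOn ℝ ∞ ζ (Ioo (-1) 1)) (hy : y ∈ offAxis) :
    ∑ i, pd i (fun z => axiField α β ζ z i) y = (‖y‖ ^ 2)⁻¹ * divRes α ζ (cosPolar y) := by
  have ho := isOpen_offAxis
  have dA := (contDiffOn_hom_offAxis (k := 2) hα).differentiableAt_of_isOpen ho hy
  have dB := (contDiffOn_hom_offAxis (k := 2) hβ).differentiableAt_of_isOpen ho hy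
  have dA' := fun j => (contDiffOn_coord_mul_hom (k := 2) hα j).differentiableAt_of_isOpen ho hy
  have dB' := fun j => (contDiffOn_coord_mul_hom (k := 2) hβ j).differentiableAt_of_isOpen ho hy
  simp only [Fin.sum_univ_three, axiField_zero, axiField_one, axiField_two]
  rw [pd_sub (dA' 0) (dB' 1), pd_add (dA' 1) (dB' 0)]
  simp only [pd_coord_mul dA, pd_coord_mul dB]
  rw [pd_hom_horizontal hα hy (show (0 : Fin 3) ≠ 2 by decide),
    pd_hom_horizontal hα hy (show (1 : Fin 3) ≠ 2 by decide),
    pd_hom_horizontal hβ hy (show (0 : Fin 3) ≠ 2 by decide),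
    pd_hom_horizontal hβ hy (show (1 : Fin 3) ≠ 2 by decide), pd_hom_two hζ hy]
  have hr := sq_add_sq_mul_inv_pow hy 2
  simp only [hom, divRes, Nat.reduceAdd, Fin.reduceEq, if_true, if_false] at hr ⊢
  generalize cosPolar y = x at *
  linear_combination (2 * rhoOp 2 α x) * hr

end

/-! ### The residuals in terms of U_θ and U_φ. -/

lemma deriv_rhoOp {k : ℕ} {η : ℝ → ℝ} {J : Set ℝ} (hJ : IsOpen J) (h : ContDiffOn ℝ ∞ η J)
    {x : ℝ} (hx : x ∈ J) :
    deriv (rhoOp k η) x = -((k + 1) * deriv η x + x * deriv (deriv η) x) / 2 := by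
  have h1 := h.hasDerivAt_of_isOpen hJ hx
  have h2 := (h.deriv_infty hJ).hasDerivAt_of_isOpen hJ hx
  have : HasDerivAt (rhoOp k η) _ x :=
    (((h1.const_mul (k : ℝ)).fun_add ((hasDerivAt_id' x).fun_mul h2)).fun_neg).div_const 2
  rw [this.deriv]
  ring

lemma deriv_zOp {k : ℕ} {η : ℝ → ℝ} {J : Set ℝ} (hJ : IsOpen J) (h : ContDiffOn ℝ ∞ η J)
    {x : ℝ} (hx : x ∈ J) :
    deriv (zOp k η) x =
      -k * η x - (k + 2) * x * deriv η x + (1 - x ^ 2) * deriv (deriv η) x := by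
  have h1 := h.hasDerivAt_of_isOpen hJ hx
  have h2 := (h.deriv_infty hJ).hasDerivAt_of_isOpen hJ hx
  have : HasDerivAt (zOp k η) _ x :=
    (((hasDerivAt_id' x).const_mul (-(k : ℝ))).fun_mul h1).fun_add
      (((hasDerivAt_pow 2 x).const_sub 1).fun_mul h2)
  rw [this.deriv]
  push_cast
  ring

lemma deriv_eq_of_eqOn {φ ψ ψ' : ℝ → ℝ} {J : Set ℝ} (hJ : IsOpen J) (h : EqOn φ ψ J)
    (hd : ∀ x ∈ J, HasDerivAt ψ (ψ' x) x) : EqOn (deriv φ) ψ' J := fun x hx => by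
  rw [(h.eventuallyEq_of_mem (hJ.mem_nhds hx)).deriv_eq]
  exact (hd x hx).deriv

/-- The meridian profiles of the velocity expressed by `f = U_θ` and `g = U_φ`. -/
structure IsProfile (f g α β ζ : ℝ → ℝ) : Prop where
  smooth_f : ContDiffOn ℝ ∞ f (Ioo (-1) 1)
  smooth_g : ContDiffOn ℝ ∞ g (Ioo (-1) 1)
  eq_α : EqOn α (fun x => deriv f x + x * f x / (1 - x ^ 2)) (Ioo (-1) 1)
  eq_β : EqOn β (fun x => g x / (1 - x ^ 2)) (Ioo (-1) 1)
  eq_ζ : EqOn ζ (fun x => x * deriv f x - f x) (Ioo (-1) 1)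

lemma one_sub_sq_pos {x : ℝ} (hx : x ∈ Ioo (-1 : ℝ) 1) : 0 < 1 - x ^ 2 := by
  nlinarith [hx.1, hx.2]

lemma hasDerivAt_one_sub_sq (x : ℝ) : HasDerivAt (fun x : ℝ => 1 - x ^ 2) (-(2 * x)) x := by
  simpa using (hasDerivAt_pow 2 x).const_sub 1

namespace IsProfile

variable {f g α β ζ : ℝ → ℝ}

lemma smooth_α (h : IsProfile f g α β ζ) : ContDiffOn ℝ ∞ α (Ioo (-1) 1) := by
  have h1 := h.smooth_f
  have h2 := h1.deriv_infty isOpen_Ioo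
  refine ContDiffOn.congr ?_ h.eq_α
  exact h2.add ((contDiffOn_id.mul h1).div (by fun_prop) fun x hx => (one_sub_sq_pos hx).ne')

lemma smooth_β (h : IsProfile f g α β ζ) : ContDiffOn ℝ ∞ β (Ioo (-1) 1) :=
  (h.smooth_g.div (by fun_prop) fun _ hx => (one_sub_sq_pos hx).ne').congr h.eq_β

lemma smooth_ζ (h : IsProfile f g α β ζ) : ContDiffOn ℝ ∞ ζ (Ioo (-1) 1) :=
  ((contDiffOn_id.mul (h.smooth_f.deriv_infty isOpen_Ioo)).sub h.smooth_f).congr h.eq_ζ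

lemma deriv_α (h : IsProfile f g α β ζ) : EqOn (deriv α) (fun x => deriv (deriv f) x +
    (f x + x * deriv f x) / (1 - x ^ 2) + 2 * x ^ 2 * f x / (1 - x ^ 2) ^ 2) (Ioo (-1) 1) := by
  refine deriv_eq_of_eqOn isOpen_Ioo h.eq_α fun x hx => ?_
  have d0 := h.smooth_f.hasDerivAt_of_isOpen isOpen_Ioo hx
  have d1 := (h.smooth_f.deriv_infty isOpen_Ioo).hasDerivAt_of_isOpen isOpen_Ioo hx
  have hw := (one_sub_sq_pos hx).ne'
  refine (d1.fun_add (((hasDerivAt_id' x).fun_mul d0).fun_div (hasDerivAt_one_sub_sq x)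
    hw)).congr_deriv ?_
  field_simp
  ring

lemma deriv_deriv_α (h : IsProfile f g α β ζ) : EqOn (deriv (deriv α))
    (fun x => deriv (deriv (deriv f)) x + (2 * deriv f x + x * deriv (deriv f) x) / (1 - x ^ 2) +
      (6 * x * f x + 4 * x ^ 2 * deriv f x) / (1 - x ^ 2) ^ 2 +
      8 * x ^ 3 * f x / (1 - x ^ 2) ^ 3) (Ioo (-1) 1) := by
  refine deriv_eq_of_eqOn isOpen_Ioo h.deriv_α fun x hx => ?_
  have s1 := h.smooth_f.deriv_infty isOpen_Ioo
  have d0 := h.smooth_f.hasDerivAt_of_isOpen isOpen_Ioo hx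
  have d1 := s1.hasDerivAt_of_isOpen isOpen_Ioo hx
  have d2 := (s1.deriv_infty isOpen_Ioo).hasDerivAt_of_isOpen isOpen_Ioo hx
  have hw := (one_sub_sq_pos hx).ne'
  have dx := hasDerivAt_id' x
  have dw := hasDerivAt_one_sub_sq x
  have dx2 : HasDerivAt (fun x : ℝ => 2 * x ^ 2) (2 * (2 * x)) x := by
    simpa using (hasDerivAt_pow 2 x).const_mul 2
  refine ((d2.fun_add ((d0.fun_add (dx.fun_mul d1)).fun_div dw hw)).fun_add
    ((dx2.fun_mul d0).fun_div (dw.fun_pow 2) (pow_ne_zero 2 hw))).congr_deriv ?_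
  field_simp
  ring

lemma deriv_β (h : IsProfile f g α β ζ) : EqOn (deriv β) (fun x => deriv g x / (1 - x ^ 2) +
    2 * x * g x / (1 - x ^ 2) ^ 2) (Ioo (-1) 1) := by
  refine deriv_eq_of_eqOn isOpen_Ioo h.eq_β fun x hx => ?_
  have d0 := h.smooth_g.hasDerivAt_of_isOpen isOpen_Ioo hx
  have hw := (one_sub_sq_pos hx).ne'
  refine (d0.fun_div (hasDerivAt_one_sub_sq x) hw).congr_deriv ?_
  field_simp
  ring

lemma deriv_deriv_β (h : IsProfile f g α β ζ) : EqOn (deriv (deriv β))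
    (fun x => deriv (deriv g) x / (1 - x ^ 2) + (2 * g x + 4 * x * deriv g x) / (1 - x ^ 2) ^ 2 +
    8 * x ^ 2 * g x / (1 - x ^ 2) ^ 3) (Ioo (-1) 1) := by
  refine deriv_eq_of_eqOn isOpen_Ioo h.deriv_β fun x hx => ?_
  have d0 := h.smooth_g.hasDerivAt_of_isOpen isOpen_Ioo hx
  have d1 := (h.smooth_g.deriv_infty isOpen_Ioo).hasDerivAt_of_isOpen isOpen_Ioo hx
  have hw := (one_sub_sq_pos hx).ne'
  have dw := hasDerivAt_one_sub_sq x
  refine ((d1.fun_div dw hw).fun_add ((((hasDerivAt_id' x).const_mul 2).fun_mul d0).fun_div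
    (dw.fun_pow 2) (pow_ne_zero 2 hw))).congr_deriv ?_
  field_simp
  ring

lemma deriv_ζ (h : IsProfile f g α β ζ) :
    EqOn (deriv ζ) (fun x => x * deriv (deriv f) x) (Ioo (-1) 1) := by
  refine deriv_eq_of_eqOn isOpen_Ioo h.eq_ζ fun x hx => ?_
  have d0 := h.smooth_f.hasDerivAt_of_isOpen isOpen_Ioo hx
  have d1 := (h.smooth_f.deriv_infty isOpen_Ioo).hasDerivAt_of_isOpen isOpen_Ioo hx
  exact (((hasDerivAt_id' x).fun_mul d1).fun_sub d0).congr_deriv (by ring)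

lemma deriv_deriv_ζ (h : IsProfile f g α β ζ) : EqOn (deriv (deriv ζ))
    (fun x => deriv (deriv f) x + x * deriv (deriv (deriv f)) x) (Ioo (-1) 1) := by
  refine deriv_eq_of_eqOn isOpen_Ioo h.deriv_ζ fun x hx => ?_
  have s2 := (h.smooth_f.deriv_infty isOpen_Ioo).deriv_infty isOpen_Ioo
  exact ((hasDerivAt_id' x).fun_mul (s2.hasDerivAt_of_isOpen isOpen_Ioo hx)).congr_deriv (by ring)

variable {x : ℝ}

lemma divRes_eq (h : IsProfile f g α β ζ) (hx : x ∈ Ioo (-1 : ℝ) 1) : divRes α ζ x = 0 := by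
  have hw := (one_sub_sq_pos hx).ne'
  simp only [divRes, rhoOp, zOp, h.deriv_α hx, h.deriv_ζ hx, h.eq_α hx, h.eq_ζ hx]
  push_cast
  field_simp
  ring

lemma swirlRes_eq (h : IsProfile f g α β ζ) (hx : x ∈ Ioo (-1 : ℝ) 1) : swirlRes α β ζ x =
    -((1 - x ^ 2) * deriv (deriv g) x + f x * deriv g x) / (1 - x ^ 2) := by
  have hw := (one_sub_sq_pos hx).ne'
  have hβ := h.smooth_β
  simp only [swirlRes, rhoOp, zOp]
  rw [deriv_rhoOp isOpen_Ioo hβ hx, deriv_zOp isOpen_Ioo hβ hx]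
  simp only [h.deriv_deriv_β hx, h.deriv_β hx, h.eq_α hx, h.eq_β hx, h.eq_ζ hx]
  push_cast
  field_simp
  ring

/-- The two combinations are the projections of the meridian residual onto the ray and onto the
meridian. The pressure gradient is known along both: by Euler's identity along the ray, and as the
derivative of the pressure profile along the meridian. -/
lemma radialRes_axialRes (h : IsProfile f g α β ζ) (hx : x ∈ Ioo (-1 : ℝ) 1) :
    (1 - x ^ 2) * radialRes α β ζ x + x * axialRes α ζ x =
      -(1 - x ^ 2) * deriv (deriv (deriv f)) x + 2 * x * deriv (deriv f) x -
        f x * deriv (deriv f) x - deriv f x ^ 2 - (f x ^ 2 + g x ^ 2) / (1 - x ^ 2) ∧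
    x * radialRes α β ζ x - axialRes α ζ x =
      deriv (deriv f) x - f x * deriv f x / (1 - x ^ 2) -
        x * (f x ^ 2 + g x ^ 2) / (1 - x ^ 2) ^ 2 := by
  have hw := (one_sub_sq_pos hx).ne'
  have hα := h.smooth_α
  have hζ := h.smooth_ζ
  simp only [radialRes, axialRes, rhoOp, zOp]
  rw [deriv_rhoOp isOpen_Ioo hα hx, deriv_zOp isOpen_Ioo hα hx,
    deriv_rhoOp isOpen_Ioo hζ hx, deriv_zOp isOpen_Ioo hζ hx]
  simp only [h.deriv_deriv_α hx, h.deriv_α hx, h.deriv_deriv_ζ hx, h.deriv_ζ hx, h.eq_α hx,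
    h.eq_β hx, h.eq_ζ hx]
  push_cast
  constructor
  · field_simp
    ring
  · field_simp
    ring

end IsProfile

/-- Twice the pressure profile. -/
noncomputable def pressureForm (f g : ℝ → ℝ) (x : ℝ) : ℝ :=
  -(1 - x ^ 2) * deriv (deriv (deriv f)) x + 2 * x * deriv (deriv f) x -
    f x * deriv (deriv f) x - deriv f x ^ 2 - (f x ^ 2 + g x ^ 2) / (1 - x ^ 2)

/-- The derivative of the pressure profile and the third derivative of the Riccati form. -/
lemma deriv_pressureForm {f g : ℝ → ℝ} (hf : ContDiffOn ℝ ∞ f (Ioo (-1) 1))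
    (hg : ContDiffOn ℝ ∞ g (Ioo (-1) 1)) {x : ℝ} (hx : x ∈ Ioo (-1 : ℝ) 1) :
    HasDerivAt (pressureForm f g) (2 * (deriv (deriv f) x - f x * deriv f x / (1 - x ^ 2) -
        x * (f x ^ 2 + g x ^ 2) / (1 - x ^ 2) ^ 2) -
      (deriv (deriv (deriv (riccatiForm f))) x + 2 * g x * deriv g x / (1 - x ^ 2))) x := by
  have s1 := hf.deriv_infty isOpen_Ioo
  have s2 := s1.deriv_infty isOpen_Ioo
  have s3 := s2.deriv_infty isOpen_Ioo
  have D : ∀ {φ : ℝ → ℝ}, ContDiffOn ℝ ∞ φ (Ioo (-1) 1) → ∀ z ∈ Ioo (-1 : ℝ) 1,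
      HasDerivAt φ (deriv φ z) z := fun hφ z hz => hφ.hasDerivAt_of_isOpen isOpen_Ioo hz
  have r1 : EqOn (deriv (riccatiForm f)) (fun z => (1 - z ^ 2) * deriv (deriv f) z + 2 * f z +
      f z * deriv f z) (Ioo (-1) 1) := by
    refine deriv_eq_of_eqOn isOpen_Ioo (fun z _ => rfl) fun z hz => ?_
    refine ((((hasDerivAt_one_sub_sq z).fun_mul (D s1 z hz)).fun_add
      (((hasDerivAt_id' z).const_mul 2).fun_mul (D hf z hz))).fun_add
      (((D hf z hz).fun_pow 2).div_const 2)).congr_deriv ?_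
    simp
    ring
  have r2 : EqOn (deriv (deriv (riccatiForm f))) (fun z => (1 - z ^ 2) * deriv (deriv (deriv f)) z -
      2 * z * deriv (deriv f) z + 2 * deriv f z + deriv f z ^ 2 + f z * deriv (deriv f) z)
      (Ioo (-1) 1) := by
    refine deriv_eq_of_eqOn isOpen_Ioo r1 fun z hz => ?_
    refine ((((hasDerivAt_one_sub_sq z).fun_mul (D s2 z hz)).fun_add
      ((D hf z hz).const_mul 2)).fun_add ((D hf z hz).fun_mul (D s1 z hz))).congr_deriv ?_
    ring
  have r3 : EqOn (deriv (deriv (deriv (riccatiForm f))))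
      (fun z => (1 - z ^ 2) * deriv (deriv (deriv (deriv f))) z - 4 * z * deriv (deriv (deriv f)) z +
      3 * deriv f z * deriv (deriv f) z + f z * deriv (deriv (deriv f)) z)
      (Ioo (-1) 1) := by
    refine deriv_eq_of_eqOn isOpen_Ioo r2 fun z hz => ?_
    refine ((((((hasDerivAt_one_sub_sq z).fun_mul (D s3 z hz)).fun_sub
      (((hasDerivAt_id' z).const_mul 2).fun_mul (D s2 z hz))).fun_add
      ((D s1 z hz).const_mul 2)).fun_add ((D s1 z hz).fun_pow 2)).fun_add
      ((D hf z hz).fun_mul (D s2 z hz))).congr_deriv ?_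
    simp
    ring
  have hw := (one_sub_sq_pos hx).ne'
  rw [r3 hx]
  refine ((((((hasDerivAt_one_sub_sq x).fun_neg.fun_mul (D s3 x hx)).fun_add
    (((hasDerivAt_id' x).const_mul 2).fun_mul (D s2 x hx))).fun_sub
    ((D hf x hx).fun_mul (D s2 x hx))).fun_sub ((D s1 x hx).fun_pow 2)).fun_sub
    ((((D hf x hx).fun_pow 2).fun_add ((D hg x hx).fun_pow 2)).fun_div
      (hasDerivAt_one_sub_sq x) hw)).congr_deriv ?_
  simp
  field_simp
  ring

/-! ### From a solution to the profile equations. -/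

lemma isOpen_slitSpace : IsOpen slitSpace := by
  have : IsClosed {y : R3 | y 0 = 0 ∧ y 1 = 0 ∧ y 2 ≤ 0} :=
    (isClosed_eq (contDiff_coord 0).continuous continuous_const).inter
      ((isClosed_eq (contDiff_coord 1).continuous continuous_const).inter
        (isClosed_le (contDiff_coord 2).continuous continuous_const))
  exact this.isOpen_compl

lemma hasDerivAt_comp_curve {p : R3 → ℝ} {a b c : ℝ → ℝ} {a' b' c' t : ℝ}
    (hp : DifferentiableAt ℝ p !₂[a t, b t, c t]) (ha : HasDerivAt a a' t)
    (hb : HasDerivAt b b' t) (hc : HasDerivAt c c' t) :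
    HasDerivAt (fun t => p !₂[a t, b t, c t])
      (a' * pd 0 p !₂[a t, b t, c t] + b' * pd 1 p !₂[a t, b t, c t] +
        c' * pd 2 p !₂[a t, b t, c t]) t := by
  have hγ : (fun t => (!₂[a t, b t, c t] : R3)) = fun t => a t • EuclideanSpace.single 0 (1 : ℝ) +
      b t • EuclideanSpace.single 1 (1 : ℝ) + c t • EuclideanSpace.single 2 (1 : ℝ) := by
    ext t k
    fin_cases k <;> simp
  have h1 : HasDerivAt (fun t => (!₂[a t, b t, c t] : R3))
      (a' • EuclideanSpace.single 0 (1 : ℝ) + b' • EuclideanSpace.single 1 (1 : ℝ) +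
        c' • EuclideanSpace.single 2 (1 : ℝ)) t := by
    rw [hγ]
    exact ((ha.smul_const _).fun_add (hb.smul_const _)).fun_add (hc.smul_const _)
  refine (hp.hasFDerivAt.comp_hasDerivAt t h1).congr_deriv ?_
  simp [pd]

lemma momentum_congr {u v : R3 → R3} {s : Set R3} (hs : IsOpen s) (h : EqOn u v s) {y : R3}
    (hy : y ∈ s) (j : Fin 3) :
    momentum u (fun z => u z j) y = momentum v (fun z => v z j) y := by
  have hj : EqOn (fun z => u z j) (fun z => v z j) s := fun z hz => by simp only [h hz]
  unfold momentum
  rw [lap_congr hs hj hy]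
  simp only [pd_congr hs hj hy, h hy]

/-- The point of the unit sphere on the meridian `φ = 0` with `cos θ = x`. -/
noncomputable def meridian (x : ℝ) : R3 := !₂[√(1 - x ^ 2), 0, x]

lemma one_smul_eR_arccos {x : ℝ} (hx : x ∈ Icc (-1 : ℝ) 1) :
    (1 : ℝ) • eR (Real.arccos x) 0 = meridian x := by
  simp [eR, meridian, Real.sin_arccos, Real.cos_arccos hx.1 hx.2]

lemma sqrt_one_sub_sq_pos {x : ℝ} (hx : x ∈ Ioo (-1 : ℝ) 1) : 0 < √(1 - x ^ 2) :=
  Real.sqrt_pos.2 (one_sub_sq_pos hx)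

lemma meridian_mem_offAxis {x : ℝ} (hx : x ∈ Ioo (-1 : ℝ) 1) : meridian x ∈ offAxis := by
  have := sqrt_one_sub_sq_pos hx
  show 0 < meridian x 0 ^ 2 + meridian x 1 ^ 2
  simp [meridian]
  positivity

lemma norm_meridian {x : ℝ} (hx : x ∈ Ioo (-1 : ℝ) 1) : ‖meridian x‖ = 1 := by
  have h := norm_sq_eq (meridian x)
  have h2 : ‖meridian x‖ ^ 2 = 1 := by
    rw [h]
    simp [meridian, Real.sq_sqrt (one_sub_sq_pos hx).le]
  exact (pow_eq_one_iff_of_nonneg (norm_nonneg _) two_ne_zero).1 h2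

lemma cosPolar_meridian {x : ℝ} (hx : x ∈ Ioo (-1 : ℝ) 1) : cosPolar (meridian x) = x := by
  rw [cosPolar, norm_meridian hx, div_one]
  rfl

lemma contDiffOn_meridian : ContDiffOn ℝ ∞ meridian (Ioo (-1) 1) := by
  refine contDiffOn_euclidean.2 fun i => ?_
  have h : ContDiffOn ℝ ∞ (fun x : ℝ => √(1 - x ^ 2)) (Ioo (-1) 1) :=
    ContDiffOn.sqrt (by fun_prop) fun x hx => (one_sub_sq_pos hx).ne'
  fin_cases i
  · exact h
  · exact contDiffOn_const
  · exact contDiffOn_id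

/-- Polar coordinates off the axis. -/
lemma exists_polar {y : R3} (hy : y ∈ offAxis) :
    ∃ φ, y = ‖y‖ • eR (Real.arccos (cosPolar y)) φ := by
  have h0 := norm_pos_of_mem_offAxis hy
  have hx := cosPolar_mem_Ioo hy
  refine ⟨Complex.arg ⟨y 0, y 1⟩, ?_⟩
  have hρ : ‖(⟨y 0, y 1⟩ : ℂ)‖ = ‖y‖ * √(1 - cosPolar y ^ 2) := by
    rw [← sq_eq_sq₀ (norm_nonneg _) (by positivity), mul_pow,
      Real.sq_sqrt (one_sub_sq_pos hx).le, Complex.sq_norm, Complex.normSq_mk, cosPolar]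
    field_simp
    rw [norm_sq_eq y]
    ring
  have h1 := Complex.norm_mul_cos_arg ⟨y 0, y 1⟩
  have h2 := Complex.norm_mul_sin_arg ⟨y 0, y 1⟩
  rw [hρ] at h1 h2
  have h3 : ‖y‖ * cosPolar y = y 2 := by
    unfold cosPolar
    field_simp
  ext k
  fin_cases k
  · simp [eR, Real.sin_arccos, ← mul_assoc, h1]
  · simp [eR, Real.sin_arccos, ← mul_assoc, h2]
  · simp [eR, Real.cos_arccos hx.1.le hx.2.le, h3]

namespace IsAxisymmetricSolution

variable {u : R3 → R3} {p : R3 → ℝ}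

/-- A homogeneous axisymmetric field is determined by its values on a meridian. -/
lemma eq_axiField (h : IsAxisymmetricSolution u p) :
    EqOn u (axiField (fun x => u (meridian x) 0 / √(1 - x ^ 2))
      (fun x => u (meridian x) 1 / √(1 - x ^ 2)) (fun x => u (meridian x) 2)) offAxis := by
  intro y hy
  have h0 := norm_pos_of_mem_offAxis hy
  have hx := cosPolar_mem_Ioo hy
  obtain ⟨φ, hφ⟩ := exists_polar hy
  set x := cosPolar y with hxdef
  set θ := Real.arccos x with hθ
  have hs := sqrt_one_sub_sq_pos hx
  have hsin : Real.sin θ = √(1 - x ^ 2) := Real.sin_arccos x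
  have hcos : Real.cos θ = x := Real.cos_arccos hx.1.le hx.2.le
  have hθm : θ ∈ Ioo 0 Real.pi :=
    ⟨Real.arccos_pos.2 hx.2, lt_of_le_of_ne (Real.arccos_le_pi x) (by
      rw [Ne, Real.arccos_eq_pi]
      linarith [hx.1])⟩
  have hm : eR θ 0 = meridian x := by
    simpa using one_smul_eR_arccos ⟨hx.1.le, hx.2.le⟩
  have hhom : u (‖y‖ • eR θ 0) = ‖y‖⁻¹ • u (meridian x) := by
    rw [hm]
    exact h.homogeneous_velocity _ (offAxis_subset_slitSpace (meridian_mem_offAxis hx)) _ h0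
  obtain ⟨e1, e2, e3⟩ := h.axisymmetric ‖y‖ h0 θ hθm φ 0
  simp only [compR, compTheta, compPhi, hhom, ← hφ] at e1 e2 e3
  simp [eR, eTheta, ePhi, PiLp.inner_apply, Fin.sum_univ_three, hsin, hcos] at e1 e2 e3
  have hy0 : y 0 = ‖y‖ * (√(1 - x ^ 2) * Real.cos φ) := by
    conv_lhs => rw [hφ]
    simp [eR, hsin]
  have hy1 : y 1 = ‖y‖ * (√(1 - x ^ 2) * Real.sin φ) := by
    conv_lhs => rw [hφ]
    simp [eR, hsin]
  have hsq := Real.sq_sqrt (one_sub_sq_pos hx).le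
  have hcs := Real.sin_sq_add_cos_sq φ
  set σ := √(1 - x ^ 2) with hσ
  -- Inverts the orthogonal frame: first the rotation by θ in the meridian plane, then the rotation
  -- by φ in the horizontal plane.
  have f1 : u y 0 * Real.cos φ + u y 1 * Real.sin φ = ‖y‖⁻¹ * u (meridian x) 0 := by
    linear_combination σ * e1 + x * e2 - (u y 0 * Real.cos φ + u y 1 * Real.sin φ -
      ‖y‖⁻¹ * u (meridian x) 0) * hsq
  have f2 : u y 2 = ‖y‖⁻¹ * u (meridian x) 2 := by
    linear_combination x * e1 - σ * e2 - (u y 2 - ‖y‖⁻¹ * u (meridian x) 2) * hsq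
  have f3 : u y 0 = ‖y‖⁻¹ * (Real.cos φ * u (meridian x) 0 - Real.sin φ * u (meridian x) 1) := by
    linear_combination Real.cos φ * f1 - Real.sin φ * e3 - u y 0 * hcs
  have f4 : u y 1 = ‖y‖⁻¹ * (Real.sin φ * u (meridian x) 0 + Real.cos φ * u (meridian x) 1) := by
    linear_combination Real.sin φ * f1 + Real.cos φ * e3 - u y 1 * hcs
  ext k
  fin_cases k
  · show u y 0 = axiField _ _ _ y 0
    rw [axiField_zero, hom, hom, ← hxdef, ← hσ, hy0, hy1, f3]
    field_simp
  · show u y 1 = axiField _ _ _ y 1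
    rw [axiField_one, hom, hom, ← hxdef, ← hσ, hy0, hy1, f4]
    field_simp
  · show u y 2 = axiField _ _ _ y 2
    rw [axiField_two, hom, ← hxdef, f2]
    ring

end IsAxisymmetricSolution

/-- Recovering `U_θ` and `U_φ` from the meridian profiles of a divergence-free field. -/
lemma isProfile_of_divRes {α β ζ : ℝ → ℝ} (hα : ContDiffOn ℝ ∞ α (Ioo (-1) 1))
    (hβ : ContDiffOn ℝ ∞ β (Ioo (-1) 1)) (hζ : ContDiffOn ℝ ∞ ζ (Ioo (-1) 1))
    (hdiv : ∀ x ∈ Ioo (-1 : ℝ) 1, divRes α ζ x = 0) :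
    IsProfile (fun x => (1 - x ^ 2) * (x * α x - ζ x)) (fun x => (1 - x ^ 2) * β x) α β ζ := by
  -- The right side is u_r on the unit sphere. Incompressibility says that u_r is the derivative of
  -- U_θ, so α and ζ are recovered from f and f'.
  have hd : ∀ x ∈ Ioo (-1 : ℝ) 1, deriv (fun x => (1 - x ^ 2) * (x * α x - ζ x)) x =
      (1 - x ^ 2) * α x + x * ζ x := by
    intro x hx
    have dα := hα.hasDerivAt_of_isOpen isOpen_Ioo hx
    have dζ := hζ.hasDerivAt_of_isOpen isOpen_Ioo hx
    have h := hdiv x hx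
    simp only [divRes, rhoOp, zOp] at h
    push_cast at h
    refine (((hasDerivAt_one_sub_sq x).fun_mul
      (((hasDerivAt_id' x).fun_mul dα).fun_sub dζ)).congr_deriv ?_).deriv
    linear_combination -h
  refine ⟨?_, ?_, fun x hx => ?_, fun x hx => ?_, fun x hx => ?_⟩
  · fun_prop
  · fun_prop
  · have := (one_sub_sq_pos hx).ne'
    simp only [hd x hx]
    field_simp
    ring
  · have := (one_sub_sq_pos hx).ne'
    simp only
    field_simp
  · simp only [hd x hx]
    ring

namespace IsAxisymmetricSolution

variable {u : R3 → R3} {p : R3 → ℝ}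

/-- The pressure is eliminated by following it along three curves: a circle of latitude gives the
swirl equation, and the ray and the meridian together give the equation for the Riccati form. -/
lemma profileEquations (h : IsAxisymmetricSolution u p) : ∃ f g : ℝ → ℝ, ProfileEquations f g ∧
    (∀ x ∈ Ioo (-1 : ℝ) 1, f x = √(1 - x ^ 2) *
      (x * u (meridian x) 0 - √(1 - x ^ 2) * u (meridian x) 2)) ∧
    (∀ x ∈ Ioo (-1 : ℝ) 1, g x = √(1 - x ^ 2) * u (meridian x) 1) := by
  set α := fun x => u (meridian x) 0 / √(1 - x ^ 2) with hαdef
  set β := fun x => u (meridian x) 1 / √(1 - x ^ 2) with hβdef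
  set ζ := fun x => u (meridian x) 2 with hζdef
  have hu : EqOn u (axiField α β ζ) offAxis := h.eq_axiField
  have hmem : ∀ x ∈ Ioo (-1 : ℝ) 1, meridian x ∈ slitSpace := fun x hx =>
    offAxis_subset_slitSpace (meridian_mem_offAxis hx)
  have hum : ∀ j, ContDiffOn ℝ ∞ (fun x => u (meridian x) j) (Ioo (-1) 1) := fun j =>
    (contDiff_coord j).comp_contDiffOn (h.smooth_velocity.comp contDiffOn_meridian hmem)
  have hsq : ContDiffOn ℝ ∞ (fun x : ℝ => √(1 - x ^ 2)) (Ioo (-1) 1) :=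
    ContDiffOn.sqrt (by fun_prop) fun x hx => (one_sub_sq_pos hx).ne'
  have hα : ContDiffOn ℝ ∞ α (Ioo (-1) 1) :=
    (hum 0).div hsq fun x hx => (sqrt_one_sub_sq_pos hx).ne'
  have hβ : ContDiffOn ℝ ∞ β (Ioo (-1) 1) :=
    (hum 1).div hsq fun x hx => (sqrt_one_sub_sq_pos hx).ne'
  have hζ : ContDiffOn ℝ ∞ ζ (Ioo (-1) 1) := hum 2
  have dp : ∀ {y}, y ∈ offAxis → DifferentiableAt ℝ p y := fun hy =>
    h.smooth_pressure.differentiableAt_of_isOpen isOpen_slitSpace (offAxis_subset_slitSpace hy)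
  have heq : ∀ y ∈ offAxis, (∀ j, momentum (axiField α β ζ) (fun z => axiField α β ζ z j) y +
      pd j p y = 0) ∧ ∑ i, pd i (fun z => axiField α β ζ z i) y = 0 := by
    intro y hy
    have h1 := (navierStokes_iff isOpen_slitSpace h.smooth_velocity
      (offAxis_subset_slitSpace hy)).1 (h.equations y (offAxis_subset_slitSpace hy))
    refine ⟨fun j => ?_, ?_⟩
    · rw [← momentum_congr isOpen_offAxis hu hy]
      exact h1.1 j
    · rw [← h1.2]
      refine Finset.sum_congr rfl fun i _ => pd_congr isOpen_offAxis (fun z hz => ?_) hy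
      simp only [hu hz]
  have hdiv : ∀ x ∈ Ioo (-1 : ℝ) 1, divRes α ζ x = 0 := by
    intro x hx
    have h1 := (heq _ (meridian_mem_offAxis hx)).2
    rw [div_axiField hα hβ hζ (meridian_mem_offAxis hx), norm_meridian hx,
      cosPolar_meridian hx] at h1
    simpa using h1
  have hP := isProfile_of_divRes hα hβ hζ hdiv
  refine ⟨_, _, ⟨hP.smooth_f, hP.smooth_g, fun x hx => ?_, fun x hx => ?_⟩, fun x hx => ?_,
    fun x hx => ?_⟩
  · have hw := one_sub_sq_pos hx
    have hs := sqrt_one_sub_sq_pos hx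
    have hss := Real.sq_sqrt hw.le
    set σ := √(1 - x ^ 2) with hσ
    -- The pressure is not assumed to be independent of φ. Its derivative along a circle of latitude
    -- is a constant, and periodicity with Rolle's theorem makes that constant zero.
    have hcirc : ∀ φ, HasDerivAt
        (fun φ => p !₂[σ * Real.cos φ, σ * Real.sin φ, x])
        (-(1 - x ^ 2) * swirlRes α β ζ x) φ := by
      intro φ
      have hcs := Real.sin_sq_add_cos_sq φ
      have hn : ‖(!₂[σ * Real.cos φ, σ * Real.sin φ, x] : R3)‖ = 1 := by
        refine (pow_eq_one_iff_of_nonneg (norm_nonneg _) two_ne_zero).1 ?_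
        rw [norm_sq_eq]
        simp
        linear_combination σ ^ 2 * hcs + hss
      have hoff : (!₂[σ * Real.cos φ, σ * Real.sin φ, x] : R3) ∈ offAxis := by
        show 0 < (σ * Real.cos φ) ^ 2 + (σ * Real.sin φ) ^ 2
        nlinarith
      have hc : cosPolar !₂[σ * Real.cos φ, σ * Real.sin φ, x] = x := by
        rw [cosPolar, hn, div_one]
        rfl
      refine (hasDerivAt_comp_curve (dp hoff) ((Real.hasDerivAt_cos φ).const_mul σ)
        ((Real.hasDerivAt_sin φ).const_mul σ) (hasDerivAt_const φ x)).congr_deriv ?_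
      have e0 := (heq _ hoff).1 0
      have e1 := (heq _ hoff).1 1
      rw [momentum_axiField_zero hα hβ hoff, hn, hc] at e0
      rw [momentum_axiField_one hα hβ hoff, hn, hc] at e1
      simp at e0 e1 ⊢
      linear_combination -σ * Real.sin φ * e0 + σ * Real.cos φ * e1 -
        swirlRes α β ζ x * σ ^ 2 * hcs - swirlRes α β ζ x * hss
    obtain ⟨c, -, hc⟩ := exists_hasDerivAt_eq_zero Real.two_pi_pos
      (fun φ _ => (hcirc φ).continuousAt.continuousWithinAt) (by simp) (fun φ _ => hcirc φ)
    have h0 : swirlRes α β ζ x = 0 := by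
      rcases mul_eq_zero.1 hc with h | h
      · linarith
      · exact h
    rw [hP.swirlRes_eq hx, div_eq_zero_iff] at h0
    rcases h0 with h0 | h0
    · linarith
    · linarith
  -- Differentiating along the ray at c = 1 and using (-2)-homogeneity expresses p itself;
  -- differentiating along the meridian expresses its derivative.
  · have hpm : ∀ z ∈ Ioo (-1 : ℝ) 1,
        2 * p (meridian z) = pressureForm (fun x => (1 - x ^ 2) * (x * α x - ζ x))
          (fun x => (1 - x ^ 2) * β x) z ∧
        HasDerivAt (fun z => p (meridian z)) (z * radialRes α β ζ z - axialRes α ζ z) z := by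
      intro z hz
      have hoff := meridian_mem_offAxis hz
      have hs := sqrt_one_sub_sq_pos hz
      have hss := Real.sq_sqrt (one_sub_sq_pos hz).le
      have e0 := (heq _ hoff).1 0
      have e2 := (heq _ hoff).1 2
      rw [momentum_axiField_zero hα hβ hoff, norm_meridian hz, cosPolar_meridian hz] at e0
      rw [momentum_axiField_two hζ hoff, norm_meridian hz, cosPolar_meridian hz] at e2
      have m0 : meridian z 0 = √(1 - z ^ 2) := rfl
      have m1 : meridian z 1 = 0 := rfl
      simp only [m0, m1] at e0 e2
      norm_num at e0 e2
      constructor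
      · have hsc : ∀ c : ℝ, (!₂[c * √(1 - z ^ 2), c * 0, c * z] : R3) = c • meridian z := by
          intro c
          ext k
          fin_cases k <;> simp [meridian]
        have d1 : HasDerivAt (fun c : ℝ => p !₂[c * √(1 - z ^ 2), c * 0, c * z])
            (1 * √(1 - z ^ 2) * pd 0 p !₂[1 * √(1 - z ^ 2), 1 * 0, 1 * z] +
              1 * 0 * pd 1 p !₂[1 * √(1 - z ^ 2), 1 * 0, 1 * z] +
              1 * z * pd 2 p !₂[1 * √(1 - z ^ 2), 1 * 0, 1 * z]) 1 :=
          hasDerivAt_comp_curve (by rw [hsc, one_smul]; exact dp hoff)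
            ((hasDerivAt_id' 1).mul_const _) ((hasDerivAt_id' 1).mul_const _)
            ((hasDerivAt_id' 1).mul_const _)
        have d2 : HasDerivAt (fun c : ℝ => (c ^ 2)⁻¹ * p (meridian z))
            (-2 * p (meridian z)) 1 := by
          refine (((hasDerivAt_pow 2 (1 : ℝ)).fun_inv (by norm_num)).mul_const _).congr_deriv ?_
          norm_num
        have d3 := d1.unique (d2.congr_of_eventuallyEq (by
          filter_upwards [Ioi_mem_nhds one_pos] with c hc
          rw [hsc]
          exact h.homogeneous_pressure _ (offAxis_subset_slitSpace hoff) c hc))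
        rw [hsc, one_smul] at d3
        rw [pressureForm, ← (hP.radialRes_axialRes hz).1]
        linear_combination d3 - √(1 - z ^ 2) * e0 - z * e2 + radialRes α β ζ z * hss
      · have dsq : HasDerivAt (fun z : ℝ => √(1 - z ^ 2)) (-(2 * z) / (2 * √(1 - z ^ 2))) z :=
          (hasDerivAt_one_sub_sq z).sqrt (one_sub_sq_pos hz).ne'
        refine (hasDerivAt_comp_curve (p := p) (a := fun z : ℝ => √(1 - z ^ 2)) (b := fun _ => 0)
          (c := fun z => z) (dp hoff) dsq (hasDerivAt_const z (0 : ℝ))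
          (hasDerivAt_id' z)).congr_deriv ?_
        show -(2 * z) / (2 * √(1 - z ^ 2)) * pd 0 p (meridian z) + 0 * pd 1 p (meridian z) +
          1 * pd 2 p (meridian z) = _
        have e0' : pd 0 p (meridian z) = -(√(1 - z ^ 2) * radialRes α β ζ z) := by linarith
        rw [e0']
        field_simp
        linear_combination e2
    -- Comparing the two formulas for the derivative of 2 p leaves exactly the meridian equation.
    have hD := (hpm x hx).2.const_mul 2
    have hD' := hD.congr_of_eventuallyEq (f₁ := pressureForm
      (fun x => (1 - x ^ 2) * (x * α x - ζ x)) (fun x => (1 - x ^ 2) * β x)) (by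
        filter_upwards [isOpen_Ioo.mem_nhds hx] with z hz using (hpm z hz).1.symm)
    have h1 := hD'.unique (deriv_pressureForm hP.smooth_f hP.smooth_g hx)
    rw [(hP.radialRes_axialRes hx).2] at h1
    linarith
  · have hs := sqrt_one_sub_sq_pos hx
    have hss := Real.sq_sqrt (one_sub_sq_pos hx).le
    simp only [hαdef, hζdef]
    rw [← hss]
    field_simp
    rw [Real.sqrt_sq hs.le]
  · have hs := sqrt_one_sub_sq_pos hx
    have hss := Real.sq_sqrt (one_sub_sq_pos hx).le
    simp only [hβdef]
    rw [← hss]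
    field_simp
    rw [Real.sqrt_sq hs.le]
    field_simp

lemma UTheta_eq {x : ℝ} (hx : x ∈ Icc (-1 : ℝ) 1) : UTheta u x = √(1 - x ^ 2) *
    (x * u (meridian x) 0 - √(1 - x ^ 2) * u (meridian x) 2) := by
  rw [UTheta, compTheta, one_smul_eR_arccos hx]
  simp [eTheta, PiLp.inner_apply, Fin.sum_univ_three, Real.sin_arccos,
    Real.cos_arccos hx.1 hx.2]
  ring

lemma UPhi_eq {x : ℝ} (hx : x ∈ Icc (-1 : ℝ) 1) :
    UPhi u x = √(1 - x ^ 2) * u (meridian x) 1 := by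
  rw [UPhi, compPhi, one_smul_eR_arccos hx]
  simp [ePhi, PiLp.inner_apply, Fin.sum_univ_three, Real.sin_arccos]
  ring

/-- `U_θ` has a finite limit at the south pole, and the swirl vanishes if it is at least `3`. -/
theorem exists_limit_south (h : IsAxisymmetricSolution u p) :
    ∃ a : ℝ, UThetaAtSouth u a ∧ (3 ≤ a → ∀ x ∈ Ioc (-1 : ℝ) 1, UPhi u x = 0) := by
  obtain ⟨f, g, hfg, hf, hg⟩ := h.profileEquations
  -- The velocity is continuous at the north pole, so the factor √(1 - x²) forces U_φ → 0 there: the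
  -- boundary condition which fixes the sign of g.
  have hcont : ContinuousAt (fun x => √(1 - x ^ 2) * u (meridian x) 1) 1 := by
    have hm : Continuous meridian := by
      unfold meridian
      fun_prop
    have hmem : meridian 1 ∈ slitSpace := by
      rintro ⟨-, -, h3⟩
      have : (meridian 1) 2 = 1 := rfl
      linarith
    have hu : ContinuousAt u (meridian 1) :=
      (h.smooth_velocity.differentiableAt_of_isOpen isOpen_slitSpace hmem).continuousAt
    have h1 : ContinuousAt (fun x => u (meridian x)) 1 :=
      ContinuousAt.comp (f := meridian) hu hm.continuousAt
    have h2 : ContinuousAt (fun x => u (meridian x) 1) 1 :=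
      ContinuousAt.comp (f := fun x => u (meridian x)) (coord 1).continuous.continuousAt h1
    exact ContinuousAt.mul (by fun_prop) h2
  have hg1 : Tendsto g (𝓝[<] 1) (𝓝 0) := by
    have h1 : Tendsto (fun x => √(1 - x ^ 2) * u (meridian x) 1) (𝓝[<] 1) (𝓝 0) := by
      simpa using hcont.tendsto.mono_left nhdsWithin_le_nhds
    refine h1.congr' ?_
    filter_upwards [Ioo_mem_nhdsLT (show (-1 : ℝ) < 1 by norm_num)] with x hx using (hg x hx).symm
  obtain ⟨a, ha, h3⟩ := hfg.south_pole hg1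
  refine ⟨a, ha.congr' ?_, fun h3a x hx => ?_⟩
  · filter_upwards [Ioo_mem_nhdsGT (show (-1 : ℝ) < 1 by norm_num)] with x hx
    rw [hf x hx, UTheta_eq (Ioo_subset_Icc_self hx)]
  · rcases hx.2.lt_or_eq with hlt | rfl
    · rw [UPhi_eq ⟨hx.1.le, hx.2⟩, ← hg x ⟨hx.1, hlt⟩]
      exact h3 h3a x ⟨hx.1, hlt⟩
    · simp [UPhi]

end IsAxisymmetricSolution

/-! ### Functions bounded by a power of y, and their primitives. -/

/-- `φ` is continuous on `(0, 3)` and bounded there by `C yᵖ`. -/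
structure PowBd (p C : ℝ) (φ : ℝ → ℝ) : Prop where
  cont : ContinuousOn φ (Ioo 0 3)
  bound : ∀ y ∈ Ioo (0 : ℝ) 3, |φ y| ≤ C * y ^ p

namespace PowBd

variable {p q C C' : ℝ} {φ ψ : ℝ → ℝ}

lemma congr (h : PowBd p C φ) (he : EqOn ψ φ (Ioo 0 3)) : PowBd p C ψ :=
  ⟨h.cont.congr he, fun y hy => by rw [he hy]; exact h.bound y hy⟩

lemma mono (h : PowBd p C φ) (hC : C ≤ C') : PowBd p C' φ :=
  ⟨h.cont, fun y hy => (h.bound y hy).trans (by have := hy.1; gcongr)⟩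

lemma nonneg (h : PowBd p C φ) : 0 ≤ C := by
  have h1 := (abs_nonneg _).trans (h.bound 1 ⟨by norm_num, by norm_num⟩)
  simpa using h1

lemma add (h : PowBd p C φ) (h' : PowBd p C' ψ) : PowBd p (C + C') (fun y => φ y + ψ y) :=
  ⟨h.cont.add h'.cont, fun y hy => by
    rw [add_mul]
    exact (abs_add_le _ _).trans (add_le_add (h.bound y hy) (h'.bound y hy))⟩

lemma const_mul (h : PowBd p C φ) (c : ℝ) : PowBd p (|c| * C) (fun y => c * φ y) :=
  ⟨continuousOn_const.mul h.cont, fun y hy => by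
    rw [abs_mul, mul_assoc]
    exact mul_le_mul_of_nonneg_left (h.bound y hy) (abs_nonneg c)⟩

lemma sub (h : PowBd p C φ) (h' : PowBd p C' ψ) : PowBd p (C + C') (fun y => φ y - ψ y) :=
  ⟨h.cont.sub h'.cont, fun y hy => by
    rw [add_mul]
    exact (abs_sub _ _).trans (add_le_add (h.bound y hy) (h'.bound y hy))⟩

lemma mul (h : PowBd p C φ) (h' : PowBd q C' ψ) : PowBd (p + q) (C * C') (fun y => φ y * ψ y) :=
  ⟨h.cont.mul h'.cont, fun y hy => by
    have h1 := h.bound y hy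
    have h2 := h'.bound y hy
    rw [abs_mul, Real.rpow_add hy.1]
    calc |φ y| * |ψ y| ≤ (C * y ^ p) * (C' * y ^ q) :=
          mul_le_mul h1 h2 (abs_nonneg _) ((abs_nonneg _).trans h1)
      _ = _ := by ring⟩

/-- Lowering the exponent costs the factor y^(p - q), at most 3^(p - q) since y < 3. -/
lemma weaken (h : PowBd p C φ) (hq : q ≤ p) : PowBd q (C * 3 ^ (p - q)) φ :=
  ⟨h.cont, fun y hy => by
    have h1 : y ^ p = y ^ (p - q) * y ^ q := by rw [← Real.rpow_add hy.1, sub_add_cancel]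
    have h2 : y ^ (p - q) ≤ (3 : ℝ) ^ (p - q) :=
      Real.rpow_le_rpow hy.1.le hy.2.le (by linarith)
    have h3 := h.nonneg
    have h4 := hy.1
    calc |φ y| ≤ C * (y ^ (p - q) * y ^ q) := by rw [← h1]; exact h.bound y hy
      _ ≤ C * (3 ^ (p - q) * y ^ q) := by gcongr
      _ = _ := by ring⟩

lemma rpow (p : ℝ) : PowBd p 1 (fun y => y ^ p) :=
  ⟨fun y hy => (Real.continuousAt_rpow_const y p (Or.inl hy.1.ne')).continuousWithinAt,
    fun y hy => by
      have := hy.1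
      rw [one_mul, abs_of_nonneg (by positivity)]⟩

lemma div_id (h : PowBd p C φ) : PowBd (p - 1) C (fun y => φ y / y) := by
  have h1 := h.mul (rpow (-1))
  rw [mul_one, ← sub_eq_add_neg] at h1
  refine h1.congr fun y hy => ?_
  simp only [Real.rpow_neg_one]
  rfl

end PowBd

/-- The primitive vanishing at `0`. -/
noncomputable def prim (φ : ℝ → ℝ) (y : ℝ) : ℝ := ∫ s in (0 : ℝ)..y, φ s

section prim

variable {a C C' : ℝ} {φ ψ : ℝ → ℝ} {y : ℝ}

lemma PowBd.intervalIntegrable (h : PowBd (a - 1) C φ) (ha : 0 < a) (hy : y ∈ Ioo (0 : ℝ) 3) :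
    IntervalIntegrable φ MeasureTheory.volume 0 y := by
  have hsub : uIoc (0 : ℝ) y ⊆ Ioo 0 3 := by
    rw [uIoc_of_le hy.1.le]
    exact fun s hs => ⟨hs.1, hs.2.trans_lt hy.2⟩
  have hg : IntervalIntegrable (fun s : ℝ => C * s ^ (a - 1)) MeasureTheory.volume 0 y :=
    (intervalIntegral.intervalIntegrable_rpow' (by linarith)).const_mul C
  refine hg.mono_fun' ((h.cont.mono hsub).aestronglyMeasurable measurableSet_uIoc) ?_
  filter_upwards [MeasureTheory.self_mem_ae_restrict measurableSet_uIoc] with s hs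
  exact h.bound s (hsub hs)

lemma PowBd.hasDerivAt_prim (h : PowBd (a - 1) C φ) (ha : 0 < a) (hy : y ∈ Ioo (0 : ℝ) 3) :
    HasDerivAt (prim φ) (φ y) y :=
  intervalIntegral.integral_hasDerivAt_right (h.intervalIntegrable ha hy)
    (h.cont.stronglyMeasurableAtFilter isOpen_Ioo y hy)
    (h.cont.continuousAt (isOpen_Ioo.mem_nhds hy))

lemma PowBd.prim (h : PowBd (a - 1) C φ) (ha : 0 < a) : PowBd a (C / a) (prim φ) := by
  refine ⟨fun y hy => (h.hasDerivAt_prim ha hy).continuousAt.continuousWithinAt, fun y hy => ?_⟩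
  have hg : IntervalIntegrable (fun s : ℝ => C * s ^ (a - 1)) MeasureTheory.volume 0 y :=
    (intervalIntegral.intervalIntegrable_rpow' (by linarith)).const_mul C
  have h1 := intervalIntegral.norm_integral_le_of_norm_le (f := φ) hy.1.le
    (Eventually.of_forall fun s hs => h.bound s ⟨hs.1, hs.2.trans_lt hy.2⟩) hg
  refine h1.trans_eq ?_
  rw [intervalIntegral.integral_const_mul, integral_rpow (Or.inl (by linarith))]
  simp only [sub_add_cancel]
  rw [Real.zero_rpow ha.ne']
  ring

lemma PowBd.prim_sub (h : PowBd (a - 1) C φ) (h' : PowBd (a - 1) C' ψ) (ha : 0 < a)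
    (hy : y ∈ Ioo (0 : ℝ) 3) :
    AxisymNS.prim φ y - AxisymNS.prim ψ y = AxisymNS.prim (fun s => φ s - ψ s) y :=
  (intervalIntegral.integral_sub (h.intervalIntegrable ha hy) (h'.intervalIntegrable ha hy)).symm

end prim

/-! ### The singular linear equation and a contraction principle. -/

/-- A bounded solution operator for `y w' = lam w + φ` in the class of functions bounded by a
multiple of `yᵅ`. -/
structure IsSolutionOperator (lam α c : ℝ) (S : (ℝ → ℝ) → ℝ → ℝ) : Prop where
  nonneg : 0 ≤ c
  hasDerivAt : ∀ {φ C}, PowBd α C φ → ∀ y ∈ Ioo (0 : ℝ) 3,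
    HasDerivAt (S φ) ((lam * S φ y + φ y) / y) y
  bound : ∀ {φ C}, PowBd α C φ → PowBd α (c * C) (S φ)
  sub : ∀ {φ ψ C C'}, PowBd α C φ → PowBd α C' ψ → ∀ y ∈ Ioo (0 : ℝ) 3,
    S φ y - S ψ y = S (fun s => φ s - ψ s) y

/-- Variation of constants from the singular point: for lam < α the integrand is O(s^(α - lam - 1)),
hence integrable at 0. -/
lemma isSolutionOperator_of_lt {lam α : ℝ} (h : lam < α) : IsSolutionOperator lam α (1 / (α - lam))
    (fun φ y => y ^ lam * prim (fun s => s ^ (-lam - 1) * φ s) y) := by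
  have ha : 0 < α - lam := sub_pos.2 h
  have hw : ∀ {φ C}, PowBd α C φ → PowBd (α - lam - 1) C (fun s => s ^ (-lam - 1) * φ s) := by
    intro φ C hφ
    have := (PowBd.rpow (-lam - 1)).mul hφ
    rwa [one_mul, show -lam - 1 + α = α - lam - 1 by ring] at this
  refine ⟨by positivity, fun {φ C} hφ y hy => ?_, fun {φ C} hφ => ?_,
    fun {φ ψ C C'} hφ hψ y hy => ?_⟩
  · have hy0 := hy.1
    refine ((Real.hasDerivAt_rpow_const (p := lam) (Or.inl hy0.ne')).fun_mul
      ((hw hφ).hasDerivAt_prim ha hy)).congr_deriv ?_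
    have e1 : y ^ (lam - 1) = y ^ lam / y := Real.rpow_sub_one hy0.ne' lam
    have e2 : y ^ lam * y ^ (-lam - 1) = y⁻¹ := by
      rw [← Real.rpow_add hy0, show lam + (-lam - 1) = -1 by ring, Real.rpow_neg_one]
    rw [e1, ← mul_assoc (y ^ lam), e2]
    field_simp
  · have := (PowBd.rpow lam).mul ((hw hφ).prim ha)
    rw [add_sub_cancel, one_mul] at this
    exact this.mono (by rw [one_div, inv_mul_eq_div])
  · rw [← mul_sub, (hw hφ).prim_sub (hw hψ) ha hy]
    simp only [mul_sub]

/-- For lam > α the integral need not converge at 0, so it starts at the interior point 2. The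
homogeneous solution y^lam thereby admitted is itself O(y^α). -/
lemma isSolutionOperator_of_gt {lam α : ℝ} (h : α < lam) :
    IsSolutionOperator lam α ((3 / 2) ^ (lam - α) / (lam - α))
      (fun φ y => y ^ lam * ∫ s in (2 : ℝ)..y, s ^ (-lam - 1) * φ s) := by
  have ha : 0 < lam - α := sub_pos.2 h
  have hw : ∀ {φ C}, PowBd α C φ → PowBd (α - lam - 1) C (fun s => s ^ (-lam - 1) * φ s) := by
    intro φ C hφ
    have := (PowBd.rpow (-lam - 1)).mul hφ
    rwa [one_mul, show -lam - 1 + α = α - lam - 1 by ring] at this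
  have hsub : ∀ y ∈ Ioo (0 : ℝ) 3, uIcc 2 y ⊆ Ioo 0 3 := fun y hy =>
    ordConnected_Ioo.uIcc_subset (by norm_num) hy
  have hint : ∀ {φ C}, PowBd α C φ → ∀ y ∈ Ioo (0 : ℝ) 3,
      IntervalIntegrable (fun s => s ^ (-lam - 1) * φ s) MeasureTheory.volume 2 y :=
    fun hφ y hy => ((hw hφ).cont.mono (hsub y hy)).intervalIntegrable
  have hder : ∀ {φ C}, PowBd α C φ → ∀ y ∈ Ioo (0 : ℝ) 3,
      HasDerivAt (fun y => y ^ lam * ∫ s in (2 : ℝ)..y, s ^ (-lam - 1) * φ s)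
        ((lam * (y ^ lam * ∫ s in (2 : ℝ)..y, s ^ (-lam - 1) * φ s) + φ y) / y) y := by
    intro φ C hφ y hy
    have hy0 := hy.1
    refine ((Real.hasDerivAt_rpow_const (p := lam) (Or.inl hy0.ne')).fun_mul
      (intervalIntegral.integral_hasDerivAt_right (hint hφ y hy)
        ((hw hφ).cont.stronglyMeasurableAtFilter isOpen_Ioo y hy)
        ((hw hφ).cont.continuousAt (isOpen_Ioo.mem_nhds hy)))).congr_deriv ?_
    have e1 : y ^ (lam - 1) = y ^ lam / y := Real.rpow_sub_one hy0.ne' lam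
    have e2 : y ^ lam * y ^ (-lam - 1) = y⁻¹ := by
      rw [← Real.rpow_add hy0, show lam + (-lam - 1) = -1 by ring, Real.rpow_neg_one]
    rw [e1, ← mul_assoc (y ^ lam) (y ^ (-lam - 1)), e2]
    field_simp
  refine ⟨by positivity, fun {φ C} hφ y hy => hder hφ y hy, fun {φ C} hφ => ⟨fun y hy =>
    (hder hφ y hy).continuousAt.continuousWithinAt, fun y hy => ?_⟩,
    fun {φ ψ C C'} hφ hψ y hy => ?_⟩
  · have hy0 := hy.1
    have h0 : (0 : ℝ) ∉ uIcc 2 y := fun h0 => lt_irrefl 0 (hsub y hy h0).1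
    have hg : IntervalIntegrable (fun s : ℝ => C * s ^ (α - lam - 1)) MeasureTheory.volume 2 y :=
      (intervalIntegral.intervalIntegrable_rpow (Or.inr h0)).const_mul C
    have h1 := intervalIntegral.norm_integral_le_abs_of_norm_le
      (f := fun s => s ^ (-lam - 1) * φ s) (by
        filter_upwards [MeasureTheory.self_mem_ae_restrict measurableSet_uIoc] with s hs
        exact (hw hφ).bound s (hsub y hy (uIoc_subset_uIcc hs))) hg
    rw [intervalIntegral.integral_const_mul, integral_rpow (Or.inr ⟨by linarith, h0⟩),
      sub_add_cancel] at h1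
    have hC := hφ.nonneg
    have h2 : |C * ((y ^ (α - lam) - 2 ^ (α - lam)) / (α - lam))| ≤
        C * ((3 / 2) ^ (lam - α) * y ^ (α - lam) / (lam - α)) := by
      have e1 : (1 : ℝ) ≤ (3 / 2) ^ (lam - α) := Real.one_le_rpow (by norm_num) ha.le
      have e2 : 0 < y ^ (α - lam) := Real.rpow_pos_of_pos hy0 _
      -- The contribution of the base point 2 is compared with y^(α - lam) using y < 3, whence the
      -- factor (3/2)^(lam - α).
      have e3 : (2 : ℝ) ^ (α - lam) ≤ (3 / 2) ^ (lam - α) * y ^ (α - lam) := by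
        rw [show α - lam = -(lam - α) by ring, Real.rpow_neg hy0.le, Real.rpow_neg (by norm_num),
          ← Real.inv_rpow hy0.le, ← Real.inv_rpow (by norm_num), ← Real.mul_rpow (by norm_num)
          (by positivity)]
        refine Real.rpow_le_rpow (by norm_num) ?_ ha.le
        have : (3 : ℝ)⁻¹ ≤ y⁻¹ := inv_anti₀ hy0 hy.2.le
        linarith
      have e4 : (0 : ℝ) < 2 ^ (α - lam) := by positivity
      rw [abs_mul, abs_of_nonneg hC, abs_div, abs_of_neg (show α - lam < 0 by linarith), neg_sub]
      refine mul_le_mul_of_nonneg_left (div_le_div_of_nonneg_right ?_ ha.le) hC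
      rw [abs_le]
      constructor <;> nlinarith
    have h3 := h1.trans h2
    have e5 : 0 < y ^ lam := Real.rpow_pos_of_pos hy0 _
    rw [abs_mul, abs_of_pos e5]
    calc y ^ lam * |∫ s in (2 : ℝ)..y, s ^ (-lam - 1) * φ s| ≤
          y ^ lam * (C * ((3 / 2) ^ (lam - α) * y ^ (α - lam) / (lam - α))) := by
          gcongr
          exact h3
      _ = (3 / 2) ^ (lam - α) / (lam - α) * C * (y ^ lam * y ^ (α - lam)) := by ring
      _ = _ := by rw [← Real.rpow_add hy0, add_sub_cancel]
  · rw [← mul_sub, ← intervalIntegral.integral_sub (hint hφ y hy) (hint hψ y hy)]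
    simp only [mul_sub]

/-- A contraction principle in the class of functions bounded by a multiple of `yᵅ`. -/
lemma exists_fixedPoint {α δ : ℝ} (hδ : 0 ≤ δ) (N : (ℝ → ℝ) → ℝ → ℝ)
    (h1 : ∀ w, PowBd α δ w → PowBd α δ (N w))
    (h2 : ∀ w₁ w₂ d, PowBd α δ w₁ → PowBd α δ w₂ → PowBd α d (fun y => w₁ y - w₂ y) →
      PowBd α (d / 2) (fun y => N w₁ y - N w₂ y)) :
    ∃ w, PowBd α δ w ∧ EqOn w (N w) (Ioo 0 3) := by
  classical
  let X := Ioo (0 : ℝ) 3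
  -- The function w corresponds to the bounded continuous function y^(-α) w, and the weighted bound
  -- to the supremum norm. The value 0 outside (0, 3) is a mere default.
  let ext : (BoundedContinuousFunction X ℝ) → ℝ → ℝ := fun v y =>
    if h : y ∈ Ioo (0 : ℝ) 3 then y ^ α * v ⟨y, h⟩ else 0
  have hext : ∀ (v : BoundedContinuousFunction X ℝ) (y) (hy : y ∈ Ioo (0 : ℝ) 3),
      ext v y = y ^ α * v ⟨y, hy⟩ := fun v y hy => dif_pos hy
  have hcont : ∀ v, ContinuousOn (ext v) (Ioo 0 3) := by
    intro v
    rw [continuousOn_iff_continuous_domRestrict]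
    have : (Ioo (0 : ℝ) 3).domRestrict (ext v) = fun y : X => (y : ℝ) ^ α * v y := by
      ext y
      exact hext v y y.2
    rw [this]
    exact (continuousOn_iff_continuous_domRestrict.1 (PowBd.rpow α).cont).mul v.continuous
  have hbd : ∀ v (c : ℝ), ‖v‖ ≤ c → PowBd α c (ext v) := fun v c hv =>
    ⟨hcont v, fun y hy => by
      have e : 0 < y ^ α := Real.rpow_pos_of_pos hy.1 _
      rw [hext v y hy, abs_mul, abs_of_pos e, mul_comm]
      exact mul_le_mul_of_nonneg_right ((v.norm_coe_le_norm _).trans hv) e.le⟩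
  have hball : ∀ v : Metric.closedBall (0 : BoundedContinuousFunction X ℝ) δ,
      PowBd α δ (ext v) := fun v => hbd v δ (mem_closedBall_zero_iff.1 v.2)
  have hNc : ∀ v : Metric.closedBall (0 : BoundedContinuousFunction X ℝ) δ,
      Continuous fun y : X => (y : ℝ) ^ (-α) * N (ext v) y := fun v =>
    (continuousOn_iff_continuous_domRestrict.1 (PowBd.rpow (-α)).cont).mul
      (continuousOn_iff_continuous_domRestrict.1 (h1 _ (hball v)).cont)
  have hcancel : ∀ (y : X), (y : ℝ) ^ (-α) * (y : ℝ) ^ α = 1 := fun y => by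
    rw [← Real.rpow_add y.2.1, neg_add_cancel, Real.rpow_zero]
  have hscale : ∀ (φ : ℝ → ℝ) c, PowBd α c φ → ∀ y : X, ‖(y : ℝ) ^ (-α) * φ y‖ ≤ c := by
    intro φ c hφ y
    have e : 0 < (y : ℝ) ^ (-α) := Real.rpow_pos_of_pos y.2.1 _
    rw [norm_mul, Real.norm_of_nonneg e.le]
    calc (y : ℝ) ^ (-α) * ‖φ y‖ ≤ (y : ℝ) ^ (-α) * (c * (y : ℝ) ^ α) :=
          mul_le_mul_of_nonneg_left (hφ.bound y y.2) e.le
      _ = c * ((y : ℝ) ^ (-α) * (y : ℝ) ^ α) := by ring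
      _ = c := by rw [hcancel, mul_one]
  let T : Metric.closedBall (0 : BoundedContinuousFunction X ℝ) δ →
      Metric.closedBall (0 : BoundedContinuousFunction X ℝ) δ := fun v =>
    ⟨BoundedContinuousFunction.ofNormedAddCommGroup _ (hNc v) δ
      (hscale _ _ (h1 _ (hball v))), by
      simpa using BoundedContinuousFunction.norm_ofNormedAddCommGroup_le _ hδ
        (hscale _ _ (h1 _ (hball v)))⟩
  have hT : ContractingWith (1 / 2) T := by
    refine ⟨by norm_num, LipschitzWith.of_dist_le_mul fun v₁ v₂ => ?_⟩
    rw [Subtype.dist_eq, Subtype.dist_eq]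
    refine (BoundedContinuousFunction.dist_le (by positivity)).2 fun y => ?_
    have hd : PowBd α (dist (v₁ : BoundedContinuousFunction X ℝ) v₂)
        (fun y => ext v₁ y - ext v₂ y) := by
      refine (hbd ((v₁ : BoundedContinuousFunction X ℝ) - v₂) _ (dist_eq_norm _ _).ge).congr
        fun y hy => ?_
      simp only [hext _ y hy]
      simp [mul_sub]
    have := hscale _ _ (h2 _ _ _ (hball v₁) (hball v₂) hd) y
    rw [dist_eq_norm]
    show ‖(y : ℝ) ^ (-α) * N (ext v₁) y - (y : ℝ) ^ (-α) * N (ext v₂) y‖ ≤ _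
    rw [← mul_sub]
    refine this.trans_eq ?_
    push_cast
    ring
  have : CompleteSpace (Metric.closedBall (0 : BoundedContinuousFunction X ℝ) δ) :=
    Metric.isClosed_closedBall.completeSpace_coe
  have : Nonempty (Metric.closedBall (0 : BoundedContinuousFunction X ℝ) δ) :=
    ⟨⟨0, Metric.mem_closedBall_self hδ⟩⟩
  set v := hT.fixedPoint T with hv
  have hfix : T v = v := hT.fixedPoint_isFixedPt
  refine ⟨ext v, hball v, fun y hy => ?_⟩
  have h3 : (v : BoundedContinuousFunction X ℝ) ⟨y, hy⟩ = y ^ (-α) * N (ext v) y := by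
    conv_lhs => rw [← hfix]
    rfl
  have h4 := hcancel ⟨y, hy⟩
  simp only at h4
  rw [hext _ y hy, h3, ← mul_assoc, mul_comm (y ^ α), h4, one_mul]

/-! ### Averages over the segment from y to the north pole. -/

/-- Weighted average of `φ` over the segment from `y` to `2`. -/
noncomputable def avg (ρ φ : ℝ → ℝ) (y : ℝ) : ℝ := ∫ σ in (0 : ℝ)..1, ρ σ * φ (y + σ * (2 - y))

section avg

variable {ρ φ ψ : ℝ → ℝ} {y : ℝ}

lemma segment_mem {s : Set ℝ} (hs : s.OrdConnected) (h2 : (2 : ℝ) ∈ s) (hy : y ∈ s) {σ : ℝ}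
    (hσ : σ ∈ Icc (0 : ℝ) 1) : y + σ * (2 - y) ∈ s := by
  have : y + σ * (2 - y) ∈ segment ℝ y 2 :=
    ⟨1 - σ, σ, by linarith [hσ.2], hσ.1, by ring, by simp only [smul_eq_mul]; ring⟩
  exact hs.convex.segment_subset hy h2 this

lemma two_mem : (2 : ℝ) ∈ Ioo (0 : ℝ) 3 := by norm_num

/-- A compact interval containing 2 and a neighbourhood of y contains all segments from nearby
points to 2; it supplies the uniform bounds for dominated convergence. -/
lemma exists_Icc_nhds (hy : y ∈ Ioo (0 : ℝ) 3) :
    ∃ c d : ℝ, Icc c d ⊆ Ioo (0 : ℝ) 3 ∧ Icc c d ∈ 𝓝 y ∧ (2 : ℝ) ∈ Icc c d := by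
  refine ⟨min (y / 2) 2, max ((y + 3) / 2) 2, fun s hs => ⟨?_, ?_⟩, Icc_mem_nhds ?_ ?_,
    min_le_right _ _, le_max_right _ _⟩
  · exact lt_of_lt_of_le (lt_min (by linarith [hy.1]) (by norm_num)) hs.1
  · exact lt_of_le_of_lt hs.2 (max_lt (by linarith [hy.2]) (by norm_num))
  · exact lt_of_le_of_lt (min_le_left _ _) (by linarith [hy.1])
  · exact lt_of_lt_of_le (by linarith [hy.2]) (le_max_left _ _)

lemma continuousOn_avg_integrand (hρ : Continuous ρ) (hφ : ContinuousOn φ (Ioo 0 3))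
    (hy : y ∈ Ioo (0 : ℝ) 3) :
    ContinuousOn (fun σ => ρ σ * φ (y + σ * (2 - y))) (Icc 0 1) :=
  hρ.continuousOn.mul (hφ.comp (by fun_prop)
    fun σ hσ => segment_mem ordConnected_Ioo two_mem hy hσ)

lemma intervalIntegrable_avg_integrand (hρ : Continuous ρ) (hφ : ContinuousOn φ (Ioo 0 3))
    (hy : y ∈ Ioo (0 : ℝ) 3) :
    IntervalIntegrable (fun σ => ρ σ * φ (y + σ * (2 - y))) MeasureTheory.volume 0 1 :=
  ContinuousOn.intervalIntegrable (by
    rw [uIcc_of_le zero_le_one]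
    exact continuousOn_avg_integrand hρ hφ hy)

lemma aestronglyMeasurable_avg_integrand (hρ : Continuous ρ) (hφ : ContinuousOn φ (Ioo 0 3))
    (hy : y ∈ Ioo (0 : ℝ) 3) :
    MeasureTheory.AEStronglyMeasurable (fun σ => ρ σ * φ (y + σ * (2 - y)))
      (MeasureTheory.volume.restrict (uIoc 0 1)) :=
  (intervalIntegrable_avg_integrand hρ hφ hy).def'.aestronglyMeasurable

lemma exists_avg_bound (hρ : Continuous ρ) (hφ : ContinuousOn φ (Ioo 0 3)) {c d : ℝ}
    (hcd : Icc c d ⊆ Ioo (0 : ℝ) 3) (h2 : (2 : ℝ) ∈ Icc c d) :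
    ∃ B, ∀ σ ∈ uIoc (0 : ℝ) 1, ∀ z ∈ Icc c d, ‖ρ σ * φ (z + σ * (2 - z))‖ ≤ B := by
  obtain ⟨B₁, hB₁⟩ := isCompact_Icc.exists_bound_of_continuousOn (s := Icc (0 : ℝ) 1)
    hρ.continuousOn
  obtain ⟨B₂, hB₂⟩ := isCompact_Icc.exists_bound_of_continuousOn (hφ.mono hcd)
  refine ⟨B₁ * B₂, fun σ hσ z hz => ?_⟩
  rw [uIoc_of_le zero_le_one] at hσ
  have h1 := hB₁ σ ⟨hσ.1.le, hσ.2⟩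
  rw [norm_mul]
  exact mul_le_mul h1 (hB₂ _ (segment_mem ordConnected_Icc h2 hz ⟨hσ.1.le, hσ.2⟩))
    (norm_nonneg _) ((norm_nonneg _).trans h1)

lemma continuousOn_avg (hρ : Continuous ρ) (hφ : ContinuousOn φ (Ioo 0 3)) :
    ContinuousOn (avg ρ φ) (Ioo 0 3) := by
  intro y hy
  obtain ⟨c, d, hcd, hn, h2⟩ := exists_Icc_nhds hy
  obtain ⟨B, hB⟩ := exists_avg_bound hρ hφ hcd h2
  refine ContinuousAt.continuousWithinAt (intervalIntegral.continuousAt_of_dominated_interval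
    (bound := fun _ => B) ?_ ?_ intervalIntegrable_const ?_)
  · filter_upwards [isOpen_Ioo.mem_nhds hy] with z hz using
      aestronglyMeasurable_avg_integrand hρ hφ hz
  · filter_upwards [hn] with z hz
    exact Eventually.of_forall fun σ hσ => hB σ hσ z hz
  · refine Eventually.of_forall fun σ hσ => ?_
    rw [uIoc_of_le zero_le_one] at hσ
    have hm := segment_mem ordConnected_Ioo two_mem hy ⟨hσ.1.le, hσ.2⟩
    refine continuousAt_const.mul (ContinuousAt.comp (f := fun z => z + σ * (2 - z))
      (hφ.continuousAt (isOpen_Ioo.mem_nhds hm)) (by fun_prop))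

/-- The inner derivative of y + σ (2 - y) is 1 - σ, so differentiation changes only the weight. The
induction in `contDiffOn_avg` must therefore let the weight vary. -/
lemma hasDerivAt_avg {φ' : ℝ → ℝ} (hρ : Continuous ρ)
    (hφ : ∀ s ∈ Ioo (0 : ℝ) 3, HasDerivAt φ (φ' s) s) (hφ' : ContinuousOn φ' (Ioo 0 3))
    (hy : y ∈ Ioo (0 : ℝ) 3) :
    HasDerivAt (avg ρ φ) (avg (fun σ => ρ σ * (1 - σ)) φ' y) y := by
  have hφc : ContinuousOn φ (Ioo 0 3) := fun s hs => (hφ s hs).continuousAt.continuousWithinAt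
  have hρ' : Continuous fun σ => ρ σ * (1 - σ) := by fun_prop
  obtain ⟨c, d, hcd, hn, h2⟩ := exists_Icc_nhds hy
  obtain ⟨B, hB⟩ := exists_avg_bound hρ' hφ' hcd h2
  refine (intervalIntegral.hasDerivAt_integral_of_dominated_loc_of_deriv_le
    (F := fun z σ => ρ σ * φ (z + σ * (2 - z)))
    (F' := fun z σ => ρ σ * (1 - σ) * φ' (z + σ * (2 - z)))
    (bound := fun _ => B) hn ?_ (intervalIntegrable_avg_integrand hρ hφc hy)
    (aestronglyMeasurable_avg_integrand hρ' hφ' hy) ?_ intervalIntegrable_const ?_).2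
  · filter_upwards [isOpen_Ioo.mem_nhds hy] with z hz using
      aestronglyMeasurable_avg_integrand hρ hφc hz
  · exact Eventually.of_forall fun σ hσ z hz => hB σ hσ z hz
  · refine Eventually.of_forall fun σ hσ z hz => ?_
    rw [uIoc_of_le zero_le_one] at hσ
    have hm := segment_mem ordConnected_Ioo two_mem (hcd hz) ⟨hσ.1.le, hσ.2⟩
    have hin : HasDerivAt (fun z => z + σ * (2 - z)) (1 + σ * -1) z :=
      (hasDerivAt_id' z).fun_add (((hasDerivAt_id' z).const_sub 2).const_mul σ)
    refine (((hφ _ hm).comp z hin).const_mul (ρ σ)).congr_deriv ?_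
    ring

lemma contDiffOn_avg (n : ℕ) : ∀ {ρ φ : ℝ → ℝ}, Continuous ρ → ContDiffOn ℝ n φ (Ioo 0 3) →
    ContDiffOn ℝ n (avg ρ φ) (Ioo 0 3) := by
  induction n with
  | zero =>
    intro ρ φ hρ hφ
    exact contDiffOn_zero.2 (continuousOn_avg hρ hφ.continuousOn)
  | succ n ih =>
    intro ρ φ hρ hφ
    push_cast at hφ ⊢
    rw [contDiffOn_succ_iff_deriv_of_isOpen isOpen_Ioo] at hφ ⊢
    obtain ⟨hd, -, hc⟩ := hφ
    have hD : ∀ z ∈ Ioo (0 : ℝ) 3, HasDerivAt (avg ρ φ)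
        (avg (fun σ => ρ σ * (1 - σ)) (deriv φ) z) z := fun z hz =>
      hasDerivAt_avg hρ (fun s hs => (hd.differentiableAt (isOpen_Ioo.mem_nhds hs)).hasDerivAt)
        hc.continuousOn hz
    refine ⟨fun z hz => (hD z hz).differentiableAt.differentiableWithinAt, by simp, ?_⟩
    exact (ih (by fun_prop) hc).congr fun z hz => (hD z hz).deriv

lemma avg_sub (hρ : Continuous ρ) (hφ : ContinuousOn φ (Ioo 0 3))
    (hψ : ContinuousOn ψ (Ioo 0 3)) (hy : y ∈ Ioo (0 : ℝ) 3) :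
    avg ρ φ y - avg ρ ψ y = avg ρ (fun s => φ s - ψ s) y := by
  unfold avg
  rw [← intervalIntegral.integral_sub (intervalIntegrable_avg_integrand hρ hφ hy)
    (intervalIntegrable_avg_integrand hρ hψ hy)]
  simp only [mul_sub]

/-- Averaging over the segment to `2` gains up to one power of `y`, and a weight vanishing at the
end point `y` gains correspondingly more. -/
lemma PowBd.avg {a b c C : ℝ} (hρ : Continuous ρ) (ha : 0 ≤ a) (hb : 0 ≤ b) (hb1 : b < 1)
    (hc : 0 ≤ c) (hρc : ∀ σ ∈ Ioc (0 : ℝ) 1, |ρ σ| ≤ σ ^ c) (hφ : PowBd (-(a + b + c)) C φ) :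
    PowBd (-a) (C * 4 ^ (a + b + c) / (1 - b)) (avg ρ φ) := by
  refine ⟨continuousOn_avg hρ hφ.cont, fun y hy => ?_⟩
  have hC := hφ.nonneg
  have hy0 := hy.1
  set K := C * 4 ^ (a + b + c) * y ^ (-a) with hK
  have hg : IntervalIntegrable (fun σ : ℝ => K * σ ^ (-b)) MeasureTheory.volume 0 1 :=
    (intervalIntegral.intervalIntegrable_rpow' (by linarith)).const_mul K
  have h1 := intervalIntegral.norm_integral_le_of_norm_le
    (f := fun σ => ρ σ * φ (y + σ * (2 - y))) zero_le_one
    (Eventually.of_forall fun σ hσ => ?_) hg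
  · refine h1.trans_eq ?_
    rw [intervalIntegral.integral_const_mul, integral_rpow (Or.inl (by linarith))]
    rw [Real.one_rpow, Real.zero_rpow (by linarith), hK]
    have : 1 - b ≠ 0 := by linarith
    have : -b + 1 ≠ 0 := by linarith
    field_simp
    ring
  · have hσ0 := hσ.1
    have hm := segment_mem ordConnected_Ioo two_mem hy ⟨hσ.1.le, hσ.2⟩
    -- Points of the segment are at least a multiple of y + σ, so the power splits in three: the
    -- exponent a is left to y, the exponent b < 1 is integrable in σ, and the exponent c is
    -- absorbed by the weight.
    have hlow : (y + σ) / 4 ≤ y + σ * (2 - y) := by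
      nlinarith [hσ.1, hσ.2, hy.1, hy.2, mul_pos hσ.1 (sub_pos.2 hy.2),
        mul_nonneg (sub_nonneg.2 hσ.2) hy0.le]
    have hb' := hφ.bound _ hm
    have h2 : (y + σ * (2 - y)) ^ (-(a + b + c)) ≤
        4 ^ (a + b + c) * (y ^ (-a) * σ ^ (-b) * σ ^ (-c)) := by
      calc (y + σ * (2 - y)) ^ (-(a + b + c)) ≤ ((y + σ) / 4) ^ (-(a + b + c)) :=
            Real.rpow_le_rpow_of_nonpos (by positivity) hlow (by linarith)
        _ = 4 ^ (a + b + c) * ((y + σ) ^ (-a) * (y + σ) ^ (-b) * (y + σ) ^ (-c)) := by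
            rw [Real.div_rpow (by positivity) (by norm_num), Real.rpow_neg (by norm_num : (0:ℝ) ≤ 4),
              div_inv_eq_mul, mul_comm, ← Real.rpow_add (by positivity),
              ← Real.rpow_add (by positivity)]
            ring_nf
        _ ≤ 4 ^ (a + b + c) * (y ^ (-a) * σ ^ (-b) * σ ^ (-c)) := by
            have e1 : (y + σ) ^ (-a) ≤ y ^ (-a) :=
              Real.rpow_le_rpow_of_nonpos hy0 (by linarith) (by linarith)
            have e2 : (y + σ) ^ (-b) ≤ σ ^ (-b) :=
              Real.rpow_le_rpow_of_nonpos hσ0 (by linarith) (by linarith)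
            have e3 : (y + σ) ^ (-c) ≤ σ ^ (-c) :=
              Real.rpow_le_rpow_of_nonpos hσ0 (by linarith) (by linarith)
            gcongr
    have h3 : σ ^ c * σ ^ (-c) = 1 := by
      rw [← Real.rpow_add hσ0, add_neg_cancel, Real.rpow_zero]
    rw [norm_mul]
    calc ‖ρ σ‖ * ‖φ (y + σ * (2 - y))‖ ≤
          σ ^ c * (C * (4 ^ (a + b + c) * (y ^ (-a) * σ ^ (-b) * σ ^ (-c)))) := by
          refine mul_le_mul (hρc σ hσ) (hb'.trans ?_) (norm_nonneg _) (by positivity)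
          gcongr
      _ = C * 4 ^ (a + b + c) * y ^ (-a) * σ ^ (-b) * (σ ^ c * σ ^ (-c)) := by ring
      _ = K * σ ^ (-b) := by rw [h3, mul_one, hK]

end avg

/-! ### Calculus of bounds with Lipschitz dependence on w. -/

/-- The map `Φ` is bounded with constant `C yᵖ` and Lipschitz with constant `C yᵖ` on the functions
bounded by `yᵅ`. -/
def LipBd (α p C : ℝ) (Φ : (ℝ → ℝ) → ℝ → ℝ) : Prop :=
  ∀ w₁ w₂ d, PowBd α 1 w₁ → PowBd α 1 w₂ → PowBd α d (fun y => w₁ y - w₂ y) →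
    PowBd p C (Φ w₁) ∧ PowBd p (C * d) (fun y => Φ w₁ y - Φ w₂ y)

namespace LipBd

variable {α p q C C' : ℝ} {Φ Ψ : (ℝ → ℝ) → ℝ → ℝ}

lemma right {w₁ w₂ : ℝ → ℝ} {d : ℝ} (h : LipBd α p C Φ) (h₁ : PowBd α 1 w₁)
    (h₂ : PowBd α 1 w₂) (hd : PowBd α d (fun y => w₁ y - w₂ y)) : PowBd p C (Φ w₂) := by
  refine (h w₂ w₁ d h₂ h₁ ⟨h₂.cont.sub h₁.cont, fun y hy => ?_⟩).1
  rw [abs_sub_comm]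
  exact hd.bound y hy

lemma id : LipBd α α 1 fun w => w := fun w₁ w₂ d h₁ _ hd => ⟨h₁, by rwa [one_mul]⟩

lemma weaken (h : LipBd α p C Φ) (hq : q ≤ p) : LipBd α q (C * 3 ^ (p - q)) Φ :=
  fun w₁ w₂ d h₁ h₂ hd => ⟨(h w₁ w₂ d h₁ h₂ hd).1.weaken hq, by
    have := (h w₁ w₂ d h₁ h₂ hd).2.weaken hq
    rwa [mul_right_comm] at this⟩

lemma mul (h : LipBd α p C Φ) (h' : LipBd α q C' Ψ) :
    LipBd α (p + q) (2 * C * C') fun w y => Φ w y * Ψ w y := by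
  intro w₁ w₂ d h₁ h₂ hd
  obtain ⟨a1, a2⟩ := h w₁ w₂ d h₁ h₂ hd
  obtain ⟨b1, b2⟩ := h' w₁ w₂ d h₁ h₂ hd
  have hC := a1.nonneg
  have hC' := b1.nonneg
  refine ⟨(a1.mul b1).mono (by nlinarith [mul_nonneg hC hC']), ?_⟩
  refine (((a2.mul b1).add ((h.right h₁ h₂ hd).mul b2)).mono
    (show _ ≤ 2 * C * C' * d from le_of_eq (by ring))).congr fun y _ => ?_
  simp only
  ring

lemma of_fixed {φ : ℝ → ℝ} (h : PowBd p C φ) : LipBd α p C fun _ => φ := by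
  intro w₁ w₂ d _ _ hd
  refine ⟨h, ⟨by simpa using continuousOn_const, fun y hy => ?_⟩⟩
  have := h.nonneg
  have := hd.nonneg
  have := hy.1
  simp only [sub_self, abs_zero]
  positivity

lemma div_id (h : LipBd α p C Φ) : LipBd α (p - 1) C fun w y => Φ w y / y :=
  fun w₁ w₂ d h₁ h₂ hd => ⟨(h w₁ w₂ d h₁ h₂ hd).1.div_id,
    (h w₁ w₂ d h₁ h₂ hd).2.div_id.congr fun _ _ => (sub_div _ _ _).symm⟩

lemma prim {a : ℝ} (h : LipBd α (a - 1) C Φ) (ha : 0 < a) :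
    LipBd α a (C / a) fun w => prim (Φ w) := fun w₁ w₂ d h₁ h₂ hd => by
  obtain ⟨a1, a2⟩ := h w₁ w₂ d h₁ h₂ hd
  refine ⟨a1.prim ha, ?_⟩
  rw [div_mul_eq_mul_div]
  exact (a2.prim ha).congr fun y hy => a1.prim_sub (h.right h₁ h₂ hd) ha hy

lemma avg {ρ : ℝ → ℝ} {a b c : ℝ} (hρ : Continuous ρ) (ha : 0 ≤ a) (hb : 0 ≤ b) (hb1 : b < 1)
    (hc : 0 ≤ c) (hρc : ∀ σ ∈ Ioc (0 : ℝ) 1, |ρ σ| ≤ σ ^ c) (h : LipBd α (-(a + b + c)) C Φ) :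
    LipBd α (-a) (C * 4 ^ (a + b + c) / (1 - b)) fun w => avg ρ (Φ w) :=
  fun w₁ w₂ d h₁ h₂ hd => by
    obtain ⟨a1, a2⟩ := h w₁ w₂ d h₁ h₂ hd
    refine ⟨a1.avg hρ ha hb hb1 hc hρc, ?_⟩
    have := (a2.avg hρ ha hb hb1 hc hρc).congr (ψ := fun y => AxisymNS.avg ρ (Φ w₁) y -
      AxisymNS.avg ρ (Φ w₂) y) fun y hy => avg_sub hρ a1.cont (h.right h₁ h₂ hd).cont hy
    exact this.mono (le_of_eq (by ring))

/-- On [-C, C] the map t ↦ exp (-t) is bounded by exp C and Lipschitz with that constant; the factor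
1 + C lets one constant serve both requirements. -/
lemma exp_neg (h : LipBd α 0 C Φ) :
    LipBd α 0 (Real.exp C * (1 + C)) fun w y => Real.exp (-Φ w y) := by
  intro w₁ w₂ d h₁ h₂ hd
  obtain ⟨a1, a2⟩ := h w₁ w₂ d h₁ h₂ hd
  have b1 := h.right h₁ h₂ hd
  have hC := a1.nonneg
  have hd0 := hd.nonneg
  have key : ∀ x y : ℝ, |x| ≤ C → |y| ≤ C →
      |Real.exp (-x) - Real.exp (-y)| ≤ Real.exp C * |x - y| := by
    have aux : ∀ x y : ℝ, |x| ≤ C → Real.exp (-x) - Real.exp (-y) ≤ Real.exp C * |x - y| := by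
      intro x y hx
      have e1 : -(x - y) * -1 + 1 ≤ Real.exp (x - y) := by linarith [Real.add_one_le_exp (x - y)]
      have e2 : Real.exp (-y) = Real.exp (-x) * Real.exp (x - y) := by
        rw [← Real.exp_add]
        ring_nf
      have e3 : Real.exp (-x) ≤ Real.exp C := Real.exp_le_exp.2 (by linarith [(abs_le.1 hx).1])
      have e4 := (Real.exp_pos (-x)).le
      calc Real.exp (-x) - Real.exp (-y) = Real.exp (-x) * (1 - Real.exp (x - y)) := by
            rw [e2]
            ring
        _ ≤ Real.exp (-x) * |x - y| := by
            refine mul_le_mul_of_nonneg_left ?_ e4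
            linarith [neg_abs_le (x - y)]
        _ ≤ Real.exp C * |x - y| := mul_le_mul_of_nonneg_right e3 (abs_nonneg _)
    intro x y hx hy
    rw [abs_le]
    have h1 := aux x y hx
    have h2 := aux y x hy
    rw [abs_sub_comm] at h2
    constructor <;> linarith
  have hbd : ∀ {φ : ℝ → ℝ} {K}, PowBd 0 K φ → ∀ y ∈ Ioo (0 : ℝ) 3, |φ y| ≤ K := fun hφ y hy => by
    simpa using hφ.bound y hy
  have hcont : ∀ {φ : ℝ → ℝ} {K}, PowBd 0 K φ →
      ContinuousOn (fun y => Real.exp (-φ y)) (Ioo 0 3) := fun hφ =>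
    Real.continuous_exp.comp_continuousOn hφ.cont.neg
  refine ⟨⟨hcont a1, fun y hy => ?_⟩, ⟨(hcont a1).sub (hcont b1), fun y hy => ?_⟩⟩
  · rw [Real.rpow_zero, mul_one, abs_of_pos (Real.exp_pos _)]
    refine le_trans (Real.exp_le_exp.2 ?_) (le_mul_of_one_le_right (Real.exp_pos C).le (by linarith))
    linarith [(abs_le.1 (hbd a1 y hy)).1]
  · rw [Real.rpow_zero, mul_one]
    refine (key _ _ (hbd a1 y hy) (hbd b1 y hy)).trans ?_
    rw [mul_assoc]
    refine mul_le_mul_of_nonneg_left ((hbd a2 y hy).trans ?_) (Real.exp_pos C).le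
    nlinarith

end LipBd

/-! ### The swirl functionals and the reduced equation. -/

/-- The normalized derivative of the swirl belonging to the profile `m + w`. -/
noncomputable def swirlSlope (m : ℝ) (w : ℝ → ℝ) (y : ℝ) : ℝ :=
  y ^ (-m) * Real.exp (-prim (fun s => w s / s) y)

/-- The normalized swirl divided by `2 - y`, up to sign. -/
noncomputable def swirlMean (m : ℝ) (w : ℝ → ℝ) : ℝ → ℝ := avg (fun _ => 1) (swirlSlope m w)

/-- The normalized source term which the swirl contributes to the meridian equation. -/
noncomputable def swirlSource (m : ℝ) (w : ℝ → ℝ) (y : ℝ) : ℝ :=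
  swirlMean m w y * swirlSlope m w y / y

/-- The derivative of the inhomogeneity of the reduced Riccati equation. -/
noncomputable def swirlKernel (m : ℝ) (w : ℝ → ℝ) : ℝ → ℝ :=
  avg (fun σ => σ * (1 - σ)) (swirlSource m w)

/-- For w = O(y^α) the integral of w / s is bounded, so the exponential factor does not change the
order y^(-m); passing to a larger M gives room for small or negative m. -/
lemma lipBd_swirlSlope {m M α : ℝ} (hα : 0 < α) (hM : m ≤ M) :
    ∃ C, LipBd α (-M) C (swirlSlope m) := by
  have h1 := ((((LipBd.id (α := α)).div_id.prim hα).weaken hα.le).exp_neg)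
  have h2 := ((LipBd.of_fixed (α := α) (PowBd.rpow (-m))).mul h1)
  rw [add_zero] at h2
  exact ⟨_, h2.weaken (neg_le_neg hM)⟩

/-- The exponents used for the fixed point argument. -/
structure Exponents (m M a b α : ℝ) : Prop where
  le_M : m ≤ M
  M_eq : M = a + b
  a_nonneg : 0 ≤ a
  b_nonneg : 0 ≤ b
  b_lt : b < 1
  α_pos : 0 < α
  α_le : α ≤ 1
  low : 0 ≤ a + M - (1 - α)
  high : a + M - (1 - α) < 1

lemma Exponents.lipBd_swirlKernel {m M a b α : ℝ} (h : Exponents m M a b α) :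
    ∃ C, LipBd α (α - 1) C (swirlKernel m) := by
  obtain ⟨C, hG⟩ := lipBd_swirlSlope (m := m) h.α_pos h.le_M
  have hΓ : LipBd α (-a) _ (swirlMean m) := LipBd.avg (c := 0) continuous_const h.a_nonneg
    h.b_nonneg h.b_lt le_rfl (by simp) (by rwa [add_zero, ← h.M_eq])
  have hR : LipBd α _ _ (swirlSource m) := (hΓ.mul hG).div_id
  rw [show -a + -M - 1 = -((1 - α) + (a + M - (1 - α)) + 1) by ring] at hR
  have hV : LipBd α (-(1 - α)) _ (swirlKernel m) := hR.avg (by fun_prop)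
    (by linarith [h.α_le]) h.low h.high zero_le_one (fun σ hσ => by
      rw [Real.rpow_one, abs_of_nonneg (mul_nonneg hσ.1.le (by linarith [hσ.2]))]
      exact mul_le_of_le_one_right hσ.1.le (by linarith [hσ.1]))
  rw [neg_sub] at hV
  exact ⟨_, hV⟩

/-- The constraints need a > M - 1 and a + M < 2 - α, so 2 M < 3 - α; this is where m < 3/2 is used.
For m ≥ 1 the choice M = m works and 1 - m < α. For m < 1 there is room for M = 1, and α is taken
below 1 - m, which calls for the other solution operator. -/
lemma exists_exponents {m : ℝ} (hm : m < 3 / 2) :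
    ∃ M a b α, Exponents m M a b α ∧ ∃ c S, IsSolutionOperator (1 - m) α c S := by
  rcases le_or_gt 1 m with h | h
  · refine ⟨m, m - 1 + (3 / 2 - m) / 2, 1 - (3 / 2 - m) / 2, 3 / 2 - m, ?_, _, _,
      isSolutionOperator_of_lt (by linarith)⟩
    constructor <;> linarith
  · refine ⟨1, 1 / 4, 3 / 4, min (1 / 2) ((1 - m) / 2), ?_, _, _, isSolutionOperator_of_gt ?_⟩
    · have h1 := min_le_left (1 / 2) ((1 - m) / 2)
      have h2 : 0 < min (1 / 2) ((1 - m) / 2) := lt_min (by norm_num) (by linarith)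
      constructor <;> linarith
    · exact lt_of_le_of_lt (min_le_right _ _) (by linarith)

/-- Solutions of the reduced Riccati equation with small swirl. -/
lemma exists_reduced_solution {m : ℝ} (hm : m < 3 / 2) :
    ∃ α e : ℝ, ∃ w : ℝ → ℝ, 0 < α ∧ 0 < e ∧ PowBd α 1 w ∧
      (∃ C, PowBd (α - 1) C (swirlKernel m w)) ∧
      ∀ y ∈ Ioo (0 : ℝ) 3, HasDerivAt w
        (((1 - m) * w y + (e * prim (swirlKernel m w) y - w y ^ 2 / 2)) / y) y := by
  obtain ⟨M, a, b, α, hE, c, S, hS⟩ := exists_exponents hm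
  obtain ⟨C₀, hV⟩ := hE.lipBd_swirlKernel
  have hα := hE.α_pos
  have hκ := hV.prim hα
  set C := C₀ / α with hCdef
  have hc := hS.nonneg
  -- The sign of the constant is read off from the bound at w = 0.
  have hC : 0 ≤ C := ((hκ (fun _ => 0) (fun _ => 0) 0 ?_ ?_ ?_).1).nonneg
  rotate_left
  · exact ⟨continuousOn_const, fun y hy => by have := hy.1; simp; positivity⟩
  · exact ⟨continuousOn_const, fun y hy => by have := hy.1; simp; positivity⟩
  · exact ⟨by simpa using continuousOn_const, fun y hy => by simp⟩
  have h3 : (0 : ℝ) < 3 ^ α := by positivity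
  -- The radius δ makes the quadratic term contribute at most 1/4 to the contraction factor; then e
  -- makes the swirl term at most δ/4, so that it respects the ball of radius δ and also contributes
  -- at most 1/4.
  obtain ⟨δ, hδ0, hδ1, hδ⟩ : ∃ δ : ℝ, 0 < δ ∧ δ ≤ 1 ∧ c * δ * 3 ^ α ≤ 1 / 4 := by
    refine ⟨min 1 (1 / (4 * (c + 1) * 3 ^ α)), lt_min one_pos (by positivity), min_le_left _ _, ?_⟩
    calc c * min 1 (1 / (4 * (c + 1) * 3 ^ α)) * 3 ^ α ≤
          (c + 1) * (1 / (4 * (c + 1) * 3 ^ α)) * 3 ^ α := by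
          gcongr
          · linarith
          · exact min_le_right _ _
      _ = 1 / 4 := by field_simp
  obtain ⟨e, he0, he⟩ : ∃ e : ℝ, 0 < e ∧ c * (e * C) ≤ δ / 4 := by
    refine ⟨δ / (4 * (c + 1) * (C + 1)), by positivity, ?_⟩
    calc c * (δ / (4 * (c + 1) * (C + 1)) * C) ≤
          (c + 1) * (δ / (4 * (c + 1) * (C + 1)) * (C + 1)) := by
          gcongr <;> linarith
      _ = δ / 4 := by field_simp
  have hin : ∀ w, PowBd α δ w →
      PowBd α (e * C + δ ^ 2 * 3 ^ α / 2) (fun y => e * prim (swirlKernel m w) y - w y ^ 2 / 2) := by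
    intro w hw
    have hw1 := hw.mono hδ1
    have hk := (hκ w w 0 hw1 hw1 ⟨by simpa using continuousOn_const, fun y hy => by simp⟩).1
    have hsq := ((hw.mul hw).weaken (show α ≤ α + α by linarith)).const_mul (1 / 2)
    refine (((hk.const_mul e).sub hsq).congr fun y _ => ?_).mono (le_of_eq ?_)
    · simp only
      ring
    · rw [abs_of_pos he0, abs_of_pos (by norm_num : (0 : ℝ) < 1 / 2), add_sub_cancel_right]
      ring
  obtain ⟨w, hw, hfix⟩ := exists_fixedPoint (α := α) hδ0.le
    (fun w => S fun y => e * prim (swirlKernel m w) y - w y ^ 2 / 2)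
    (fun w hw => (hS.bound (hin w hw)).mono (by nlinarith [mul_nonneg hc h3.le]))
    (fun w₁ w₂ d h₁ h₂ hd => by
      have hd0 := hd.nonneg
      have hk := (hκ w₁ w₂ d (h₁.mono hδ1) (h₂.mono hδ1) hd).2
      have hsq := ((hd.mul (h₁.add h₂)).weaken (show α ≤ α + α by linarith)).const_mul (1 / 2)
      have hdiff : PowBd α (e * (C * d) + d * δ * 3 ^ α)
          (fun y => (e * prim (swirlKernel m w₁) y - w₁ y ^ 2 / 2) -
            (e * prim (swirlKernel m w₂) y - w₂ y ^ 2 / 2)) := by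
        refine (((hk.const_mul e).sub hsq).congr fun y _ => ?_).mono (le_of_eq ?_)
        · simp only
          ring
        · rw [abs_of_pos he0, abs_of_pos (by norm_num : (0 : ℝ) < 1 / 2), add_sub_cancel_right]
          ring
      refine ((hS.bound hdiff).mono ?_).congr fun y hy => hS.sub (hin _ h₁) (hin _ h₂) y hy
      have e1 : c * (e * C) * d ≤ 1 / 4 * d := mul_le_mul_of_nonneg_right (by linarith) hd0
      have e2 : c * δ * 3 ^ α * d ≤ 1 / 4 * d := mul_le_mul_of_nonneg_right hδ hd0
      linarith)
  have hw1 := hw.mono hδ1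
  refine ⟨α, e, w, hα, he0, hw1, ⟨C₀, (hV w w 0 hw1 hw1
    ⟨by simpa using continuousOn_const, fun y hy => by simp⟩).1⟩, fun y hy => ?_⟩
  have hd := hS.hasDerivAt (hin w hw) y hy
  refine (hd.congr_of_eventuallyEq (hfix.eventuallyEq_of_mem (isOpen_Ioo.mem_nhds hy))).congr_deriv
    ?_
  rw [← hfix hy]

lemma PowBd.contDiffOn_prim {a C : ℝ} {φ : ℝ → ℝ} (h : PowBd (a - 1) C φ) (ha : 0 < a) {n : ℕ}
    (hφ : ContDiffOn ℝ n φ (Ioo 0 3)) : ContDiffOn ℝ n (AxisymNS.prim φ) (Ioo 0 3) := by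
  have h1 : ContDiffOn ℝ (n + 1) (AxisymNS.prim φ) (Ioo 0 3) := by
    rw [contDiffOn_succ_iff_deriv_of_isOpen isOpen_Ioo]
    exact ⟨fun y hy => (h.hasDerivAt_prim ha hy).differentiableAt.differentiableWithinAt, by simp,
      hφ.congr fun y hy => (h.hasDerivAt_prim ha hy).deriv⟩
  exact h1.of_le (by norm_cast; omega)

/-! ### Smoothness and the construction of swirling profiles. -/

section smooth

variable {m α : ℝ} {w : ℝ → ℝ}

lemma contDiffOn_swirlSlope (hα : 0 < α) (hw : PowBd α 1 w) {n : ℕ}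
    (h : ContDiffOn ℝ n w (Ioo 0 3)) : ContDiffOn ℝ n (swirlSlope m w) (Ioo 0 3) := by
  have h1 : ContDiffOn ℝ n (fun s => w s / s) (Ioo 0 3) :=
    h.div contDiffOn_id fun y hy => hy.1.ne'
  have h2 := hw.div_id.contDiffOn_prim hα h1
  exact ContDiffOn.mul (fun y hy => (Real.contDiffAt_rpow_const_of_ne hy.1.ne').contDiffWithinAt)
    (Real.contDiff_exp.comp_contDiffOn h2.neg)

lemma contDiffOn_swirlMean (hα : 0 < α) (hw : PowBd α 1 w) {n : ℕ}
    (h : ContDiffOn ℝ n w (Ioo 0 3)) : ContDiffOn ℝ n (swirlMean m w) (Ioo 0 3) :=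
  contDiffOn_avg n continuous_const (contDiffOn_swirlSlope hα hw h)

lemma contDiffOn_swirlSource (hα : 0 < α) (hw : PowBd α 1 w) {n : ℕ}
    (h : ContDiffOn ℝ n w (Ioo 0 3)) : ContDiffOn ℝ n (swirlSource m w) (Ioo 0 3) :=
  ((contDiffOn_swirlMean hα hw h).mul (contDiffOn_swirlSlope hα hw h)).div contDiffOn_id
    fun _ hy => hy.1.ne'

lemma contDiffOn_swirlKernel (hα : 0 < α) (hw : PowBd α 1 w) {n : ℕ}
    (h : ContDiffOn ℝ n w (Ioo 0 3)) : ContDiffOn ℝ n (swirlKernel m w) (Ioo 0 3) :=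
  contDiffOn_avg n (by fun_prop) (contDiffOn_swirlSource hα hw h)

/-- Bootstrapping: the equation expresses w' through w and integral functionals that preserve n-fold
differentiability, so each pass gains one derivative. -/
lemma contDiffOn_reduced_solution {e C : ℝ} (hα : 0 < α) (hw : PowBd α 1 w)
    (hV : PowBd (α - 1) C (swirlKernel m w))
    (hd : ∀ y ∈ Ioo (0 : ℝ) 3, HasDerivAt w
      (((1 - m) * w y + (e * prim (swirlKernel m w) y - w y ^ 2 / 2)) / y) y) (n : ℕ) :
    ContDiffOn ℝ n w (Ioo 0 3) := by
  induction n with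
  | zero => exact contDiffOn_zero.2 hw.cont
  | succ n ih =>
    push_cast
    rw [contDiffOn_succ_iff_deriv_of_isOpen isOpen_Ioo]
    refine ⟨fun y hy => (hd y hy).differentiableAt.differentiableWithinAt, by simp, ?_⟩
    have hκ := hV.contDiffOn_prim hα (contDiffOn_swirlKernel hα hw ih)
    have : ContDiffOn ℝ n (fun y => ((1 - m) * w y +
        (e * prim (swirlKernel m w) y - w y ^ 2 / 2)) / y) (Ioo 0 3) :=
      ((contDiffOn_const.mul ih).add ((contDiffOn_const.mul hκ).sub
        ((ih.pow 2).div_const 2))).div contDiffOn_id fun y hy => hy.1.ne'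
    exact this.congr fun y hy => (hd y hy).deriv

lemma hasDerivAt_swirlSlope (hα : 0 < α) (hw : PowBd α 1 w) {y : ℝ} (hy : y ∈ Ioo (0 : ℝ) 3) :
    HasDerivAt (swirlSlope m w) (-((m + w y) * swirlSlope m w y / y)) y := by
  have hy0 := hy.1
  refine ((Real.hasDerivAt_rpow_const (p := -m) (Or.inl hy0.ne')).fun_mul
    (hw.div_id.hasDerivAt_prim hα hy).fun_neg.exp).congr_deriv ?_
  rw [Real.rpow_sub_one hy0.ne', swirlSlope]
  field_simp
  ring

end smooth

lemma hasDerivAt_integral_to_two {φ : ℝ → ℝ} (hφ : ContinuousOn φ (Ioo 0 3)) {y : ℝ}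
    (hy : y ∈ Ioo (0 : ℝ) 3) : HasDerivAt (fun y => ∫ s in y..2, φ s) (-φ y) y :=
  intervalIntegral.integral_hasDerivAt_left
    ((hφ.mono (ordConnected_Ioo.uIcc_subset hy two_mem)).intervalIntegrable)
    (hφ.stronglyMeasurableAtFilter isOpen_Ioo y hy)
    (hφ.continuousAt (isOpen_Ioo.mem_nhds hy))

lemma mul_avg_one (φ : ℝ → ℝ) (y : ℝ) :
    (2 - y) * avg (fun _ => 1) φ y = ∫ s in y..2, φ s := by
  have := intervalIntegral.mul_integral_comp_mul_add (f := φ) (a := 0) (b := 1) (2 - y) y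
  simp only [mul_zero, zero_add, mul_one, sub_add_cancel] at this
  rw [← this]
  unfold avg
  congr 2
  ext σ
  rw [one_mul]
  congr 1
  ring

/-- The substitution s = y + σ (2 - y) turns the weight into (s - y)(2 - s) / (2 - y)². Expanding s
- y leaves integrals whose only dependence on y is the lower limit, which are easy to differentiate.
-/
lemma mul_avg_parabola {φ : ℝ → ℝ} (hφ : ContinuousOn φ (Ioo 0 3)) {y : ℝ}
    (hy : y ∈ Ioo (0 : ℝ) 3) :
    (2 - y) ^ 3 * avg (fun σ => σ * (1 - σ)) φ y =
      (∫ s in y..2, s * ((2 - s) * φ s)) - y * ∫ s in y..2, (2 - s) * φ s := by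
  have h1 := intervalIntegral.mul_integral_comp_mul_add
    (f := fun s => (s - y) * ((2 - s) * φ s)) (a := 0) (b := 1) (2 - y) y
  simp only [mul_zero, zero_add, mul_one, sub_add_cancel] at h1
  have hsub := ordConnected_Ioo.uIcc_subset hy two_mem
  have i1 : IntervalIntegrable (fun s => (2 - s) * φ s) MeasureTheory.volume y 2 :=
    (ContinuousOn.mul (by fun_prop) (hφ.mono hsub)).intervalIntegrable
  have i2 : IntervalIntegrable (fun s => s * ((2 - s) * φ s)) MeasureTheory.volume y 2 :=
    (continuousOn_id.mul (ContinuousOn.mul (by fun_prop) (hφ.mono hsub))).intervalIntegrable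
  rw [← intervalIntegral.integral_const_mul, ← intervalIntegral.integral_sub i2 (i1.const_mul y)]
  simp only [← sub_mul]
  rw [← h1]
  unfold avg
  rw [← intervalIntegral.integral_const_mul, ← intervalIntegral.integral_const_mul]
  congr 1
  ext σ
  rw [show y + σ * (2 - y) = (2 - y) * σ + y by ring]
  ring

/-- For every `m < 3 / 2` there is a swirling pair of profiles with `U_θ = (1 - x) ψ`,
`U_φ = (1 - x) γ` and `ψ(-1) = m`, smooth across the north pole. -/
theorem exists_swirling_profile {m : ℝ} (hm : m < 3 / 2) : ∃ ψ γ : ℝ → ℝ,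
    ContDiffOn ℝ ∞ ψ (Ioo (-1) 2) ∧ ContDiffOn ℝ ∞ γ (Ioo (-1) 2) ∧
    ProfileEquations (fun x => (1 - x) * ψ x) (fun x => (1 - x) * γ x) ∧
    Tendsto ψ (𝓝[>] (-1)) (𝓝 m) ∧ γ 0 ≠ 0 := by
  obtain ⟨α, e, w, hα, he, hw, ⟨C, hV⟩, hd⟩ := exists_reduced_solution hm
  have hwn := contDiffOn_reduced_solution hα hw hV hd
  have hws : ContDiffOn ℝ ∞ w (Ioo 0 3) := contDiffOn_infty.2 hwn
  have hGs : ContDiffOn ℝ ∞ (swirlSlope m w) (Ioo 0 3) :=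
    contDiffOn_infty.2 fun n => contDiffOn_swirlSlope hα hw (hwn n)
  have hΓs : ContDiffOn ℝ ∞ (swirlMean m w) (Ioo 0 3) :=
    contDiffOn_infty.2 fun n => contDiffOn_swirlMean hα hw (hwn n)
  have hRs : ContDiffOn ℝ ∞ (swirlSource m w) (Ioo 0 3) :=
    contDiffOn_infty.2 fun n => contDiffOn_swirlSource hα hw (hwn n)
  -- The amplitude of the swirl: the source is quadratic in it, with e = 2 ε².
  set ε := √(e / 2) with hε
  have hε2 : ε ^ 2 = e / 2 := Real.sq_sqrt (by positivity)
  have hε0 : 0 < ε := Real.sqrt_pos.2 (by positivity)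
  have hmaps : MapsTo (fun x : ℝ => 1 + x) (Ioo (-1) 2) (Ioo 0 3) := fun x hx =>
    ⟨by linarith [hx.1], by linarith [hx.2]⟩
  have hsm : ∀ {φ : ℝ → ℝ}, ContDiffOn ℝ ∞ φ (Ioo 0 3) →
      ContDiffOn ℝ ∞ (fun x => φ (1 + x)) (Ioo (-1) 2) := fun hφ =>
    hφ.comp (by fun_prop) hmaps
  have hsub : Ioo (-1 : ℝ) 1 ⊆ Ioo (-1) 2 := Ioo_subset_Ioo le_rfl (by norm_num)
  have hψ : ContDiffOn ℝ ∞ (fun x => m + w (1 + x)) (Ioo (-1) 2) := contDiffOn_const.add (hsm hws)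
  have hγ : ContDiffOn ℝ ∞ (fun x => -ε * swirlMean m w (1 + x)) (Ioo (-1) 2) :=
    contDiffOn_const.mul (hsm hΓs)
  have hmem : ∀ x ∈ Ioo (-1 : ℝ) 1, 1 + x ∈ Ioo (0 : ℝ) 3 := fun x hx => hmaps (hsub hx)
  refine ⟨fun x => m + w (1 + x), fun x => -ε * swirlMean m w (1 + x), hψ, hγ, ?_, ?_, ?_⟩
  · have dt : ∀ x : ℝ, HasDerivAt (fun x : ℝ => 1 - x) (-1) x := fun x =>
      (hasDerivAt_id' x).const_sub 1
    have dg : EqOn (deriv fun x => (1 - x) * (-ε * swirlMean m w (1 + x)))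
        (fun x => ε * swirlSlope m w (1 + x)) (Ioo (-1) 1) := by
      refine deriv_eq_of_eqOn isOpen_Ioo (ψ := fun x => -ε * ∫ s in (1 + x)..2, swirlSlope m w s)
        (fun x _ => ?_) fun x hx => ?_
      · simp only
        rw [← mul_avg_one]
        simp only [swirlMean]
        ring
      · refine ((hasDerivAt_integral_to_two hGs.continuousOn (hmem x hx)).comp_const_add
          1 x |>.const_mul (-ε)).congr_deriv ?_
        ring
    have dg2 : EqOn (deriv (deriv fun x => (1 - x) * (-ε * swirlMean m w (1 + x))))
        (fun x => ε * -((m + w (1 + x)) * swirlSlope m w (1 + x) / (1 + x))) (Ioo (-1) 1) :=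
      deriv_eq_of_eqOn isOpen_Ioo dg fun x hx =>
        ((hasDerivAt_swirlSlope hα hw (hmem x hx)).comp_const_add 1 x).const_mul ε
    -- the first integral of the meridian equation
    have r0 : EqOn (riccatiForm fun x => (1 - x) * (m + w (1 + x))) (fun x => (1 - x) ^ 2 *
        (e * prim (swirlKernel m w) (1 + x) + (m ^ 2 / 2 - m))) (Ioo (-1) 1) := by
      intro x hx
      have hx1 : 1 + x ≠ 0 := (hmem x hx).1.ne'
      have := ((dt x).fun_mul (((hd _ (hmem x hx)).comp_const_add 1 x).const_add m)).deriv
      simp only [riccatiForm, this]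
      field_simp
      ring
    have hRc := hRs.continuousOn
    have hR1 : ContinuousOn (fun s => (2 - s) * swirlSource m w s) (Ioo 0 3) :=
      ContinuousOn.mul (by fun_prop) hRc
    have hR2 : ContinuousOn (fun s => s * ((2 - s) * swirlSource m w s)) (Ioo 0 3) :=
      continuousOn_id.mul hR1
    set I₁ : ℝ → ℝ := fun y => ∫ s in y..2, (2 - s) * swirlSource m w s with hI₁
    set I₂ : ℝ → ℝ := fun y => ∫ s in y..2, s * ((2 - s) * swirlSource m w s) with hI₂
    have dI₁ : ∀ x ∈ Ioo (-1 : ℝ) 1, HasDerivAt (fun x => I₁ (1 + x))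
        (-((1 - x) * swirlSource m w (1 + x))) x := fun x hx =>
      ((hasDerivAt_integral_to_two hR1 (hmem x hx)).comp_const_add 1 x).congr_deriv (by ring)
    have dI₂ : ∀ x ∈ Ioo (-1 : ℝ) 1, HasDerivAt (fun x => I₂ (1 + x))
        (-((1 + x) * ((1 - x) * swirlSource m w (1 + x)))) x := fun x hx =>
      ((hasDerivAt_integral_to_two hR2 (hmem x hx)).comp_const_add 1 x).congr_deriv (by ring)
    -- Away from the north pole the kernel has this explicit form, whose derivatives close up: I₂ -
    -- y I₁ has derivative -I₁, and I₁ has derivative -(2 - y) times the source. After three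
    -- differentiations of the Riccati form only the source remains.
    have hker : ∀ x ∈ Ioo (-1 : ℝ) 1, swirlKernel m w (1 + x) =
        (I₂ (1 + x) - (1 + x) * I₁ (1 + x)) / (1 - x) ^ 3 := by
      intro x hx
      have hx1 : 1 - x ≠ 0 := by linarith [hx.2]
      rw [eq_div_iff (pow_ne_zero 3 hx1), ← mul_avg_parabola hRc (hmem x hx)]
      simp only [swirlKernel]
      ring
    have dκ : ∀ x ∈ Ioo (-1 : ℝ) 1, HasDerivAt (fun x => prim (swirlKernel m w) (1 + x))
        ((I₂ (1 + x) - (1 + x) * I₁ (1 + x)) / (1 - x) ^ 3) x := fun x hx => by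
      rw [← hker x hx]
      exact (hV.hasDerivAt_prim hα (hmem x hx)).comp_const_add 1 x
    have r1 : EqOn (deriv (riccatiForm fun x => (1 - x) * (m + w (1 + x))))
        (fun x => -2 * (1 - x) * (e * prim (swirlKernel m w) (1 + x) + (m ^ 2 / 2 - m)) +
          e * (I₂ (1 + x) - (1 + x) * I₁ (1 + x)) / (1 - x)) (Ioo (-1) 1) := by
      refine deriv_eq_of_eqOn isOpen_Ioo r0 fun x hx => ?_
      have hx1 : 1 - x ≠ 0 := by linarith [hx.2]
      refine (((dt x).fun_pow 2).fun_mul (((dκ x hx).const_mul e).add_const _)).congr_deriv ?_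
      field_simp
      ring
    have dW : ∀ x ∈ Ioo (-1 : ℝ) 1, HasDerivAt (fun x => I₂ (1 + x) - (1 + x) * I₁ (1 + x))
        (-I₁ (1 + x)) x := fun x hx =>
      ((dI₂ x hx).fun_sub (((hasDerivAt_id' x).const_add 1).fun_mul (dI₁ x hx))).congr_deriv
        (by ring)
    have r2 : EqOn (deriv (deriv (riccatiForm fun x => (1 - x) * (m + w (1 + x)))))
        (fun x => 2 * (e * prim (swirlKernel m w) (1 + x) + (m ^ 2 / 2 - m)) -
          e * (I₂ (1 + x) - (1 + x) * I₁ (1 + x)) / (1 - x) ^ 2 - e * I₁ (1 + x) / (1 - x))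
        (Ioo (-1) 1) := by
      refine deriv_eq_of_eqOn isOpen_Ioo r1 fun x hx => ?_
      have hx1 : 1 - x ≠ 0 := by linarith [hx.2]
      refine ((((dt x).const_mul (-2)).fun_mul (((dκ x hx).const_mul e).add_const _)).fun_add
        (((dW x hx).const_mul e).fun_div (dt x) hx1)).congr_deriv ?_
      field_simp
      ring
    have r3 : EqOn (deriv (deriv (deriv (riccatiForm fun x => (1 - x) * (m + w (1 + x))))))
        (fun x => e * swirlSource m w (1 + x)) (Ioo (-1) 1) := by
      refine deriv_eq_of_eqOn isOpen_Ioo r2 fun x hx => ?_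
      have hx1 : 1 - x ≠ 0 := by linarith [hx.2]
      refine (((((dκ x hx).const_mul e).add_const _).const_mul 2 |>.fun_sub
        (((dW x hx).const_mul e).fun_div ((dt x).fun_pow 2) (pow_ne_zero 2 hx1))).fun_sub
        (((dI₁ x hx).const_mul e).fun_div (dt x) hx1)).congr_deriv ?_
      field_simp
      ring
    refine ⟨?_, ?_, fun x hx => ?_, fun x hx => ?_⟩
    · exact ContDiffOn.mul (by fun_prop) (hψ.mono hsub)
    · exact ContDiffOn.mul (by fun_prop) (hγ.mono hsub)
    · have hx1 : 1 + x ≠ 0 := (hmem x hx).1.ne'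
      rw [dg2 hx, dg hx]
      field_simp
      ring
    · have hx1 : 1 + x ≠ 0 := (hmem x hx).1.ne'
      have hx2 : 1 - x ≠ 0 := by linarith [hx.2]
      rw [r3 hx, dg hx, show (1 : ℝ) - x ^ 2 = (1 - x) * (1 + x) by ring]
      have he' : e = 2 * ε ^ 2 := by linarith
      simp only [swirlSource]
      rw [he']
      field_simp
      ring
  · have h0 : Tendsto w (𝓝[>] 0) (𝓝 0) := by
      have h1 : Tendsto (fun y : ℝ => 1 * y ^ α) (𝓝[>] 0) (𝓝 0) := by
        have := (Real.continuousAt_rpow_const 0 α (Or.inr hα.le)).tendsto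
        rw [Real.zero_rpow hα.ne'] at this
        simpa using this.mono_left nhdsWithin_le_nhds
      refine squeeze_zero_norm' ?_ h1
      filter_upwards [Ioo_mem_nhdsGT (show (0 : ℝ) < 3 by norm_num)] with y hy using hw.bound y hy
    have ht : Tendsto (fun x : ℝ => 1 + x) (𝓝[>] (-1)) (𝓝[>] 0) := by
      refine tendsto_nhdsWithin_iff.2 ⟨?_, ?_⟩
      · have : Continuous fun x : ℝ => 1 + x := by fun_prop
        simpa using (this.tendsto (-1)).mono_left nhdsWithin_le_nhds
      · filter_upwards [self_mem_nhdsWithin] with x hx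
        have : -1 < x := hx
        show (0 : ℝ) < 1 + x
        linarith
    simpa using (h0.comp ht).const_add m
  · have hpos : 0 < swirlMean m w (1 + 0) := by
      have h1 := mul_avg_one (swirlSlope m w) (1 + 0)
      have h2 : 0 < ∫ s in (1 + 0 : ℝ)..2, swirlSlope m w s := by
        refine intervalIntegral.intervalIntegral_pos_of_pos_on ?_ (fun s hs => ?_) (by norm_num)
        · refine (hGs.continuousOn.mono ?_).intervalIntegrable
          exact ordConnected_Ioo.uIcc_subset (by norm_num) two_mem
        · have : 0 < s := by linarith [hs.1]
          unfold swirlSlope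
          positivity
      rw [← h1] at h2
      exact pos_of_mul_pos_right h2 (by norm_num)
    have := mul_pos hε0 hpos
    simp only
    linarith

/-! ### From profiles to solutions on the slit space. -/

lemma cosPolar_mem_Ioc {y : R3} (hy : y ∈ slitSpace) : cosPolar y ∈ Ioc (-1 : ℝ) 1 := by
  have h0 : 0 < ‖y‖ := norm_pos_iff.2 (ne_zero_of_mem_slitSpace hy)
  have h1 := norm_sq_eq y
  by_cases h : y ∈ offAxis
  · exact ⟨(cosPolar_mem_Ioo h).1, (cosPolar_mem_Ioo h).2.le⟩
  · have h2 : y 0 ^ 2 + y 1 ^ 2 ≤ 0 := not_lt.1 h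
    have e0 : y 0 = 0 := pow_eq_zero_iff two_ne_zero |>.1
      (by nlinarith [sq_nonneg (y 0), sq_nonneg (y 1)])
    have e1 : y 1 = 0 := pow_eq_zero_iff two_ne_zero |>.1
      (by nlinarith [sq_nonneg (y 0), sq_nonneg (y 1)])
    have e2 : 0 < y 2 := not_le.1 fun h' => hy ⟨e0, e1, h'⟩
    have e3 : ‖y‖ = y 2 := (sq_eq_sq₀ h0.le e2.le).1 (by rw [h1, e0, e1]; ring)
    rw [cosPolar, e3, div_self e2.ne']
    norm_num

lemma hom_smul (k : ℕ) (η : ℝ → ℝ) (y : R3) {c : ℝ} (hc : 0 < c) :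
    hom k η (c • y) = (c ^ k)⁻¹ * hom k η y := by
  have h : cosPolar (c • y) = cosPolar y := by
    simp only [cosPolar, norm_smul, Real.norm_of_nonneg hc.le, PiLp.smul_apply, smul_eq_mul]
    exact mul_div_mul_left _ _ hc.ne'
  rw [hom, hom, h, norm_smul, Real.norm_of_nonneg hc.le, mul_pow, mul_inv, mul_assoc]

lemma axiField_smul (α β ζ : ℝ → ℝ) (y : R3) {c : ℝ} (hc : 0 < c) :
    axiField α β ζ (c • y) = c⁻¹ • axiField α β ζ y := by
  have h := hc.ne'
  ext k
  fin_cases k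
  · show axiField α β ζ (c • y) 0 = c⁻¹ * axiField α β ζ y 0
    rw [axiField_zero, axiField_zero, hom_smul _ _ _ hc, hom_smul _ _ _ hc]
    simp only [PiLp.smul_apply, smul_eq_mul]
    field_simp
  · show axiField α β ζ (c • y) 1 = c⁻¹ * axiField α β ζ y 1
    rw [axiField_one, axiField_one, hom_smul _ _ _ hc, hom_smul _ _ _ hc]
    simp only [PiLp.smul_apply, smul_eq_mul]
    field_simp
  · show axiField α β ζ (c • y) 2 = c⁻¹ * axiField α β ζ y 2
    rw [axiField_two, axiField_two, hom_smul _ _ _ hc, pow_one]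

lemma norm_eR (θ φ : ℝ) : ‖eR θ φ‖ = 1 := by
  have h : ‖eR θ φ‖ ^ 2 = 1 := by
    rw [norm_sq_eq]
    simp only [eR]
    simp
    nlinarith [Real.sin_sq_add_cos_sq θ, Real.sin_sq_add_cos_sq φ]
  exact (pow_eq_one_iff_of_nonneg (norm_nonneg _) two_ne_zero).1 h

lemma isAxisymmetric_axiField (α β ζ : ℝ → ℝ) : IsAxisymmetric (axiField α β ζ) := by
  have key : ∀ k η θ φ, hom k η (eR θ φ) = η (Real.cos θ) := fun k η θ φ => by
    have h : eR θ φ 2 = Real.cos θ := rfl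
    simp [hom, norm_eR, cosPolar, h]
  have h0 : ∀ θ φ, axiField α β ζ (eR θ φ) = !₂[Real.sin θ * (Real.cos φ * α (Real.cos θ) -
      Real.sin φ * β (Real.cos θ)), Real.sin θ * (Real.sin φ * α (Real.cos θ) +
      Real.cos φ * β (Real.cos θ)), ζ (Real.cos θ)] := fun θ φ => by
    simp only [axiField, key]
    ext k
    fin_cases k <;> simp [eR] <;> ring
  intro r hr θ _ φ φ'
  have hcs := Real.sin_sq_add_cos_sq
  have h1 : ∀ φ, compR (axiField α β ζ) r θ φ = r⁻¹ * (Real.sin θ ^ 2 * α (Real.cos θ) +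
      Real.cos θ * ζ (Real.cos θ)) := fun φ => by
    rw [compR, axiField_smul _ _ _ _ hr, h0, inner_smul_left]
    simp [eR, PiLp.inner_apply, Fin.sum_univ_three]
    left
    linear_combination (Real.sin θ ^ 2 * α (Real.cos θ)) * hcs φ
  have h2 : ∀ φ, compTheta (axiField α β ζ) r θ φ = r⁻¹ * (Real.sin θ * (Real.cos θ *
      α (Real.cos θ) - ζ (Real.cos θ))) := fun φ => by
    rw [compTheta, axiField_smul _ _ _ _ hr, h0, inner_smul_left]
    simp [eTheta, PiLp.inner_apply, Fin.sum_univ_three]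
    left
    linear_combination (Real.sin θ * Real.cos θ * α (Real.cos θ)) * hcs φ
  have h3 : ∀ φ, compPhi (axiField α β ζ) r θ φ = r⁻¹ * (Real.sin θ * β (Real.cos θ)) :=
    fun φ => by
    rw [compPhi, axiField_smul _ _ _ _ hr, h0, inner_smul_left]
    simp [ePhi, PiLp.inner_apply, Fin.sum_univ_three]
    left
    linear_combination (Real.sin θ * β (Real.cos θ)) * hcs φ
  simp only [h1, h2, h3, and_self]

/-- A small shift in the first coordinate leaves the axis. -/
lemma slitSpace_subset_closure_offAxis : slitSpace ⊆ closure offAxis := by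
  intro y _
  have hc : Continuous fun t : ℝ => y + t • (EuclideanSpace.single 0 1 : R3) := by fun_prop
  have ht : Tendsto (fun t : ℝ => y + t • (EuclideanSpace.single 0 1 : R3)) (𝓝[≠] 0) (𝓝 y) := by
    simpa using (hc.tendsto 0).mono_left nhdsWithin_le_nhds
  refine mem_closure_of_tendsto ht ?_
  have h1 : ∀ᶠ t : ℝ in 𝓝[≠] 0, t ≠ - y 0 := by
    by_cases h : y 0 = 0
    · rw [h, neg_zero]
      exact self_mem_nhdsWithin
    · exact nhdsWithin_le_nhds (isOpen_ne.mem_nhds (by simpa [eq_comm] using h))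
  filter_upwards [h1] with t ht
  show 0 < (y + t • (EuclideanSpace.single 0 1 : R3)) 0 ^ 2 +
    (y + t • (EuclideanSpace.single 0 1 : R3)) 1 ^ 2
  have : y 0 + t ≠ 0 := fun h => ht (by linarith)
  simp
  positivity

/-- Equations that hold off the axis extend to the smooth part of the axis. -/
lemma eqOn_slitSpace_of_offAxis {h : R3 → ℝ} (hc : ContinuousOn h slitSpace)
    (h0 : ∀ y ∈ offAxis, h y = 0) : ∀ y ∈ slitSpace, h y = 0 := by
  have : EqOn h 0 slitSpace := EqOn.of_subset_closure (s := offAxis) (fun y hy => h0 y hy) hc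
    continuousOn_const offAxis_subset_slitSpace slitSpace_subset_closure_offAxis
  exact this

lemma contDiffOn_momentum {u : R3 → R3} {v : R3 → ℝ} {s : Set R3} (hs : IsOpen s)
    (hu : ContDiffOn ℝ ∞ u s) (hv : ContDiffOn ℝ ∞ v s) : ContDiffOn ℝ ∞ (momentum u v) s := by
  unfold momentum lap
  refine ContDiffOn.add (ContDiffOn.neg (ContDiffOn.sum fun i _ =>
    contDiffOn_pd hs (contDiffOn_pd hs hv))) (ContDiffOn.sum fun i _ => ?_)
  exact ((contDiff_coord i).comp_contDiffOn hu).mul (contDiffOn_pd hs hv)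

/-- The pressure profile is defined so that the component along the ray balances, and the meridian
equation makes its derivative balance the tangential component. Solving these two relations for the
radial and axial residuals gives the horizontal and vertical balances. -/
lemma IsProfile.solvesNavierStokes {f g α β ζ π : ℝ → ℝ} (h : IsProfile f g α β ζ)
    (hfg : ProfileEquations f g) (hπ : EqOn π (fun x => pressureForm f g x / 2) (Ioo (-1) 1))
    (hπs : ContDiffOn ℝ ∞ π (Ioo (-1) 1)) {y : R3} (hy : y ∈ offAxis) :
    (∀ j, momentum (axiField α β ζ) (fun z => axiField α β ζ z j) y + pd j (hom 2 π) y = 0) ∧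
      ∑ i, pd i (fun z => axiField α β ζ z i) y = 0 := by
  have hx := cosPolar_mem_Ioo hy
  have hs : swirlRes α β ζ (cosPolar y) = 0 := by
    rw [h.swirlRes_eq hx, hfg.swirl _ hx]
    simp
  obtain ⟨r1, r2⟩ := h.radialRes_axialRes hx
  have e1 : 2 * π (cosPolar y) = (1 - cosPolar y ^ 2) * radialRes α β ζ (cosPolar y) +
      cosPolar y * axialRes α ζ (cosPolar y) := by
    rw [r1, hπ hx]
    simp only [pressureForm]
    ring
  have e2 : deriv π (cosPolar y) = cosPolar y * radialRes α β ζ (cosPolar y) -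
      axialRes α ζ (cosPolar y) := by
    rw [deriv_eq_of_eqOn isOpen_Ioo hπ (fun x hx => (deriv_pressureForm h.smooth_f h.smooth_g
      hx).div_const 2) hx]
    beta_reduce
    rw [hfg.meridian _ hx, r2]
    ring
  have hrad : radialRes α β ζ (cosPolar y) + 2 * rhoOp 2 π (cosPolar y) = 0 := by
    simp only [rhoOp, e2]
    push_cast
    linear_combination -e1
  have hax : axialRes α ζ (cosPolar y) + zOp 2 π (cosPolar y) = 0 := by
    simp only [zOp, e2]
    push_cast
    linear_combination -cosPolar y * e1
  refine ⟨fun j => ?_, ?_⟩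
  · fin_cases j
    · show momentum _ (fun z => axiField α β ζ z 0) y + pd 0 (hom 2 π) y = 0
      rw [momentum_axiField_zero h.smooth_α h.smooth_β hy, hs,
        pd_hom_horizontal hπs hy (by decide), hom]
      linear_combination (‖y‖ ^ 4)⁻¹ * y 0 * hrad
    · show momentum _ (fun z => axiField α β ζ z 1) y + pd 1 (hom 2 π) y = 0
      rw [momentum_axiField_one h.smooth_α h.smooth_β hy, hs,
        pd_hom_horizontal hπs hy (by decide), hom]
      linear_combination (‖y‖ ^ 4)⁻¹ * y 1 * hrad
    · show momentum _ (fun z => axiField α β ζ z 2) y + pd 2 (hom 2 π) y = 0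
      rw [momentum_axiField_two h.smooth_ζ hy, pd_hom_two hπs hy, hom]
      linear_combination (‖y‖ ^ 3)⁻¹ * hax
  · rw [div_axiField h.smooth_α h.smooth_β h.smooth_ζ hy, h.divRes_eq hx, mul_zero]

/-- Profiles that are smooth up to the north pole define an axisymmetric solution. -/
lemma IsProfile.isAxisymmetricSolution {f g α β ζ π : ℝ → ℝ} (h : IsProfile f g α β ζ)
    (hfg : ProfileEquations f g) (hπ : EqOn π (fun x => pressureForm f g x / 2) (Ioo (-1) 1))
    {J : Set ℝ} (hJ : Ioc (-1) 1 ⊆ J) (sα : ContDiffOn ℝ ∞ α J) (sβ : ContDiffOn ℝ ∞ β J)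
    (sζ : ContDiffOn ℝ ∞ ζ J) (sπ : ContDiffOn ℝ ∞ π J) :
    IsAxisymmetricSolution (axiField α β ζ) (hom 2 π) := by
  have hsm : ∀ {k : ℕ} {η : ℝ → ℝ}, ContDiffOn ℝ ∞ η J → ContDiffOn ℝ ∞ (hom k η) slitSpace :=
    fun hη => contDiffOn_hom (fun _ hy => ne_zero_of_mem_slitSpace hy)
      (fun _ hy => hJ (cosPolar_mem_Ioc hy)) hη
  have hc : ∀ j : Fin 3, ContDiffOn ℝ ∞ (fun y : R3 => y j) slitSpace :=
    fun j => (contDiff_coord j).contDiffOn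
  have hu : ContDiffOn ℝ ∞ (axiField α β ζ) slitSpace := by
    refine contDiffOn_euclidean.2 fun j => ?_
    fin_cases j
    · exact ((hc 0).mul (hsm sα)).sub ((hc 1).mul (hsm sβ))
    · exact ((hc 1).mul (hsm sα)).add ((hc 0).mul (hsm sβ))
    · exact hsm sζ
  have huj : ∀ j, ContDiffOn ℝ ∞ (fun z => axiField α β ζ z j) slitSpace :=
    fun j => (contDiff_coord j).comp_contDiffOn hu
  have hp : ContDiffOn ℝ ∞ (hom 2 π) slitSpace := hsm sπ
  have ho := isOpen_slitSpace
  have heq := fun y (hy : y ∈ offAxis) => h.solvesNavierStokes hfg hπ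
    (sπ.mono (Ioo_subset_Ioc_self.trans hJ)) hy
  refine ⟨hu, hp, fun y _ c hc => axiField_smul _ _ _ _ hc, fun y _ c hc => hom_smul _ _ _ hc,
    isAxisymmetric_axiField _ _ _, fun y hy => (navierStokes_iff ho hu hy).2 ⟨fun j => ?_, ?_⟩⟩
  · exact eqOn_slitSpace_of_offAxis (h := fun y => momentum (axiField α β ζ)
      (fun z => axiField α β ζ z j) y + pd j (hom 2 π) y)
      ((contDiffOn_momentum ho hu (huj j)).add (contDiffOn_pd ho hp)).continuousOn
      (fun y hy => (heq y hy).1 j) y hy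
  · exact eqOn_slitSpace_of_offAxis (h := fun y => ∑ i, pd i (fun z => axiField α β ζ z i) y)
      (ContDiffOn.sum fun i _ => contDiffOn_pd ho (huj i)).continuousOn
      (fun y hy => (heq y hy).2) y hy

/-- Every value below `3` is attained at the south pole by a solution with nonzero swirl. -/
theorem exists_swirling_solution {τ : ℝ} (hτ : τ < 3) :
    ∃ (u : R3 → R3) (p : R3 → ℝ), IsAxisymmetricSolution u p ∧ UThetaAtSouth u τ ∧
      ∃ x ∈ Ioo (-1 : ℝ) 1, UPhi u x ≠ 0 := by
  -- The factor 1 - x equals 2 at the south pole, hence m = τ / 2.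
  obtain ⟨ψ, γ, hψ, hγ, hfg, hlim, hγ0⟩ := exists_swirling_profile (m := τ / 2) (by linarith)
  set f : ℝ → ℝ := fun x => (1 - x) * ψ x with hf
  set g : ℝ → ℝ := fun x => (1 - x) * γ x with hg
  have sf : ContDiffOn ℝ ∞ f (Ioo (-1) 2) := ContDiffOn.mul (by fun_prop) hψ
  have s1 := sf.deriv_infty isOpen_Ioo
  have s2 := s1.deriv_infty isOpen_Ioo
  have s3 := s2.deriv_infty isOpen_Ioo
  have hne : ∀ x ∈ Ioo (-1 : ℝ) 2, 1 + x ≠ 0 := fun x hx => by linarith [hx.1]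
  have sid : ContDiffOn ℝ ∞ (fun x : ℝ => x) (Ioo (-1) 2) := contDiffOn_id
  -- In α, β and the pressure profile the factor 1 - x is cancelled by hand, so the formulas remain
  -- smooth at x = 1, where 1 - x² vanishes.
  set α : ℝ → ℝ := fun x => deriv f x + x * ψ x / (1 + x) with hα
  set β : ℝ → ℝ := fun x => γ x / (1 + x) with hβ
  set ζ : ℝ → ℝ := fun x => x * deriv f x - f x with hζ
  set π : ℝ → ℝ := fun x => (-(1 - x ^ 2) * deriv (deriv (deriv f)) x +
    2 * x * deriv (deriv f) x - f x * deriv (deriv f) x - deriv f x ^ 2 -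
    (1 - x) * (ψ x ^ 2 + γ x ^ 2) / (1 + x)) / 2 with hπ
  have sα : ContDiffOn ℝ ∞ α (Ioo (-1) 2) := s1.add ((sid.mul hψ).div (by fun_prop) hne)
  have sβ : ContDiffOn ℝ ∞ β (Ioo (-1) 2) := hγ.div (by fun_prop) hne
  have sζ : ContDiffOn ℝ ∞ ζ (Ioo (-1) 2) := (sid.mul s1).sub sf
  have sπ : ContDiffOn ℝ ∞ π (Ioo (-1) 2) := by
    refine ContDiffOn.div_const (ContDiffOn.sub (by fun_prop) ?_) 2
    exact ContDiffOn.div (by fun_prop) (by fun_prop) hne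
  have hpr : IsProfile f g α β ζ := by
    refine ⟨hfg.smooth_f, hfg.smooth_g, fun x hx => ?_, fun x hx => ?_, fun x hx => rfl⟩
    all_goals
      have h1 : 1 - x ≠ 0 := by linarith [hx.2]
      have h2 : 1 + x ≠ 0 := by linarith [hx.1]
      simp only [hα, hβ, hf, hg]
      rw [show (1 : ℝ) - x ^ 2 = (1 - x) * (1 + x) by ring]
      field_simp
  have hπe : EqOn π (fun x => pressureForm f g x / 2) (Ioo (-1) 1) := fun x hx => by
    have h1 : 1 - x ≠ 0 := by linarith [hx.2]
    have h2 : 1 + x ≠ 0 := by linarith [hx.1]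
    have h3 : (f x ^ 2 + g x ^ 2) / (1 - x ^ 2) = (1 - x) * (ψ x ^ 2 + γ x ^ 2) / (1 + x) := by
      simp only [hf, hg]
      rw [show (1 : ℝ) - x ^ 2 = (1 - x) * (1 + x) by ring]
      field_simp
    simp only [hπ, pressureForm, h3]
  have hhom : ∀ k η x, x ∈ Ioo (-1 : ℝ) 1 → hom k η (meridian x) = η x := fun k η x hx => by
    simp [hom, norm_meridian hx, cosPolar_meridian hx]
  refine ⟨axiField α β ζ, hom 2 π, hpr.isAxisymmetricSolution hfg hπe (J := Ioo (-1) 2)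
    (fun x hx => ⟨hx.1, by linarith [hx.2]⟩) sα sβ sζ sπ, ?_, 0, by norm_num, ?_⟩
  · have hUt : ∀ x ∈ Ioo (-1 : ℝ) 1, f x = UTheta (axiField α β ζ) x := fun x hx => by
      have h2 : 1 + x ≠ 0 := by linarith [hx.1]
      have hsq := Real.mul_self_sqrt (one_sub_sq_pos hx).le
      rw [IsAxisymmetricSolution.UTheta_eq ⟨hx.1.le, hx.2.le⟩, axiField_zero, axiField_two,
        hhom _ _ _ hx, hhom _ _ _ hx, hhom _ _ _ hx]
      have h3 : f x = (1 - x ^ 2) * (x * α x - ζ x) := by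
        simp only [hα, hζ, hf]
        field_simp
        ring
      rw [h3]
      simp only [meridian]
      simp
      linear_combination -(x * α x - ζ x) * hsq
    have h1 : Tendsto f (𝓝[>] (-1)) (𝓝 τ) := by
      have hc : Continuous fun x : ℝ => 1 - x := by fun_prop
      have := ((hc.tendsto (-1)).mono_left nhdsWithin_le_nhds).mul hlim
      convert this using 2
      ring
    refine h1.congr' ?_
    filter_upwards [Ioo_mem_nhdsGT (show (-1 : ℝ) < 1 by norm_num)] with x hx using hUt x hx
  · have h0 : (0 : ℝ) ∈ Ioo (-1 : ℝ) 1 := by norm_num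
    rw [IsAxisymmetricSolution.UPhi_eq ⟨h0.1.le, h0.2.le⟩, axiField_one, hhom _ _ _ h0,
      hhom _ _ _ h0]
    simpa [meridian, hβ] using hγ0

end AxisymNS

theorem mainTheorem5 :
    (∀ τ : ℝ, τ < 3 →
      ∃ (u : AxisymNS.R3 → AxisymNS.R3) (p : AxisymNS.R3 → ℝ),
        AxisymNS.IsAxisymmetricSolution u p ∧
        AxisymNS.UThetaAtSouth u τ ∧
        ∃ x ∈ Set.Ioo (-1 : ℝ) 1, AxisymNS.UPhi u x ≠ 0) ∧
    (∀ (u : AxisymNS.R3 → AxisymNS.R3) (p : AxisymNS.R3 → ℝ),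
      AxisymNS.IsAxisymmetricSolution u p →
      ∃ a : ℝ, AxisymNS.UThetaAtSouth u a ∧
        (3 ≤ a → ∀ x ∈ Set.Ioc (-1 : ℝ) 1, AxisymNS.UPhi u x = 0)) := by
  exact ⟨fun _ hτ => AxisymNS.exists_swirling_solution hτ,
    fun _ _ h => h.exists_limit_south⟩
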